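/- Fix $m\ge 1$, vectors $\vec\beta_p\in\mathbb R^m$ ($p\ge 2$) with $\vec\beta_p=0$ for odd $p$ and $\sum_{p\ge2}2^p\vec\beta_p(j)^2<\infty$ for every $j$, a vector $\vec h\in\mathbb R^m$, and a positive semidefinite $m\times m$ matrix $Q$ with entries in $[-1,1]$ and diagonal entries $1$. Write $\odot$ and $A^{\circ k}$ for entrywise products and powers, $\langle A,B\rangle=\mathrm{Tr}(AB)$, $|A|=\det A$, and $$\xi'(A)=\sum_{p\ge2}p\,(\vec\beta_p\vec\beta_p^{T})\odot A^{\circ(p-1)},\qquad \xi''(A)=\sum_{p\ge2}p(p-1)\,(\vec\beta_p\vec\beta_p^{T})\odot A^{\circ(p-2)}.$$ Consider pairs $(x,\Phi)$ where $x(t)=\mu([0,t])$ for a probability measure $\mu$ on $[0,m]$, and $\Phi:[0,m]\to\mathbb R^{m\times m}$ is a path of positive semidefinite matrices, nondecreasing in the Loewner order, with $\Phi(0)=0$ and $\Phi(m)=Q$, such that $t_x:=\inf\{t\in[0,m]:x(t)=1\}<m$ and $|Q-\Phi(t_x)|>0$. For such a pair with $\Phi$ Lipschitz put $\hat\Phi(t)=\int_t^m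 x(s)\Phi'(s)\,ds$ and $$\mathscr C(x,\Phi)=\frac12\Big[\int_0^m x(t)\langle\xi'(\Phi(t))+\vec h\vec h^{T},\Phi'(t)\rangle\,dt+\log|\Phi(m)-\Phi(\hat T)|+\int_0^{\hat T}\langle\hat\Phi(t)^{-1},\Phi'(t)\rangle\,dt\Big],$$ where $\hat T\in(t_x,m)$ is any point with $|Q-\Phi(\hat T)|>0$ (the value does not depend on its choice). Let $\mathscr A_0$ be the class of such pairs for which $\Phi$ is $1$-Lipschitz (with respect to $\max_{i,j}|A_{ij}|$) and $\mathrm{Tr}\,\Phi(t)=t$ for all $t\in[0,m]$, and let $\mathscr A$ be the class of such pairs for which $\Phi$ is Lipschitz and continuously differentiable with Lipschitz derivative and $\mathrm{Tr}\,\Phi(t)=t$ for all $t\in\mathrm{supp}\,\mu$. Proposition (jump discontinuity of $\mu_P$). Let $(x,\Phi)$ minimize $\mathscr C$ over $\mathscr A_0$ or over $\mathscr A$, and let $\mu_P$ be the corresponding Parisi measure, $\mu_P([0,t])=x(t)$. Let $u_0\in\mathrm{supp}\,\mu_P$ be a point at which $\Phi$ is differentiable (relative to $[0,m]$; automatic for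 $\mathscr A$). If $$\langle\xi''(Q),\Phi'(u_0)^{\circ2}\rangle<\langle Q^{-1}\Phi'(u_0),Q^{-1}\Phi'(u_0)\rangle,$$ then $\mu_P$ has a jump discontinuity at $u_0$, that is, the one-sided limits of $t\mapsto\mu_P([0,t])$ at $u_0$ (with $\mu_P([0,t])=0$ for $t<0$) exist and differ. -/

import Mathlib

open Set Filter Topology MeasureTheory
open scoped Matrix NNReal

noncomputable section

namespace VectorSpin

/-- The pairing `⟨A, B⟩ = Tr (A B)`; on symmetric matrices it is the Frobenius inner product. -/
def pairing {m : ℕ} (A B : Matrix (Fin m) (Fin m) ℝ) : ℝ := (A * B).trace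

/-- `ξ'(A) = ∑_{p ≥ 2} p (β_p ⊗ β_p) ⊙ A^{∘(p-1)}`; the summation index is `k = p - 2`. -/
def xiD {m : ℕ} (β : ℕ → Fin m → ℝ) (A : Matrix (Fin m) (Fin m) ℝ) :
    Matrix (Fin m) (Fin m) ℝ :=
  Matrix.of fun i j =>
    ∑' k : ℕ, ((k : ℝ) + 2) * (β (k + 2) i * β (k + 2) j) * A i j ^ (k + 1)

/-- `ξ''(A) = ∑_{p ≥ 2} p (p - 1) (β_p ⊗ β_p) ⊙ A^{∘(p-2)}`; the index is `k = p - 2`. -/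
def xiDD {m : ℕ} (β : ℕ → Fin m → ℝ) (A : Matrix (Fin m) (Fin m) ℝ) :
    Matrix (Fin m) (Fin m) ℝ :=
  Matrix.of fun i j =>
    ∑' k : ℕ, ((k : ℝ) + 2) * ((k : ℝ) + 1) * (β (k + 2) i * β (k + 2) j) * A i j ^ k

/-- Inverse temperatures of a mixed even `p`-spin model (`β p j` is used for `p ≥ 2` only). -/
structure IsMixedEvenModel {m : ℕ} (β : ℕ → Fin m → ℝ) : Prop where
  even : ∀ p, 2 ≤ p → Odd p → ∀ j, β p j = 0
  summable : ∀ j, Summable fun p : ℕ => (2 : ℝ) ^ p * β p j ^ 2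

/-- The space of self-overlap constraints: positive semidefinite matrices with entries in
`[-1, 1]` and diagonal entries `1`. -/
structure IsConstraint {m : ℕ} (Q : Matrix (Fin m) (Fin m) ℝ) : Prop where
  posSemidef : Q.PosSemidef
  mem_Icc : ∀ i j, Q i j ∈ Icc (-1 : ℝ) 1
  diag : ∀ i, Q i i = 1

/-- The function `x(t) = μ([0, t])`. For a probability measure `μ` on `[0, m]` this is the
general nondecreasing right-continuous `x : [0, m] → [0, 1]` with `x(m) = 1`; it vanishes for
`t < 0`. -/
def distr (μ : Measure ℝ) (t : ℝ) : ℝ := μ.real (Icc 0 t)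

/-- `t_x = inf {t ∈ [0, m] | x(t) = 1}`. -/
def topPoint (m : ℕ) (μ : Measure ℝ) : ℝ := sInf {t : ℝ | t ∈ Icc (0 : ℝ) m ∧ distr μ t = 1}

/-- The derivative `Φ'(t)` of a matrix path on `[0, m]` (one-sided at the endpoints). -/
def pathDeriv {m : ℕ} (Φ : ℝ → Matrix (Fin m) (Fin m) ℝ) (t : ℝ) :
    Matrix (Fin m) (Fin m) ℝ :=
  Matrix.of fun i j => derivWithin (fun s => Φ s i j) (Icc (0 : ℝ) m) t

/-- `Φ̂(t) = ∫_t^m x(s) Φ'(s) ds`. -/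
def hatPath {m : ℕ} (μ : Measure ℝ) (Φ : ℝ → Matrix (Fin m) (Fin m) ℝ) (t : ℝ) :
    Matrix (Fin m) (Fin m) ℝ :=
  Matrix.of fun i j => ∫ s in t..(m : ℝ), distr μ s * pathDeriv Φ s i j

/-- The Crisanti-Sommers functional `𝒞(x, Φ)`, written with the auxiliary point `T`. -/
def crisantiSommers {m : ℕ} (β : ℕ → Fin m → ℝ) (h : Fin m → ℝ) (T : ℝ) (μ : Measure ℝ)
    (Φ : ℝ → Matrix (Fin m) (Fin m) ℝ) : ℝ :=
  (1 / 2) *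
    ((∫ t in (0 : ℝ)..m,
        distr μ t * pairing (xiD β (Φ t) + Matrix.vecMulVec h h) (pathDeriv Φ t))
      + Real.log (Φ m - Φ T).det
      + ∫ t in (0 : ℝ)..T, pairing (hatPath μ Φ t)⁻¹ (pathDeriv Φ t))

/-- Monotone paths of positive semidefinite matrices on `[0, m]` from `0` to `Q`. -/
structure IsMonotonePath {m : ℕ} (Q : Matrix (Fin m) (Fin m) ℝ)
    (Φ : ℝ → Matrix (Fin m) (Fin m) ℝ) : Prop where
  posSemidef : ∀ t ∈ Icc (0 : ℝ) m, (Φ t).PosSemidef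
  mono : ∀ s ∈ Icc (0 : ℝ) m, ∀ t ∈ Icc (0 : ℝ) m, s ≤ t → (Φ t - Φ s).PosSemidef
  zero : Φ 0 = 0
  top : Φ m = Q

/-- Monotone paths that are `1`-Lipschitz for the norm `max |A i j|` and have
`Trace Φ(t) = t`. -/
structure IsTracePath {m : ℕ} (Q : Matrix (Fin m) (Fin m) ℝ)
    (Φ : ℝ → Matrix (Fin m) (Fin m) ℝ) : Prop extends IsMonotonePath Q Φ where
  lipschitz : ∀ i j, LipschitzOnWith 1 (fun t => Φ t i j) (Icc (0 : ℝ) m)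
  trace : ∀ t ∈ Icc (0 : ℝ) m, (Φ t).trace = t

/-- Continuously differentiable Lipschitz monotone paths with Lipschitz derivative and
`Trace Φ(t) = t` for `t` in the support of `μ`. -/
structure IsSmoothPath {m : ℕ} (Q : Matrix (Fin m) (Fin m) ℝ) (μ : Measure ℝ)
    (Φ : ℝ → Matrix (Fin m) (Fin m) ℝ) : Prop extends IsMonotonePath Q Φ where
  contDiff : ∀ i j, ContDiffOn ℝ 1 (fun t => Φ t i j) (Icc (0 : ℝ) m)
  lipschitz : ∃ K : ℝ≥0, ∀ i j, LipschitzOnWith K (fun t => Φ t i j) (Icc (0 : ℝ) m)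
  lipschitz_deriv :
    ∃ K : ℝ≥0, ∀ i j, LipschitzOnWith K (fun t => pathDeriv Φ t i j) (Icc (0 : ℝ) m)
  trace : ∀ t ∈ μ.support, (Φ t).trace = t

/-- The standing conditions on a pair: `μ` is a probability measure on `[0, m]`, `t_x < m`
and `|Q - Φ(t_x)| > 0`. -/
structure IsPair {m : ℕ} (Q : Matrix (Fin m) (Fin m) ℝ) (μ : Measure ℝ)
    (Φ : ℝ → Matrix (Fin m) (Fin m) ℝ) : Prop where
  prob : IsProbabilityMeasure μ
  compl : μ (Icc (0 : ℝ) m)ᶜ = 0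
  topPoint_lt : topPoint m μ < m
  det_pos : 0 < (Q - Φ (topPoint m μ)).det

/-- Pairs whose path is `1`-Lipschitz with `Trace Φ(t) = t`. -/
def TracePair {m : ℕ} (Q : Matrix (Fin m) (Fin m) ℝ) (μ : Measure ℝ)
    (Φ : ℝ → Matrix (Fin m) (Fin m) ℝ) : Prop :=
  IsPair Q μ Φ ∧ IsTracePath Q Φ

/-- Pairs whose path is continuously differentiable with Lipschitz derivative. -/
def SmoothPair {m : ℕ} (Q : Matrix (Fin m) (Fin m) ℝ) (μ : Measure ℝ)
    (Φ : ℝ → Matrix (Fin m) (Fin m) ℝ) : Prop :=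
  IsPair Q μ Φ ∧ IsSmoothPath Q μ Φ

/-- The points `T` with `t_x < T < m` at which the functional can be written down. Its value
does not depend on the choice of such a `T`. -/
def IsCutoff {m : ℕ} (Q : Matrix (Fin m) (Fin m) ℝ) (μ : Measure ℝ)
    (Φ : ℝ → Matrix (Fin m) (Fin m) ℝ) (T : ℝ) : Prop :=
  topPoint m μ < T ∧ T < m ∧ 0 < (Q - Φ T).det

/-- `(μ, Φ)` minimizes the Crisanti-Sommers functional over the class `𝒜` of pairs. -/
def IsMinimizer {m : ℕ} (β : ℕ → Fin m → ℝ) (h : Fin m → ℝ) (Q : Matrix (Fin m) (Fin m) ℝ)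
    (𝒜 : Measure ℝ → (ℝ → Matrix (Fin m) (Fin m) ℝ) → Prop)
    (μ : Measure ℝ) (Φ : ℝ → Matrix (Fin m) (Fin m) ℝ) : Prop :=
  𝒜 μ Φ ∧ ∀ ν Ψ, 𝒜 ν Ψ → ∀ T S, IsCutoff Q μ Φ T → IsCutoff Q ν Ψ S →
    crisantiSommers β h T μ Φ ≤ crisantiSommers β h S ν Ψ

/-- `f` has a jump discontinuity at `a`: both one-sided limits exist and they differ. -/
def HasJumpAt (f : ℝ → ℝ) (a : ℝ) : Prop :=
  ∃ l r : ℝ, Tendsto f (𝓝[<] a) (𝓝 l) ∧ Tendsto f (𝓝[>] a) (𝓝 r) ∧ l ≠ r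

end VectorSpin

end

/-! Write `Ξ` for the primitive `potential` of `A ↦ ξ'(A) + h hᵀ`. Integration by parts against the
distribution function gives `Φ̂(t) = ∫ (Q - Φ(s ∨ t)) dμ(s)` and turns `2𝒞` into `∫ (Ξ(Q) - Ξ(Φ(s)))
dμ(s) + log|Q - Φ(T)| + ∫₀ᵀ ⟨Φ̂⁻¹, Φ'⟩ dt` (`crisantiSommers_eq`). In this form `Φ̂` is affine in
`μ` and affine in `Φ`, so minimality can be tested by two elementary first variations.

Changing the weights of `μ` by a density `1 + ε w` with `∫ w dμ = 0` shows that the derivative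
`massDeriv` in the direction of a point mass is constant on the support
(`massDeriv_eq_of_mem_support`). Moving `Φ(s)` towards `Φ(u)` by `ε η(s) (Φ(s) - Φ(u))`, with a bump
`η` around `u`, shows `∫ η(s) pullDeriv(s) dμ(s) ≥ 0` (`integral_bump_pullDeriv_nonneg`). The moved
path loses the trace normalization, but reparametrizing path and measure together restores it
without changing the functional (`trace_pull`, `reduced_reparam`).

For `s` in the support the two conditions combine. Put `D = Φ(s) - Φ(u)`. By `pullDeriv_eq` and the
constancy of `massDeriv`, `pullDeriv(s)` is the first-order Taylor remainder of `Ξ` between `Φ(u)`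
and `Φ(s)` minus `∫_u^s ⟨Φ̂⁻¹ Φ' Φ̂⁻¹, Φ - Φ(u)⟩ dt`. Since `D` or `-D` is positive semidefinite,
the Schur product theorem bounds the remainder by `½ ⟨ξ''(Q), D^{∘2}⟩` (`potential_taylor_le`).
Freezing `Φ̂` at `u` costs `O(|s - u|³)`, and `Φ̂(u) ≤ Q` bounds the integral below by `½ ⟨Q⁻¹D,
Q⁻¹D⟩` up to that error (`exists_integral_resolv_ge`). As `D` is close to `(s - u) Φ'(u)`, the
strict inequality assumed at `u` makes `pullDeriv(s) < 0` for all support points `s ≠ u` near `u`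
(`exists_pullDeriv_neg`).

If `u` were not an atom, the bump integral could be nonnegative only if `μ` gave no mass to a
neighbourhood of `u`, contradicting `u ∈ supp μ` (`measure_singleton_ne_zero`). An atom is a jump of
the distribution function (`hasJumpAt_distr`). -/

noncomputable section

namespace VectorSpin

variable {m : ℕ}

/-! ### The trace pairing, positive semidefinite matrices and their inverses -/

theorem pairing_eq_sum (A B : Matrix (Fin m) (Fin m) ℝ) :
    pairing A B = ∑ i, ∑ j, A i j * B j i := by
  simp [pairing, Matrix.trace, Matrix.mul_apply]

theorem pairing_sub_left (A B C : Matrix (Fin m) (Fin m) ℝ) :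
    pairing (A - B) C = pairing A C - pairing B C := by
  simp [pairing, sub_mul]

theorem pairing_add_right (A B C : Matrix (Fin m) (Fin m) ℝ) :
    pairing A (B + C) = pairing A B + pairing A C := by
  simp [pairing, mul_add]

theorem pairing_sub_right (A B C : Matrix (Fin m) (Fin m) ℝ) :
    pairing A (B - C) = pairing A B - pairing A C := by
  simp [pairing, mul_sub]

theorem pairing_smul_left (c : ℝ) (A B : Matrix (Fin m) (Fin m) ℝ) :
    pairing (c • A) B = c * pairing A B := by
  simp [pairing]

theorem pairing_smul_right (c : ℝ) (A B : Matrix (Fin m) (Fin m) ℝ) :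
    pairing A (c • B) = c * pairing A B := by
  simp [pairing]

theorem pairing_conj_comm (X P B : Matrix (Fin m) (Fin m) ℝ) :
    pairing (X * P * X) B = pairing (X * B * X) P := by
  unfold pairing
  rw [Matrix.mul_assoc (X * P), Matrix.trace_mul_comm (X * P), ← Matrix.mul_assoc]

/-- `Tr(AB)` is the quadratic form of `A ⊙ Bᵀ` at the all-ones vector, so the Schur product theorem
applies. -/
theorem pairing_nonneg {A B : Matrix (Fin m) (Fin m) ℝ} (hA : A.PosSemidef)
    (hB : B.PosSemidef) : 0 ≤ pairing A B := by
  have h := hA.hadamard hB.transpose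
  have h1 := h.dotProduct_mulVec_nonneg (fun _ => (1 : ℝ))
  rw [pairing_eq_sum]
  simpa [dotProduct, Matrix.mulVec, Matrix.hadamard] using h1

/-- Entrywise bound for a product of matrices. -/
theorem abs_mul_apply_le {A B : Matrix (Fin m) (Fin m) ℝ} {a b : ℝ}
    (hA : ∀ i j, |A i j| ≤ a) (hB : ∀ i j, |B i j| ≤ b) (i j : Fin m) :
    |(A * B) i j| ≤ m * (a * b) := by
  rw [Matrix.mul_apply]
  calc |∑ k, A i k * B k j| ≤ ∑ k, |A i k * B k j| := Finset.abs_sum_le_sum_abs _ _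
    _ ≤ ∑ _k : Fin m, a * b := by
        refine Finset.sum_le_sum fun k _ => ?_
        rw [abs_mul]
        exact mul_le_mul (hA i k) (hB k j) (abs_nonneg _) ((abs_nonneg _).trans (hA i k))
    _ = m * (a * b) := by simp

theorem abs_pairing_le {A B : Matrix (Fin m) (Fin m) ℝ} {a b : ℝ}
    (hA : ∀ i j, |A i j| ≤ a) (hB : ∀ i j, |B i j| ≤ b) :
    |pairing A B| ≤ m * (m * (a * b)) := by
  unfold pairing Matrix.trace
  calc |∑ i, (A * B).diag i| ≤ ∑ i, |(A * B) i i| := Finset.abs_sum_le_sum_abs _ _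
    _ ≤ ∑ _i : Fin m, m * (a * b) :=
        Finset.sum_le_sum fun i _ => abs_mul_apply_le hA hB i i
    _ = m * (m * (a * b)) := by simp

theorem PosSemidef.symm_apply {X : Matrix (Fin m) (Fin m) ℝ} (hX : X.PosSemidef) (i j : Fin m) :
    X i j = X j i := by
  simpa using (hX.isHermitian.apply i j).symm

/-- The quadratic form of a matrix as a double sum. -/
theorem quadForm_eq (X : Matrix (Fin m) (Fin m) ℝ) (v : Fin m → ℝ) :
    v ⬝ᵥ (X *ᵥ v) = ∑ i, ∑ j, v i * v j * X i j := by
  simp only [dotProduct, Matrix.mulVec, Finset.mul_sum]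
  exact Finset.sum_congr rfl fun i _ => Finset.sum_congr rfl fun j _ => by ring

theorem PosSemidef.quadForm_nonneg {X : Matrix (Fin m) (Fin m) ℝ} (hX : X.PosSemidef)
    (v : Fin m → ℝ) : 0 ≤ ∑ i, ∑ j, v i * v j * X i j := by
  have := hX.dotProduct_mulVec_nonneg v
  rw [← quadForm_eq]
  simpa using this

theorem PosSemidef.of_quadForm {X : Matrix (Fin m) (Fin m) ℝ} (hs : ∀ i j, X i j = X j i)
    (hX : ∀ v : Fin m → ℝ, 0 ≤ ∑ i, ∑ j, v i * v j * X i j) : X.PosSemidef := by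
  refine Matrix.PosSemidef.of_dotProduct_mulVec_nonneg ?_ fun v => ?_
  · ext i j
    simp [hs i j]
  · have := hX v
    rw [← quadForm_eq] at this
    simpa using this

/-- The quadratic form is tested on `e_i ± e_j`. -/
theorem PosSemidef.abs_apply_le {X : Matrix (Fin m) (Fin m) ℝ} (hX : X.PosSemidef)
    (i j : Fin m) : |X i j| ≤ (X i i + X j j) / 2 := by
  have hs := PosSemidef.symm_apply hX i j
  have key : ∀ c : ℝ, 0 ≤ X i i + c * X i j + c * X j i + c ^ 2 * X j j := by
    intro c
    have h := hX.dotProduct_mulVec_nonneg (Pi.single i 1 + Pi.single j c)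
    simp [Matrix.mulVec_add, add_dotProduct, dotProduct_add, Matrix.mulVec_single,
      single_dotProduct] at h
    nlinarith [h]
  have h1 := key 1
  have h2 := key (-1)
  rw [abs_le]
  constructor <;> nlinarith

theorem PosSemidef.abs_apply_le_trace {X : Matrix (Fin m) (Fin m) ℝ} (hX : X.PosSemidef)
    (i j : Fin m) : |X i j| ≤ X.trace := by
  have hd : ∀ k, X k k ≤ X.trace := fun k =>
    Finset.single_le_sum (f := fun l => X l l) (fun l _ => hX.diag_nonneg) (Finset.mem_univ k)
  linarith [PosSemidef.abs_apply_le hX i j, hd i, hd j]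

theorem posDef_of_det_pos {X : Matrix (Fin m) (Fin m) ℝ} (hX : X.PosSemidef)
    (hd : 0 < X.det) : X.PosDef :=
  hX.posDef_iff_isUnit.mpr ((Matrix.isUnit_iff_isUnit_det _).mpr hd.ne'.isUnit)

theorem PosDef.of_le {X Y : Matrix (Fin m) (Fin m) ℝ} (hX : X.PosDef)
    (h : (Y - X).PosSemidef) : Y.PosDef := by
  simpa using hX.add_posSemidef h

theorem mul_inv_cancel_of_posDef {X : Matrix (Fin m) (Fin m) ℝ} (hX : X.PosDef) : X * X⁻¹ = 1 :=
  Matrix.mul_nonsing_inv _ hX.det_pos.ne'.isUnit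

theorem inv_mul_cancel_of_posDef {X : Matrix (Fin m) (Fin m) ℝ} (hX : X.PosDef) : X⁻¹ * X = 1 :=
  Matrix.nonsing_inv_mul _ hX.det_pos.ne'.isUnit

/-- Resolvent identity. -/
theorem inv_sub_inv_of_posDef {X Y : Matrix (Fin m) (Fin m) ℝ} (hX : X.PosDef) (hY : Y.PosDef) :
    X⁻¹ - Y⁻¹ = X⁻¹ * (Y - X) * Y⁻¹ := by
  rw [mul_sub, sub_mul, inv_mul_cancel_of_posDef hX, Matrix.mul_assoc,
    mul_inv_cancel_of_posDef hY]
  simp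

/-- Applying the resolvent identity twice, with `Δ = Y - X`, gives `X⁻¹ - Y⁻¹ = Y⁻¹ΔY⁻¹ + Y⁻¹Δ X⁻¹
ΔY⁻¹`, a sum of congruences of positive semidefinite matrices. No square roots are needed. -/
theorem inv_antitone {X Y : Matrix (Fin m) (Fin m) ℝ} (hX : X.PosDef)
    (h : (Y - X).PosSemidef) : (X⁻¹ - Y⁻¹).PosSemidef := by
  have hY := PosDef.of_le hX h
  have e1 := inv_sub_inv_of_posDef hX hY
  have e2 : X⁻¹ - Y⁻¹ = Y⁻¹ * (Y - X) * X⁻¹ := by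
    have := inv_sub_inv_of_posDef hY hX
    rw [← neg_sub X Y, mul_neg, neg_mul, ← this, neg_sub]
  have e3 : X⁻¹ - Y⁻¹ = Y⁻¹ * (Y - X) * Y⁻¹ᴴ
      + (Y⁻¹ * (Y - X)) * X⁻¹ * (Y⁻¹ * (Y - X))ᴴ := by
    rw [Matrix.conjTranspose_mul, h.isHermitian.eq, hY.inv.isHermitian.eq, ← Matrix.mul_assoc,
      ← e2, sub_mul _ _ (Y - X), sub_mul _ _ Y⁻¹, ← e1]
    abel
  rw [e3]
  exact (h.mul_mul_conjTranspose_same _).add (hX.inv.posSemidef.mul_mul_conjTranspose_same _)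

/-- A bound depending on the lower bound `G` alone. With `G = Q - Φ(T)` it controls every inverse
met below, uniformly in time and in the perturbation parameter. -/
theorem abs_inv_apply_le {X G : Matrix (Fin m) (Fin m) ℝ} (hG : G.PosDef)
    (h : (X - G).PosSemidef) (i j : Fin m) : |X⁻¹ i j| ≤ (G⁻¹).trace := by
  have hX := PosDef.of_le hG h
  have h1 := PosSemidef.abs_apply_le_trace hX.inv.posSemidef i j
  have h2 := (inv_antitone hG h).trace_nonneg
  rw [Matrix.trace_sub] at h2
  linarith

/-- The two copies of `A⁻¹` are replaced by `Q⁻¹` one at a time: `A⁻¹ - Q⁻¹` pairs nonnegatively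
with both `D A⁻¹ D` and `D Q⁻¹ D`, and the mixed terms agree by cyclicity of the trace. With `A =
Φ̂(u)` this is the source of `Q⁻¹` in the stability condition. -/
theorem pairing_inv_mul_self_mono {A Q D : Matrix (Fin m) (Fin m) ℝ} (hA : A.PosDef)
    (h : (Q - A).PosSemidef) (hD : D.IsHermitian) :
    pairing (Q⁻¹ * D) (Q⁻¹ * D) ≤ pairing (A⁻¹ * D * A⁻¹) D := by
  have hQ := PosDef.of_le hA h
  have hZ := inv_antitone hA h
  have c1 : (D * A⁻¹ * D).PosSemidef := by
    have := hA.inv.posSemidef.mul_mul_conjTranspose_same D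
    rwa [hD.eq] at this
  have c2 : (D * Q⁻¹ * D).PosSemidef := by
    have := hQ.inv.posSemidef.mul_mul_conjTranspose_same D
    rwa [hD.eq] at this
  have p1 := pairing_nonneg hZ c1
  have p2 := pairing_nonneg hZ c2
  simp only [pairing, sub_mul, Matrix.trace_sub, ← Matrix.mul_assoc] at p1 p2 ⊢
  have : (A⁻¹ * D * Q⁻¹ * D).trace = (Q⁻¹ * D * A⁻¹ * D).trace := by
    rw [Matrix.mul_assoc (A⁻¹ * D), Matrix.trace_mul_comm, ← Matrix.mul_assoc]
  linarith

/-! ### Entrywise powers and Taylor remainders in the Loewner order -/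

/-- The entrywise power. -/
def hpow (A : Matrix (Fin m) (Fin m) ℝ) (n : ℕ) : Matrix (Fin m) (Fin m) ℝ :=
  Matrix.of fun i j => A i j ^ n

theorem hpow_posSemidef {A : Matrix (Fin m) (Fin m) ℝ} (hA : A.PosSemidef) (n : ℕ) :
    (hpow A n).PosSemidef := by
  induction n with
  | zero =>
    have : hpow A 0 = Matrix.vecMulVec (fun _ => (1 : ℝ)) (star fun _ => (1 : ℝ)) := by
      ext i j; simp [hpow, Matrix.vecMulVec]
    rw [this]
    exact Matrix.posSemidef_vecMulVec_self_star _
  | succ n ih =>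
    have : hpow A (n + 1) = hpow A n ⊙ A := by
      ext i j; simp [hpow, pow_succ]
    rw [this]
    exact ih.hadamard hA

theorem hpow_mono {A B : Matrix (Fin m) (Fin m) ℝ} (hA : A.PosSemidef) (hB : B.PosSemidef)
    (h : (B - A).PosSemidef) (n : ℕ) : (hpow B n - hpow A n).PosSemidef := by
  induction n with
  | zero =>
    have : hpow B 0 - hpow A 0 = 0 := by ext i j; simp [hpow]
    rw [this]; exact Matrix.PosSemidef.zero
  | succ n ih =>
    have : hpow B (n + 1) - hpow A (n + 1)
        = (hpow B n - hpow A n) ⊙ B + hpow A n ⊙ (B - A) := by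
      ext i j; simp [hpow, pow_succ]; ring
    rw [this]
    exact (ih.hadamard hB).add ((hpow_posSemidef hA n).hadamard h)

/-- First-order Taylor remainder of the entrywise power `n + 2`, based at `B`. -/
def taylorRem (A B : Matrix (Fin m) (Fin m) ℝ) (n : ℕ) : Matrix (Fin m) (Fin m) ℝ :=
  Matrix.of fun i j => ((n : ℝ) + 2) * B i j ^ (n + 1) * (B i j - A i j)
    - (B i j ^ (n + 2) - A i j ^ (n + 2))

theorem taylorRem_zero (A B : Matrix (Fin m) (Fin m) ℝ) :
    taylorRem A B 0 = (B - A) ⊙ (B - A) := by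
  ext i j; simp [taylorRem]; ring

/-- A recursion built from Schur products and nonnegative coefficients only, so that positivity
propagates from one power to the next. -/
theorem taylorRem_succ (A B : Matrix (Fin m) (Fin m) ℝ) (n : ℕ) :
    taylorRem A B (n + 1) = A ⊙ taylorRem A B n
      + ((n : ℝ) + 2) • (hpow B (n + 1) ⊙ ((B - A) ⊙ (B - A))) := by
  ext i j; simp [taylorRem, hpow]; ring

theorem taylorRem_posSemidef {A B : Matrix (Fin m) (Fin m) ℝ} (hA : A.PosSemidef)
    (hB : B.PosSemidef) (hD : ((B - A) ⊙ (B - A)).PosSemidef) (n : ℕ) :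
    (taylorRem A B n).PosSemidef := by
  induction n with
  | zero => rwa [taylorRem_zero]
  | succ n ih =>
    rw [taylorRem_succ]
    exact (hA.hadamard ih).add
      (((hpow_posSemidef hB _).hadamard hD).smul (by positivity))

/-- Induction along `taylorRem_succ`. The coefficients match because `(n+3)(n+2)/2 = (n+2)(n+1)/2 +
(n+2)`, and the slack consists of Schur products with `Q - A` and with `Q^{∘(n+1)} - B^{∘(n+1)}`. -/
theorem taylorRem_le {A B Q : Matrix (Fin m) (Fin m) ℝ} (hA : A.PosSemidef)
    (hB : B.PosSemidef) (hQ : Q.PosSemidef) (hAQ : (Q - A).PosSemidef) (hBQ : (Q - B).PosSemidef)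
    (hD : ((B - A) ⊙ (B - A)).PosSemidef) (n : ℕ) :
    ((((n : ℝ) + 2) * ((n : ℝ) + 1) / 2) • (hpow Q n ⊙ ((B - A) ⊙ (B - A)))
      - taylorRem A B n).PosSemidef := by
  induction n with
  | zero =>
    have : ((((0 : ℕ) : ℝ) + 2) * (((0 : ℕ) : ℝ) + 1) / 2) • (hpow Q 0 ⊙ ((B - A) ⊙ (B - A)))
        - taylorRem A B 0 = 0 := by
      ext i j; simp [taylorRem_zero, hpow]
    rw [this]; exact Matrix.PosSemidef.zero
  | succ n ih =>
    have : ((((n + 1 : ℕ) : ℝ) + 2) * (((n + 1 : ℕ) : ℝ) + 1) / 2) •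
          (hpow Q (n + 1) ⊙ ((B - A) ⊙ (B - A))) - taylorRem A B (n + 1)
        = A ⊙ ((((n : ℝ) + 2) * ((n : ℝ) + 1) / 2) • (hpow Q n ⊙ ((B - A) ⊙ (B - A)))
            - taylorRem A B n)
          + (((n : ℝ) + 2) * ((n : ℝ) + 1) / 2) •
            ((Q - A) ⊙ (hpow Q n ⊙ ((B - A) ⊙ (B - A))))
          + ((n : ℝ) + 2) • ((hpow Q (n + 1) - hpow B (n + 1)) ⊙ ((B - A) ⊙ (B - A))) := by
      rw [taylorRem_succ]
      ext i j; simp [hpow, pow_succ]; ring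
    rw [this]
    refine ((hA.hadamard ih).add ?_).add ?_
    · exact (hAQ.hadamard ((hpow_posSemidef hQ n).hadamard hD)).smul (by positivity)
    · exact ((hpow_mono hB hQ hBQ _).hadamard hD).smul (by positivity)

/-- Increments of a monotone path have one sign or the other, according to the side of `u`. The
Schur square does not see the difference. -/
theorem hadamard_self_posSemidef {D : Matrix (Fin m) (Fin m) ℝ}
    (h : D.PosSemidef ∨ (-D).PosSemidef) : (D ⊙ D).PosSemidef := by
  rcases h with h | h
  · exact h.hadamard h
  · have := h.hadamard h
    have e : (-D) ⊙ (-D) = D ⊙ D := by ext i j; simp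
    rwa [e] at this

/-! ### The series `ξ`, its derivatives and the potential -/

theorem IsMixedEvenModel.summable_coeff {β : ℕ → Fin m → ℝ} (hβ : IsMixedEvenModel β)
    (i j : Fin m) : Summable fun k : ℕ => (2 : ℝ) ^ k * |β (k + 2) i * β (k + 2) j| := by
  have hs : ∀ l, Summable fun k : ℕ => (2 : ℝ) ^ (k + 2) * β (k + 2) l ^ 2 := fun l =>
    (summable_nat_add_iff 2).mpr (hβ.summable l)
  refine Summable.of_nonneg_of_le (fun k => by positivity) (fun k => ?_) ((hs i).add (hs j))
  rw [abs_mul]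
  have h2 : (0 : ℝ) < 2 ^ k := by positivity
  have e : (2 : ℝ) ^ (k + 2) = 4 * 2 ^ k := by rw [pow_add]; ring
  rw [e]
  have h1 : |β (k + 2) i| * |β (k + 2) j| ≤ 4 * (β (k + 2) i ^ 2 + β (k + 2) j ^ 2) := by
    nlinarith [sq_nonneg (|β (k + 2) i| - |β (k + 2) j|), sq_abs (β (k + 2) i),
      sq_abs (β (k + 2) j), sq_nonneg (β (k + 2) i), sq_nonneg (β (k + 2) j)]
  nlinarith [mul_le_mul_of_nonneg_left h1 h2.le]

/-- Domination of the terms of the differentiated series on the ball of radius `3 / 2`. -/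
theorem linear_mul_pow_le (k : ℕ) {a : ℝ} (ha : |a| ≤ 3 / 2) :
    ((k : ℝ) + 2) * |a| ^ (k + 1) ≤ 9 * 2 ^ k := by
  -- Since `2 = (3/2)(4/3)`, Bernoulli's inequality `1 + k/3 ≤ (4/3)^k` leaves room for the linear
  -- factor `k + 2`.
  have b := one_add_mul_le_pow (a := (1 / 3 : ℝ)) (by norm_num) k
  have e : (2 : ℝ) ^ k = (3 / 2) ^ k * (1 + 1 / 3) ^ k := by
    rw [← mul_pow]; norm_num
  have h1 : |a| ^ (k + 1) ≤ (3 / 2 : ℝ) ^ (k + 1) := pow_le_pow_left₀ (abs_nonneg a) ha _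
  have h3 : (0 : ℝ) < (3 / 2) ^ k := by positivity
  calc ((k : ℝ) + 2) * |a| ^ (k + 1) ≤ ((k : ℝ) + 2) * (3 / 2 : ℝ) ^ (k + 1) := by gcongr
    _ = (3 / 2) ^ k * (3 / 2 * ((k : ℝ) + 2)) := by rw [pow_succ]; ring
    _ ≤ (3 / 2) ^ k * (9 * (1 + 1 / 3) ^ k) := by
        refine mul_le_mul_of_nonneg_left ?_ h3.le
        have : (0 : ℝ) ≤ k := Nat.cast_nonneg k
        linarith
    _ = 9 * 2 ^ k := by rw [e]; ring

theorem norm_xiD_term_le (β : ℕ → Fin m → ℝ) (i j : Fin m) (k : ℕ) {a : ℝ} (ha : |a| ≤ 3 / 2) :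
    ‖((k : ℝ) + 2) * (β (k + 2) i * β (k + 2) j) * a ^ (k + 1)‖
      ≤ 9 * (2 ^ k * |β (k + 2) i * β (k + 2) j|) := by
  rw [Real.norm_eq_abs, abs_mul, abs_mul, abs_pow, abs_of_nonneg (by positivity : (0 : ℝ) ≤ k + 2)]
  have := mul_le_mul_of_nonneg_right (linear_mul_pow_le k ha)
    (abs_nonneg (β (k + 2) i * β (k + 2) j))
  linarith

theorem summable_xiD_term {β : ℕ → Fin m → ℝ} (hβ : IsMixedEvenModel β) (i j : Fin m) {a : ℝ}
    (ha : |a| ≤ 3 / 2) :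
    Summable fun k : ℕ => ((k : ℝ) + 2) * (β (k + 2) i * β (k + 2) j) * a ^ (k + 1) :=
  Summable.of_norm_bounded ((hβ.summable_coeff i j).mul_left 9)
    fun k => norm_xiD_term_le β i j k ha

theorem summable_xi_term {β : ℕ → Fin m → ℝ} (hβ : IsMixedEvenModel β) (i j : Fin m) {a : ℝ}
    (ha : |a| ≤ 1) : Summable fun k : ℕ => β (k + 2) i * β (k + 2) j * a ^ (k + 2) := by
  refine Summable.of_norm_bounded (hβ.summable_coeff i j) fun k => ?_
  rw [Real.norm_eq_abs, abs_mul, abs_pow, mul_comm]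
  exact mul_le_mul_of_nonneg_right ((pow_le_one₀ (abs_nonneg a) ha).trans
    (one_le_pow₀ (by norm_num))) (abs_nonneg _)

theorem summable_xiDD_term {β : ℕ → Fin m → ℝ} (hβ : IsMixedEvenModel β) (i j : Fin m) {a : ℝ}
    (ha : |a| ≤ 1) : Summable fun k : ℕ =>
      ((k : ℝ) + 2) * ((k : ℝ) + 1) * (β (k + 2) i * β (k + 2) j) * a ^ k := by
  refine Summable.of_norm_bounded ((hβ.summable_coeff i j).mul_left 8) fun k => ?_
  rw [Real.norm_eq_abs, abs_mul, abs_mul, abs_pow,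
    abs_of_nonneg (by positivity : (0 : ℝ) ≤ (k + 2) * (k + 1))]
  -- The product is twice `(k+2).choose 2`, which is at most `2^(k+2)`.
  have h1 : ((k : ℝ) + 2) * ((k : ℝ) + 1) ≤ 8 * 2 ^ k := by
    have h : ((k + 2).choose 2 : ℝ) ≤ 2 ^ (k + 2) := by
      exact_mod_cast Nat.choose_le_two_pow (k + 2) 2
    rw [Nat.cast_choose_two] at h
    push_cast at h
    rw [pow_add] at h
    nlinarith
  calc ((k : ℝ) + 2) * ((k : ℝ) + 1) * |β (k + 2) i * β (k + 2) j| * |a| ^ k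
      ≤ 8 * 2 ^ k * |β (k + 2) i * β (k + 2) j| * 1 := by
        gcongr
        exact pow_le_one₀ (abs_nonneg a) ha
    _ = _ := by ring

/-- The entry `ξ_{ij}(a) = ∑_p β_p(i) β_p(j) a^p`. -/
def xiEntry (β : ℕ → Fin m → ℝ) (i j : Fin m) (a : ℝ) : ℝ :=
  ∑' k : ℕ, β (k + 2) i * β (k + 2) j * a ^ (k + 2)

/-- The derivative `ξ'_{ij}(a)`. -/
def xiEntryD (β : ℕ → Fin m → ℝ) (i j : Fin m) (a : ℝ) : ℝ :=
  ∑' k : ℕ, ((k : ℝ) + 2) * (β (k + 2) i * β (k + 2) j) * a ^ (k + 1)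

/-- Termwise differentiation is carried out on the open ball of radius `3/2`, so that the endpoints
`±1`, which entries of the path may reach, are interior points. -/
theorem hasDerivAt_xiEntry {β : ℕ → Fin m → ℝ} (hβ : IsMixedEvenModel β) (i j : Fin m) {a : ℝ}
    (ha : |a| ≤ 1) : HasDerivAt (xiEntry β i j) (xiEntryD β i j a) a := by
  have hball : ∀ {y : ℝ}, y ∈ Metric.ball (0 : ℝ) (3 / 2) → |y| ≤ 3 / 2 := fun hy => by
    rw [mem_ball_zero_iff, Real.norm_eq_abs] at hy; exact hy.le
  refine hasDerivAt_tsum_of_isPreconnected (u := fun k : ℕ =>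
      9 * (2 ^ k * |β (k + 2) i * β (k + 2) j|)) (t := Metric.ball (0 : ℝ) (3 / 2))
    (g := fun (k : ℕ) (y : ℝ) => β (k + 2) i * β (k + 2) j * y ^ (k + 2))
    (g' := fun (k : ℕ) (y : ℝ) => ((k : ℝ) + 2) * (β (k + 2) i * β (k + 2) j) * y ^ (k + 1))
    (y₀ := 0) ((hβ.summable_coeff i j).mul_left 9) Metric.isOpen_ball
    (convex_ball _ _).isPreconnected (fun k y _ => ?_)
    (fun k y hy => norm_xiD_term_le β i j k (hball hy)) (by simp) ?_ ?_
  · have := (hasDerivAt_pow (k + 2) y).const_mul (β (k + 2) i * β (k + 2) j)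
    refine this.congr_deriv ?_
    rw [show k + 2 - 1 = k + 1 from rfl]
    push_cast
    ring
  · simp
  · rw [mem_ball_zero_iff, Real.norm_eq_abs]; linarith

theorem continuousOn_xiEntryD {β : ℕ → Fin m → ℝ} (hβ : IsMixedEvenModel β) (i j : Fin m) :
    ContinuousOn (xiEntryD β i j) (Icc (-1) 1) := by
  refine continuousOn_tsum (u := fun k : ℕ => 9 * (2 ^ k * |β (k + 2) i * β (k + 2) j|))
    (fun k => by fun_prop) ((hβ.summable_coeff i j).mul_left 9) fun k a ha => ?_
  exact norm_xiD_term_le β i j k ((abs_le.mpr ha).trans (by norm_num))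

theorem exists_xiEntryD_bound {β : ℕ → Fin m → ℝ} (hβ : IsMixedEvenModel β) :
    ∃ M : ℝ≥0, ∀ i j a, |a| ≤ 1 → |xiEntryD β i j a| ≤ M := by
  have h : ∀ i j, ∃ M : ℝ, ∀ a, |a| ≤ 1 → |xiEntryD β i j a| ≤ M := fun i j => by
    obtain ⟨M, hM⟩ := isCompact_Icc.exists_bound_of_continuousOn (continuousOn_xiEntryD hβ i j)
    exact ⟨M, fun a ha => by simpa using hM a (abs_le.mp ha)⟩
  choose M hM using h
  refine ⟨∑ i, ∑ j, (M i j).toNNReal, fun i j a ha => ?_⟩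
  refine (hM i j a ha).trans ((Real.le_coe_toNNReal _).trans ?_)
  have : (M i j).toNNReal ≤ ∑ i, ∑ j, (M i j).toNNReal :=
    (Finset.single_le_sum (f := fun j => (M i j).toNNReal) (fun _ _ => zero_le)
      (Finset.mem_univ j)).trans
      (Finset.single_le_sum (f := fun i => ∑ j, (M i j).toNNReal) (fun _ _ => zero_le)
      (Finset.mem_univ i))
  exact_mod_cast this

/-- The primitive `Ξ(A) = ∑_{ij} ξ_{ij}(A_{ij}) + ⟨h, A h⟩` of `A ↦ ξ'(A) + h hᵀ`. -/
def potential (β : ℕ → Fin m → ℝ) (h : Fin m → ℝ) (A : Matrix (Fin m) (Fin m) ℝ) : ℝ :=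
  ∑ i, ∑ j, (xiEntry β i j (A i j) + h i * h j * A i j)

theorem pairing_xiD_eq (β : ℕ → Fin m → ℝ) (h : Fin m → ℝ) (A D : Matrix (Fin m) (Fin m) ℝ)
    (hD : ∀ i j, D i j = D j i) :
    pairing (xiD β A + Matrix.vecMulVec h h) D
      = ∑ i, ∑ j, (xiEntryD β i j (A i j) + h i * h j) * D i j := by
  rw [pairing_eq_sum]
  refine Finset.sum_congr rfl fun i _ => Finset.sum_congr rfl fun j _ => ?_
  rw [← hD i j]; rfl

/-- The Taylor remainder of the potential as a series of quadratic forms. -/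
theorem hasSum_potential_taylorRem {β : ℕ → Fin m → ℝ} (hβ : IsMixedEvenModel β) (h : Fin m → ℝ)
    {A B : Matrix (Fin m) (Fin m) ℝ} (hA : ∀ i j, |A i j| ≤ 1) (hB : ∀ i j, |B i j| ≤ 1)
    (hD : ∀ i j, (B - A) i j = (B - A) j i) :
    HasSum (fun k : ℕ => ∑ i, ∑ j, β (k + 2) i * β (k + 2) j * taylorRem A B k i j)
      (pairing (xiD β B + Matrix.vecMulVec h h) (B - A)
        - (potential β h B - potential β h A)) := by
  have e : pairing (xiD β B + Matrix.vecMulVec h h) (B - A)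
        - (potential β h B - potential β h A)
      = ∑ i, ∑ j, (xiEntryD β i j (B i j) * (B i j - A i j)
          - (xiEntry β i j (B i j) - xiEntry β i j (A i j))) := by
    rw [pairing_xiD_eq _ _ _ _ hD]
    simp only [potential, ← Finset.sum_sub_distrib]
    refine Finset.sum_congr rfl fun i _ => Finset.sum_congr rfl fun j _ => ?_
    simp only [Matrix.sub_apply]
    ring
  rw [e]
  refine hasSum_sum fun i _ => hasSum_sum fun j _ => ?_
  have h1 := (summable_xiD_term hβ i j ((hB i j).trans (by norm_num))).hasSum.mul_right
    (B i j - A i j)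
  have h2 := (summable_xi_term hβ i j (hB i j)).hasSum.sub (summable_xi_term hβ i j (hA i j)).hasSum
  refine (h1.sub h2).congr_fun fun k => ?_
  simp only [taylorRem, Matrix.of_apply]
  ring

/-- The remainder is a sum over `p` of quadratic forms evaluated at `β_p`, each nonnegative by
`taylorRem_posSemidef`. The tangent inequality is obtained for Loewner-comparable matrices, the only
ones that occur along a path. -/
theorem potential_convex {β : ℕ → Fin m → ℝ} (hβ : IsMixedEvenModel β) (h : Fin m → ℝ)
    {A B : Matrix (Fin m) (Fin m) ℝ} (hA : A.PosSemidef) (hB : B.PosSemidef)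
    (hA1 : ∀ i j, |A i j| ≤ 1) (hB1 : ∀ i j, |B i j| ≤ 1)
    (hD : (B - A).PosSemidef ∨ (-(B - A)).PosSemidef) :
    potential β h B - potential β h A ≤ pairing (xiD β B + Matrix.vecMulVec h h) (B - A) := by
  have hs : ∀ i j, (B - A) i j = (B - A) j i := fun i j => by
    simp [PosSemidef.symm_apply hA i j, PosSemidef.symm_apply hB i j]
  have H := hasSum_potential_taylorRem hβ h hA1 hB1 hs
  have := H.nonneg fun k => PosSemidef.quadForm_nonneg
    (taylorRem_posSemidef hA hB (hadamard_self_posSemidef hD) k) (β (k + 2))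
  linarith

/-- The bound `taylorRem_le` is evaluated at each `β_p` and summed; the comparison matrix `Q`
assembles into `ξ''(Q)`. -/
theorem potential_taylor_le {β : ℕ → Fin m → ℝ} (hβ : IsMixedEvenModel β) (h : Fin m → ℝ)
    {A B Q : Matrix (Fin m) (Fin m) ℝ} (hA : A.PosSemidef) (hB : B.PosSemidef)
    (hQ : Q.PosSemidef) (hAQ : (Q - A).PosSemidef) (hBQ : (Q - B).PosSemidef)
    (hA1 : ∀ i j, |A i j| ≤ 1) (hB1 : ∀ i j, |B i j| ≤ 1) (hQ1 : ∀ i j, |Q i j| ≤ 1)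
    (hD : (B - A).PosSemidef ∨ (-(B - A)).PosSemidef) :
    pairing (xiD β B + Matrix.vecMulVec h h) (B - A) - (potential β h B - potential β h A)
      ≤ pairing (xiDD β Q) ((B - A) ⊙ (B - A)) / 2 := by
  have hs : ∀ i j, (B - A) i j = (B - A) j i := fun i j => by
    simp [PosSemidef.symm_apply hA i j, PosSemidef.symm_apply hB i j]
  have H := hasSum_potential_taylorRem hβ h hA1 hB1 hs
  have H2 : HasSum (fun k : ℕ => ∑ i, ∑ j, β (k + 2) i * β (k + 2) j *
      ((((k : ℝ) + 2) * ((k : ℝ) + 1) / 2) • (hpow Q k ⊙ ((B - A) ⊙ (B - A)))) i j)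
      (pairing (xiDD β Q) ((B - A) ⊙ (B - A)) / 2) := by
    rw [pairing_eq_sum, Finset.sum_div]
    refine hasSum_sum fun i _ => ?_
    rw [Finset.sum_div]
    refine hasSum_sum fun j _ => ?_
    have h1 := ((summable_xiDD_term hβ i j (hQ1 i j)).hasSum.mul_right
      ((B - A) i j * (B - A) i j)).div_const 2
    have e : ((B - A) ⊙ (B - A)) j i = (B - A) i j * (B - A) i j := by
      rw [Matrix.hadamard_apply, hs j i]
    rw [e]
    refine h1.congr_fun fun k => ?_
    simp only [hpow, Matrix.smul_apply, Matrix.hadamard_apply, Matrix.of_apply, smul_eq_mul]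
    ring
  refine hasSum_le (fun k => ?_) H H2
  have := PosSemidef.quadForm_nonneg
    (taylorRem_le hA hB hQ hAQ hBQ (hadamard_self_posSemidef hD) k) (β (k + 2))
  simp only [Matrix.sub_apply _ (taylorRem A B k), mul_sub, Finset.sum_sub_distrib] at this
  linarith

/-! ### Lipschitz functions and integrability of bounded functions -/

theorem exists_lipschitzWith_sum {ι : Type*} (s : Finset ι) {f : ι → ℝ → ℝ}
    (hf : ∀ i ∈ s, ∃ K : ℝ≥0, LipschitzWith K (f i)) :
    ∃ K : ℝ≥0, LipschitzWith K fun t => ∑ i ∈ s, f i t := by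
  classical
  induction s using Finset.induction_on with
  | empty => exact ⟨0, by simp⟩
  | insert i s hi ih =>
    obtain ⟨K, hK⟩ := hf i (by simp)
    obtain ⟨L, hL⟩ := ih fun j hj => hf j (by simp [hj])
    exact ⟨K + L, by simpa [Finset.sum_insert hi] using hK.add hL⟩

theorem exists_lipschitzWith_const_mul {f : ℝ → ℝ} (c : ℝ)
    (hf : ∃ K : ℝ≥0, LipschitzWith K f) : ∃ K : ℝ≥0, LipschitzWith K fun t => c * f t := by
  obtain ⟨K, hK⟩ := hf
  refine ⟨‖c‖₊ * K, ?_⟩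
  exact (lipschitzWith_smul c).comp hK

theorem abs_sub_le_of_lipschitzWith {f : ℝ → ℝ} {K : ℝ≥0} (hf : LipschitzWith K f) (s t : ℝ) :
    |f s - f t| ≤ K * |s - t| := by
  simpa [Real.dist_eq] using hf.dist_le_mul s t

theorem exists_lipschitzWith_mul {f g : ℝ → ℝ} {a b : ℝ} (hf : ∃ K : ℝ≥0, LipschitzWith K f)
    (hg : ∃ K : ℝ≥0, LipschitzWith K g) (ha : ∀ t, |f t| ≤ a) (hb : ∀ t, |g t| ≤ b) :
    ∃ K : ℝ≥0, LipschitzWith K fun t => f t * g t := by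
  obtain ⟨K, hK⟩ := hf
  obtain ⟨L, hL⟩ := hg
  have ha0 : 0 ≤ a := (abs_nonneg _).trans (ha 0)
  have hb0 : 0 ≤ b := (abs_nonneg _).trans (hb 0)
  refine ⟨⟨a * L + b * K, by positivity⟩, LipschitzWith.of_dist_le_mul fun s t => ?_⟩
  rw [Real.dist_eq, Real.dist_eq]
  have e : f s * g s - f t * g t = f s * (g s - g t) + (f s - f t) * g t := by ring
  rw [e]
  calc |f s * (g s - g t) + (f s - f t) * g t|
      ≤ |f s| * |g s - g t| + |f s - f t| * |g t| := by
        rw [← abs_mul, ← abs_mul]; exact abs_add_le _ _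
    _ ≤ a * (L * |s - t|) + (K * |s - t|) * b := by
        gcongr
        · exact ha s
        · exact abs_sub_le_of_lipschitzWith hL s t
        · exact abs_sub_le_of_lipschitzWith hK s t
        · exact hb t
    _ = (a * L + b * K) * |s - t| := by ring

theorem integral_deriv_of_lipschitzWith {f : ℝ → ℝ} {K : ℝ≥0} (hf : LipschitzWith K f) (a b : ℝ) :
    ∫ t in a..b, deriv f t = f b - f a :=
  (hf.lipschitzOnWith (s := uIcc a b)).absolutelyContinuousOnInterval.integral_deriv_eq_sub

theorem norm_deriv_le {f : ℝ → ℝ} {K : ℝ≥0} (hf : LipschitzWith K f) (t : ℝ) :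
    |deriv f t| ≤ K := by
  simpa using norm_deriv_le_of_lipschitz (x₀ := t) hf

/-- Bounded measurable functions are interval integrable. -/
theorem intervalIntegrable_of_bound {f : ℝ → ℝ} {a b C : ℝ} (hm : Measurable f)
    (hC : ∀ t ∈ uIoc a b, |f t| ≤ C) : IntervalIntegrable f volume a b := by
  rw [intervalIntegrable_iff]
  refine Measure.integrableOn_of_bounded (M := C) (by simp [uIoc]) hm.aestronglyMeasurable ?_
  exact (ae_restrict_iff' measurableSet_uIoc).mpr (ae_of_all _ fun t ht => by simpa using hC t ht)

theorem integrable_of_bound {μ : Measure ℝ} [IsFiniteMeasure μ] {f : ℝ → ℝ} {C : ℝ}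
    (hm : Measurable f) (hC : ∀ t, |f t| ≤ C) : Integrable f μ :=
  Integrable.of_bound hm.aestronglyMeasurable C (ae_of_all _ fun t => by simpa using hC t)

/-! ### Distribution functions and integration by parts -/

theorem distr_mono (μ : Measure ℝ) [IsFiniteMeasure μ] : Monotone (distr μ) := fun _ _ hst =>
  measureReal_mono (Icc_subset_Icc_right hst)

theorem distr_nonneg (μ : Measure ℝ) (t : ℝ) : 0 ≤ distr μ t := measureReal_nonneg

theorem distr_le_one (μ : Measure ℝ) [IsProbabilityMeasure μ] (t : ℝ) : distr μ t ≤ 1 :=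
  measureReal_le_one

theorem ae_mem_Icc {μ : Measure ℝ} {a b : ℝ} (h : μ (Icc a b)ᶜ = 0) : ∀ᵐ r ∂μ, r ∈ Icc a b := h

theorem distr_eq_integral {μ : Measure ℝ} [IsProbabilityMeasure μ] {b : ℝ}
    (h : μ (Icc 0 b)ᶜ = 0) (s : ℝ) :
    distr μ s = ∫ r, (Iic s).indicator (fun _ => (1 : ℝ)) r ∂μ := by
  rw [integral_indicator measurableSet_Iic]
  simp only [integral_const, smul_eq_mul, mul_one, measureReal_restrict_apply_univ]
  refine measureReal_congr ?_
  filter_upwards [ae_mem_Icc h] with r hr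
  have h0 : 0 ≤ r := hr.1
  exact propext ⟨fun hx => hx.2, fun hx => ⟨h0, hx⟩⟩

/-- Integration by parts against a distribution function. -/
theorem integral_distr_mul_deriv {μ : Measure ℝ} [IsProbabilityMeasure μ] {b : ℝ}
    (h : μ (Icc 0 b)ᶜ = 0) {f : ℝ → ℝ} {K : ℝ≥0} (hf : LipschitzWith K f) {t : ℝ} (ht : t ≤ b) :
    ∫ s in t..b, distr μ s * deriv f s = ∫ r, (f b - f (max r t)) ∂μ := by
  have hmeas : Measurable fun p : ℝ × ℝ => (Iic p.1).indicator (fun _ => (1 : ℝ)) p.2 := by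
    have : (fun p : ℝ × ℝ => (Iic p.1).indicator (fun _ => (1 : ℝ)) p.2)
        = {p : ℝ × ℝ | p.2 ≤ p.1}.indicator fun _ => 1 := by
      ext p; simp [indicator]
    rw [this]
    exact measurable_const.indicator (measurableSet_le measurable_snd measurable_fst)
  have e1 : ∀ s, distr μ s * deriv f s
      = ∫ r, (Iic s).indicator (fun _ => (1 : ℝ)) r * deriv f s ∂μ := fun s => by
    rw [distr_eq_integral h, integral_mul_const]
  simp_rw [e1]
  rw [intervalIntegral.integral_of_le ht, integral_integral_swap]
  · refine integral_congr_ae ?_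
    filter_upwards [ae_mem_Icc h] with r hr
    have hmax : max r t ≤ b := max_le hr.2 ht
    have e2 : ∀ s, (Iic s).indicator (fun _ => (1 : ℝ)) r * deriv f s
        = (Ici r).indicator (deriv f) s := fun s => by
      by_cases hs : r ≤ s <;> simp [indicator, hs]
    simp_rw [e2]
    rw [setIntegral_indicator measurableSet_Ici, ← integral_deriv_of_lipschitzWith hf,
      intervalIntegral.integral_of_le hmax]
    refine setIntegral_congr_set ?_
    -- The sets `(t, b] ∩ [r, ∞)` and `(max r t, b]` can differ only at the point `r`.
    have hr' : ∀ᵐ s : ℝ, s ≠ r := by simp [ae_iff]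
    filter_upwards [hr'] with s hs
    refine propext ⟨fun hx => ?_, fun hx => ?_⟩
    · exact ⟨max_lt (lt_of_le_of_ne hx.2 hs.symm) hx.1.1, hx.1.2⟩
    · have := max_lt_iff.mp hx.1
      exact ⟨⟨this.2, hx.2⟩, this.1.le⟩
  · refine Integrable.of_bound (C := K) ?_ (ae_of_all _ fun p => ?_)
    · exact (hmeas.mul ((measurable_deriv f).comp measurable_fst)).aestronglyMeasurable
    · simp only [Function.uncurry, norm_mul]
      have h1 : ‖(Iic p.1).indicator (fun _ => (1 : ℝ)) p.2‖ ≤ 1 := by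
        by_cases hp : p.2 ≤ p.1 <;> simp [indicator, hp]
      have h2 := norm_deriv_le hf p.1
      rw [← Real.norm_eq_abs] at h2
      calc _ ≤ 1 * (K : ℝ) := mul_le_mul h1 h2 (norm_nonneg _) zero_le_one
        _ = K := one_mul _

/-! ### Paths on the whole line and the integrated form of the functional -/

/-- Matrix paths on the line, constant outside `[0, m]`, increasing from `0` to `Q`, with
Lipschitz entries. -/
structure GlobalPath (Q : Matrix (Fin m) (Fin m) ℝ) (Φ : ℝ → Matrix (Fin m) (Fin m) ℝ) :
    Prop where
  lipschitz : ∃ K : ℝ≥0, ∀ i j, LipschitzWith K fun t => Φ t i j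
  mono : ∀ s t, s ≤ t → (Φ t - Φ s).PosSemidef
  eq_zero : ∀ t ≤ 0, Φ t = 0
  eq_top : ∀ t, (m : ℝ) ≤ t → Φ t = Q

namespace GlobalPath

variable {Q : Matrix (Fin m) (Fin m) ℝ} {Φ : ℝ → Matrix (Fin m) (Fin m) ℝ}

theorem posSemidef (hΦ : GlobalPath Q Φ) (t : ℝ) : (Φ t).PosSemidef := by
  have := hΦ.mono (min t 0) t (min_le_left _ _)
  rwa [hΦ.eq_zero _ (min_le_right _ _), sub_zero] at this

theorem le_top (hΦ : GlobalPath Q Φ) (t : ℝ) : (Q - Φ t).PosSemidef := by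
  have := hΦ.mono t (max t m) (le_max_left _ _)
  rwa [hΦ.eq_top _ (le_max_right _ _)] at this

theorem symm_apply (hΦ : GlobalPath Q Φ) (t : ℝ) (i j : Fin m) : Φ t i j = Φ t j i :=
  PosSemidef.symm_apply (hΦ.posSemidef t) i j

theorem abs_apply_le_one (hΦ : GlobalPath Q Φ) (hQ : IsConstraint Q) (t : ℝ) (i j : Fin m) :
    |Φ t i j| ≤ 1 := by
  have h := PosSemidef.abs_apply_le (hΦ.posSemidef t) i j
  have hd : ∀ k, Φ t k k ≤ 1 := fun k => by
    have := (hΦ.le_top t).diag_nonneg (i := k)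
    rw [Matrix.sub_apply, hQ.diag] at this
    linarith
  linarith [hd i, hd j]

theorem continuous_apply (hΦ : GlobalPath Q Φ) (i j : Fin m) : Continuous fun t => Φ t i j := by
  obtain ⟨K, hK⟩ := hΦ.lipschitz
  exact (hK i j).continuous

end GlobalPath

/-- The entrywise derivative of a matrix path on the line. -/
def pathD (Φ : ℝ → Matrix (Fin m) (Fin m) ℝ) (t : ℝ) : Matrix (Fin m) (Fin m) ℝ :=
  Matrix.of fun i j => deriv (fun s => Φ s i j) t

theorem pathDeriv_eq_pathD (Φ : ℝ → Matrix (Fin m) (Fin m) ℝ) {t : ℝ} (ht : t ∈ Ioo (0 : ℝ) m) :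
    pathDeriv Φ t = pathD Φ t := by
  ext i j
  exact derivWithin_of_mem_nhds (Icc_mem_nhds ht.1 ht.2)

theorem ae_pathDeriv_eq (Φ : ℝ → Matrix (Fin m) (Fin m) ℝ) {a b : ℝ} (ha : 0 ≤ a) (hab : a ≤ b)
    (hb : b ≤ m) : ∀ᵐ t : ℝ, t ∈ uIoc a b → pathDeriv Φ t = pathD Φ t := by
  have hr' : ∀ᵐ s : ℝ, s ≠ b := by simp [ae_iff]
  filter_upwards [hr'] with s hs hmem
  rw [uIoc_of_le hab] at hmem
  exact pathDeriv_eq_pathD Φ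
    ⟨ha.trans_lt hmem.1, (lt_of_le_of_ne hmem.2 hs).trans_le hb⟩

theorem pathD_symm {Φ : ℝ → Matrix (Fin m) (Fin m) ℝ} (h : ∀ t i j, Φ t i j = Φ t j i)
    (t : ℝ) (i j : Fin m) : pathD Φ t i j = pathD Φ t j i := by
  simp only [pathD, Matrix.of_apply, h _ i j]

theorem measurable_pathD (Φ : ℝ → Matrix (Fin m) (Fin m) ℝ) (i j : Fin m) :
    Measurable fun t => pathD Φ t i j := measurable_deriv _

/-- The weighted average `∫ w(s) F(s ∨ t) dμ(s)`. -/
def tail (μ : Measure ℝ) (w : ℝ → ℝ) (F : ℝ → Matrix (Fin m) (Fin m) ℝ) (t : ℝ) :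
    Matrix (Fin m) (Fin m) ℝ :=
  Matrix.of fun i j => ∫ s, w s * F (max s t) i j ∂μ

/-- The closed form of `Φ̂`. -/
def hatM (Q : Matrix (Fin m) (Fin m) ℝ) (μ : Measure ℝ) (Φ : ℝ → Matrix (Fin m) (Fin m) ℝ) :
    ℝ → Matrix (Fin m) (Fin m) ℝ :=
  tail μ (fun _ => 1) fun s => Q - Φ s

/-- The closed form `∫ (Q - Φ(s ∨ t)) dμ(s)` contains no derivative and is affine in `μ` and in `Φ`
separately. Perturbing either one therefore changes `Φ̂` by an exactly linear term in `ε`. -/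
theorem hatPath_eq_hatM {Q : Matrix (Fin m) (Fin m) ℝ} {Φ : ℝ → Matrix (Fin m) (Fin m) ℝ}
    (hΦ : GlobalPath Q Φ) {μ : Measure ℝ} [IsProbabilityMeasure μ]
    (h : μ (Icc (0 : ℝ) m)ᶜ = 0) {t : ℝ} (ht : t ∈ Icc (0 : ℝ) m) :
    hatPath μ Φ t = hatM Q μ Φ t := by
  obtain ⟨K, hK⟩ := hΦ.lipschitz
  ext i j
  simp only [hatPath, hatM, tail, Matrix.of_apply, one_mul, Matrix.sub_apply]
  have := integral_distr_mul_deriv h (hK i j) ht.2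
  rw [hΦ.eq_top m le_rfl] at this
  rw [← this]
  refine intervalIntegral.integral_congr_ae ?_
  filter_upwards [ae_pathDeriv_eq Φ ht.1 ht.2 le_rfl] with s hs hmem
  rw [hs hmem]; rfl

theorem exists_lipschitzWith_potential {β : ℕ → Fin m → ℝ} (hβ : IsMixedEvenModel β)
    (h : Fin m → ℝ) {Q : Matrix (Fin m) (Fin m) ℝ} (hQ : IsConstraint Q)
    {Φ : ℝ → Matrix (Fin m) (Fin m) ℝ} (hΦ : GlobalPath Q Φ) :
    ∃ K : ℝ≥0, LipschitzWith K fun t => potential β h (Φ t) := by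
  obtain ⟨K, hK⟩ := hΦ.lipschitz
  obtain ⟨M, hM⟩ := exists_xiEntryD_bound hβ
  refine exists_lipschitzWith_sum _ fun i _ => exists_lipschitzWith_sum _ fun j _ => ?_
  obtain ⟨L, hL⟩ := exists_lipschitzWith_const_mul (h i * h j) ⟨K, hK i j⟩
  have h1 : LipschitzOnWith M (xiEntry β i j) (Icc (-1) 1) :=
    (convex_Icc _ _).lipschitzOnWith_of_nnnorm_hasDerivWithin_le
      (fun a ha => (hasDerivAt_xiEntry hβ i j (abs_le.mpr ha)).hasDerivWithinAt)
      fun a ha => by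
        have := hM i j a (abs_le.mpr ha)
        rw [← NNReal.coe_le_coe]
        simpa using this
  have h2 : LipschitzWith (M * K) fun t => xiEntry β i j (Φ t i j) := by
    rw [← lipschitzOnWith_univ]
    exact h1.comp ((hK i j).lipschitzOnWith (s := univ))
      fun t _ => abs_le.mp (hΦ.abs_apply_le_one hQ t i j)
  exact ⟨_, h2.add hL⟩

theorem ae_differentiableAt {Q : Matrix (Fin m) (Fin m) ℝ} {Φ : ℝ → Matrix (Fin m) (Fin m) ℝ}
    (hΦ : GlobalPath Q Φ) :
    ∀ᵐ t : ℝ, ∀ i j, DifferentiableAt ℝ (fun s => Φ s i j) t := by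
  obtain ⟨K, hK⟩ := hΦ.lipschitz
  exact ae_all_iff.mpr fun i => ae_all_iff.mpr fun j => (hK i j).ae_differentiableAt_real

theorem deriv_potential {β : ℕ → Fin m → ℝ} (hβ : IsMixedEvenModel β)
    (h : Fin m → ℝ) {Q : Matrix (Fin m) (Fin m) ℝ} (hQ : IsConstraint Q)
    {Φ : ℝ → Matrix (Fin m) (Fin m) ℝ} (hΦ : GlobalPath Q Φ) {t : ℝ}
    (ht : ∀ i j, DifferentiableAt ℝ (fun s => Φ s i j) t) :
    deriv (fun t => potential β h (Φ t)) t
      = pairing (xiD β (Φ t) + Matrix.vecMulVec h h) (pathD Φ t) := by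
  rw [pairing_xiD_eq _ _ _ _ (pathD_symm hΦ.symm_apply t)]
  refine HasDerivAt.deriv ?_
  refine HasDerivAt.fun_sum fun i _ => HasDerivAt.fun_sum fun j _ => ?_
  have h1 := (hasDerivAt_xiEntry hβ i j (hΦ.abs_apply_le_one hQ t i j)).comp t
    (ht i j).hasDerivAt
  have h2 := (ht i j).hasDerivAt.const_mul (h i * h j)
  refine (h1.add h2).congr_deriv ?_
  simp only [pathD, Matrix.of_apply]
  ring

/-- The Crisanti-Sommers functional after integration by parts. -/
theorem crisantiSommers_eq {β : ℕ → Fin m → ℝ} (hβ : IsMixedEvenModel β)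
    (h : Fin m → ℝ) {Q : Matrix (Fin m) (Fin m) ℝ} (hQ : IsConstraint Q)
    {Φ : ℝ → Matrix (Fin m) (Fin m) ℝ} (hΦ : GlobalPath Q Φ) {μ : Measure ℝ}
    [IsProbabilityMeasure μ] (hμ : μ (Icc (0 : ℝ) m)ᶜ = 0) {T : ℝ} (hT : T ∈ Icc (0 : ℝ) m) :
    crisantiSommers β h T μ Φ = (1 / 2) * ((∫ s, (potential β h Q - potential β h (Φ s)) ∂μ)
      + Real.log (Q - Φ T).det + ∫ t in (0 : ℝ)..T, pairing (hatM Q μ Φ t)⁻¹ (pathD Φ t)) := by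
  obtain ⟨K, hK⟩ := exists_lipschitzWith_potential hβ h hQ hΦ
  unfold crisantiSommers
  rw [hΦ.eq_top m le_rfl]
  congr 2
  · congr 1
    have hm0 : (0 : ℝ) ≤ m := Nat.cast_nonneg m
    have e := integral_distr_mul_deriv hμ hK hm0
    have e2 : ∫ s, (potential β h Q - potential β h (Φ s)) ∂μ
        = ∫ r, (potential β h (Φ m) - potential β h (Φ (max r 0))) ∂μ := by
      refine integral_congr_ae ?_
      filter_upwards [ae_mem_Icc hμ] with r hr
      rw [max_eq_left hr.1, hΦ.eq_top m le_rfl]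
    rw [e2, ← e]
    refine intervalIntegral.integral_congr_ae ?_
    filter_upwards [ae_pathDeriv_eq Φ le_rfl hm0 le_rfl, ae_differentiableAt hΦ] with s hs hd hmem
    rw [hs hmem, deriv_potential hβ h hQ hΦ hd]
  · refine intervalIntegral.integral_congr_ae ?_
    filter_upwards [ae_pathDeriv_eq Φ le_rfl hT.1 hT.2] with s hs hmem
    rw [hs hmem]
    rw [uIoc_of_le hT.1] at hmem
    rw [hatPath_eq_hatM hΦ hμ ⟨hmem.1.le, hmem.2.trans hT.2⟩]

/-! ### Measurability of matrix expressions -/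

section Measurability

variable {α : Type*} [MeasurableSpace α]

theorem measurable_det {A : α → Matrix (Fin m) (Fin m) ℝ}
    (hA : ∀ i j, Measurable fun t => A t i j) : Measurable fun t => (A t).det := by
  simp only [Matrix.det_apply]
  refine Finset.measurable_sum _ fun σ _ => ?_
  exact (Finset.measurable_prod _ fun i _ => hA _ _).const_smul (Equiv.Perm.sign σ)

theorem measurable_inv_apply {A : α → Matrix (Fin m) (Fin m) ℝ}
    (hA : ∀ i j, Measurable fun t => A t i j) (i j : Fin m) :
    Measurable fun t => (A t)⁻¹ i j := by
  -- Cramer's rule, valid for singular matrices too since both sides are then `0`; no invertibility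
  -- is needed for measurability.
  have e : ∀ t, (A t)⁻¹ i j = ((A t).det)⁻¹ * ((A t).updateRow j (Pi.single i 1)).det := fun t => by
    rw [Matrix.inv_def, Matrix.smul_apply, Matrix.adjugate_apply, Ring.inverse_eq_inv', smul_eq_mul]
  simp_rw [e]
  refine (measurable_det hA).inv.mul (measurable_det fun k l => ?_)
  by_cases hk : k = j
  · subst hk; simp
  · simpa [Matrix.updateRow_ne hk] using hA k l

theorem measurable_mul_apply {A B : α → Matrix (Fin m) (Fin m) ℝ}
    (hA : ∀ i j, Measurable fun t => A t i j) (hB : ∀ i j, Measurable fun t => B t i j)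
    (i j : Fin m) : Measurable fun t => (A t * B t) i j := by
  simp only [Matrix.mul_apply]
  exact Finset.measurable_sum _ fun k _ => (hA _ _).mul (hB _ _)

theorem measurable_pairing {A B : α → Matrix (Fin m) (Fin m) ℝ}
    (hA : ∀ i j, Measurable fun t => A t i j) (hB : ∀ i j, Measurable fun t => B t i j) :
    Measurable fun t => pairing (A t) (B t) := by
  simp only [pairing_eq_sum]
  exact Finset.measurable_sum _ fun i _ => Finset.measurable_sum _ fun j _ => (hA _ _).mul (hB _ _)

end Measurability

/-! ### Expansion of the inverse and averages against the measure -/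

/-- Second-order expansion of `⟨(A + ε B)⁻¹, P + ε R⟩`, uniformly over bounded data. -/
theorem exists_pairing_inv_expansion (m : ℕ) (c b p r : ℝ) : ∃ K : ℝ, 0 ≤ K ∧
    ∀ (A B P R : Matrix (Fin m) (Fin m) ℝ) (ε : ℝ), A.PosDef → (A + ε • B).PosDef →
      (∀ i j, |A⁻¹ i j| ≤ c) → (∀ i j, |(A + ε • B)⁻¹ i j| ≤ c) → (∀ i j, |B i j| ≤ b) →
      (∀ i j, |P i j| ≤ p) → (∀ i j, |R i j| ≤ r) →
      pairing (A + ε • B)⁻¹ (P + ε • R) ≤ pairing A⁻¹ P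
        + ε * (pairing A⁻¹ R - pairing (A⁻¹ * P * A⁻¹) B) + ε ^ 2 * K := by
  refine ⟨|m * (m * (m * (m * (m * (m * (c * b) * c) * b) * c) * p))
    + m * (m * (m * (m * (c * b) * c) * r))|, abs_nonneg _, ?_⟩
  intro A B P R ε hA hAε hc hcε hb hp hr
  set X := (A + ε • B)⁻¹ with hX
  set Y := A⁻¹ with hY
  have e1 : X - Y = -(ε • (X * B * Y)) := by
    have := inv_sub_inv_of_posDef hAε hA
    rw [← hX, ← hY] at this
    rw [this, sub_add_cancel_left]
    simp
  have e2 : X = Y - ε • (X * B * Y) := by rw [sub_eq_add_neg, ← e1]; abel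
  -- The resolvent identity substituted into itself once: `X = Y - ε YBY + ε² XBYBY`. The remaining
  -- `X` sits in the quadratic term, where only its entrywise bound `c` is used.
  have e3 : X * B * Y = Y * B * Y - ε • (X * B * Y * B * Y) := by
    conv_lhs => rw [e2]
    simp only [sub_mul, smul_mul_assoc]
  have h1 : |pairing (X * B * Y * B * Y) P|
      ≤ m * (m * (m * (m * (m * (m * (c * b) * c) * b) * c) * p)) :=
    abs_pairing_le (abs_mul_apply_le (abs_mul_apply_le (abs_mul_apply_le
      (abs_mul_apply_le hcε hb) hc) hb) hc) hp
  have h2 : |pairing (X * B * Y) R| ≤ m * (m * (m * (m * (c * b) * c) * r)) :=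
    abs_pairing_le (abs_mul_apply_le (abs_mul_apply_le hcε hb) hc) hr
  have e4 : pairing X (P + ε • R) = pairing Y P + ε * (pairing Y R - pairing (Y * P * Y) B)
      + ε ^ 2 * (pairing (X * B * Y * B * Y) P - pairing (X * B * Y) R) := by
    have a1 : pairing X P = pairing Y P - ε * pairing (Y * P * Y) B
        + ε ^ 2 * pairing (X * B * Y * B * Y) P := by
      have e5 : pairing (X * B * Y) P = pairing (Y * B * Y) P
          - ε * pairing (X * B * Y * B * Y) P := by
        rw [← pairing_smul_left, ← pairing_sub_left, ← e3]
      conv_lhs => rw [e2]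
      rw [pairing_sub_left, pairing_smul_left, e5, pairing_conj_comm Y B P]
      ring
    have a2 : pairing X R = pairing Y R - ε * pairing (X * B * Y) R := by
      conv_lhs => rw [e2]
      rw [pairing_sub_left, pairing_smul_left]
    rw [pairing_add_right, pairing_smul_right, a1, a2]
    ring
  rw [e4]
  have h3 : pairing (X * B * Y * B * Y) P - pairing (X * B * Y) R
      ≤ |m * (m * (m * (m * (m * (m * (c * b) * c) * b) * c) * p))
        + m * (m * (m * (m * (c * b) * c) * r))| := by
    refine le_trans ?_ (le_abs_self _)
    linarith [(abs_le.mp h1).2, (abs_le.mp h2).1]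
  have := mul_le_mul_of_nonneg_left h3 (sq_nonneg ε)
  linarith

section Tail

variable {μ : Measure ℝ} [IsProbabilityMeasure μ] {w : ℝ → ℝ} {W : ℝ}
  {F : ℝ → Matrix (Fin m) (Fin m) ℝ} {C : ℝ} {K : ℝ≥0}

theorem integrable_tail (hw : Measurable w) (hW : ∀ s, |w s| ≤ W)
    (hF : ∀ i j, Continuous fun t => F t i j) (hC : ∀ t i j, |F t i j| ≤ C) (t : ℝ) (i j : Fin m) :
    Integrable (fun s => w s * F (max s t) i j) μ := by
  refine integrable_of_bound (C := W * C) ?_ fun s => ?_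
  · exact hw.mul ((hF i j).measurable.comp (measurable_id.max measurable_const))
  · rw [abs_mul]
    exact mul_le_mul (hW s) (hC _ i j) (abs_nonneg _) ((abs_nonneg _).trans (hW s))

theorem abs_integral_le_of_bound {f : ℝ → ℝ} {C : ℝ} (hC : ∀ s, |f s| ≤ C) :
    |∫ s, f s ∂μ| ≤ C := by
  have := norm_integral_le_of_norm_le_const (μ := μ) (ae_of_all _ fun s => (by simpa using hC s :
    ‖f s‖ ≤ C))
  simpa using this

theorem abs_tail_le (hW : ∀ s, |w s| ≤ W) (hC : ∀ t i j, |F t i j| ≤ C) (t : ℝ) (i j : Fin m) :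
    |tail μ w F t i j| ≤ W * C := by
  refine abs_integral_le_of_bound fun s => ?_
  rw [abs_mul]
  exact mul_le_mul (hW s) (hC _ i j) (abs_nonneg _) ((abs_nonneg _).trans (hW s))

theorem lipschitzWith_tail (hw : Measurable w) (hW : ∀ s, |w s| ≤ W) (hC : ∀ t i j, |F t i j| ≤ C)
    (hF : ∀ i j, LipschitzWith K fun t => F t i j) (i j : Fin m) :
    LipschitzWith (W.toNNReal * K) fun t => tail μ w F t i j := by
  have hW0 : 0 ≤ W := (abs_nonneg _).trans (hW 0)
  refine LipschitzWith.of_dist_le_mul fun s t => ?_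
  have hc : ∀ i j, Continuous fun t => F t i j := fun i j => (hF i j).continuous
  rw [Real.dist_eq, tail, tail, Matrix.of_apply, Matrix.of_apply,
    ← integral_sub (integrable_tail hw hW hc hC s i j) (integrable_tail hw hW hc hC t i j)]
  refine abs_integral_le_of_bound fun r => ?_
  rw [← mul_sub, abs_mul, NNReal.coe_mul, Real.coe_toNNReal _ hW0, mul_assoc]
  refine mul_le_mul (hW r) ?_ (abs_nonneg _) hW0
  refine (abs_sub_le_of_lipschitzWith (hF i j) _ _).trans ?_
  rw [Real.dist_eq]
  refine mul_le_mul_of_nonneg_left ?_ K.2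
  exact (abs_max_sub_max_le_max r s r t).trans (by simp)

/-- Exchange of the integrations in `⟨N(t), ∫ w(s) F(s ∨ t) dμ(s)⟩`. -/
theorem integral_pairing_tail (hw : Measurable w) (hW : ∀ s, |w s| ≤ W)
    (hF : ∀ i j, Continuous fun t => F t i j) (hC : ∀ t i j, |F t i j| ≤ C)
    {N : ℝ → Matrix (Fin m) (Fin m) ℝ} (hN : ∀ i j, Measurable fun t => N t i j) {T n : ℝ}
    (hT : 0 ≤ T) (hn : ∀ t ∈ Ioc 0 T, ∀ i j, |N t i j| ≤ n) :
    ∫ t in (0 : ℝ)..T, pairing (N t) (tail μ w F t)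
      = ∫ s, w s * (∫ t in (0 : ℝ)..T, pairing (N t) (F (max s t))) ∂μ := by
  have hW0 : 0 ≤ W := (abs_nonneg _).trans (hW 0)
  have e1 : ∀ t, pairing (N t) (tail μ w F t) = ∫ s, w s * pairing (N t) (F (max s t)) ∂μ := by
    intro t
    simp only [pairing_eq_sum, tail, Matrix.of_apply, Finset.mul_sum]
    rw [integral_finsetSum]
    · refine Finset.sum_congr rfl fun i _ => ?_
      rw [integral_finsetSum]
      · refine Finset.sum_congr rfl fun j _ => ?_
        rw [← integral_const_mul]
        exact integral_congr_ae (ae_of_all _ fun s => by ring)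
      · intro j _
        have := (integrable_tail hw hW hF hC t j i (μ := μ)).const_mul (N t i j)
        exact this.congr (ae_of_all _ fun s => by ring)
    · intro i _
      refine integrable_finsetSum _ fun j _ => ?_
      have := (integrable_tail hw hW hF hC t j i (μ := μ)).const_mul (N t i j)
      exact this.congr (ae_of_all _ fun s => by ring)
  simp_rw [e1, ← intervalIntegral.integral_const_mul]
  rw [intervalIntegral.integral_of_le hT]
  simp_rw [intervalIntegral.integral_of_le hT]
  refine integral_integral_swap ?_
  have hmeas : Measurable fun q : ℝ × ℝ => w q.2 * pairing (N q.1) (F (max q.2 q.1)) := by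
    refine (hw.comp measurable_snd).mul (measurable_pairing (fun i j => ?_) fun i j => ?_)
    · exact (hN i j).comp measurable_fst
    · exact (hF i j).measurable.comp (measurable_snd.max measurable_fst)
  refine Integrable.of_bound (C := W * (m * (m * (n * C)))) hmeas.aestronglyMeasurable ?_
  -- The bound on `N` is available on `(0, T]` only, so it holds almost everywhere for the product
  -- measure.
  have hae : ∀ᵐ q ∂((volume.restrict (Ioc 0 T)).prod μ), q.1 ∈ Ioc 0 T :=
    Measure.quasiMeasurePreserving_fst.ae (ae_restrict_mem measurableSet_Ioc)
  filter_upwards [hae] with q hq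
  simp only [Function.uncurry, norm_mul, Real.norm_eq_abs]
  exact mul_le_mul (hW _) (abs_pairing_le (hn _ hq) (hC _)) (abs_nonneg _) hW0

end Tail

/-! ### Pairs cut at `T`: two-sided bounds on `Φ̂` and expansion of the energy -/

/-- A pair given by a path on the line, with a point `T` beyond the support of the measure. -/
structure CutPair (Q : Matrix (Fin m) (Fin m) ℝ) (μ : Measure ℝ)
    (Φ : ℝ → Matrix (Fin m) (Fin m) ℝ) (T : ℝ) : Prop where
  path : GlobalPath Q Φ
  prob : IsProbabilityMeasure μ
  compl : μ (Icc (0 : ℝ) T)ᶜ = 0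
  pos : 0 < T
  lt : T < m
  posDef : (Q - Φ T).PosDef

theorem integral_quadForm {μ : Measure ℝ} {F : ℝ → Matrix (Fin m) (Fin m) ℝ}
    (hF : ∀ i j, Integrable (fun s => F s i j) μ) (v : Fin m → ℝ) :
    ∑ i, ∑ j, v i * v j * ∫ s, F s i j ∂μ = ∫ s, ∑ i, ∑ j, v i * v j * F s i j ∂μ := by
  rw [integral_finsetSum]
  · refine Finset.sum_congr rfl fun i _ => ?_
    rw [integral_finsetSum]
    · exact Finset.sum_congr rfl fun j _ => (integral_const_mul _ _).symm
    · exact fun j _ => (hF i j).const_mul _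
  · exact fun i _ => integrable_finsetSum _ fun j _ => (hF i j).const_mul _

theorem posSemidef_integral {μ : Measure ℝ} {F : ℝ → Matrix (Fin m) (Fin m) ℝ}
    (hF : ∀ i j, Integrable (fun s => F s i j) μ) (h : ∀ᵐ s ∂μ, (F s).PosSemidef) :
    (Matrix.of fun i j => ∫ s, F s i j ∂μ).PosSemidef := by
  refine PosSemidef.of_quadForm (fun i j => ?_) fun v => ?_
  · refine integral_congr_ae ?_
    filter_upwards [h] with s hs
    exact PosSemidef.symm_apply hs i j
  · simp only [Matrix.of_apply]
    rw [integral_quadForm hF]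
    refine integral_nonneg_of_ae ?_
    filter_upwards [h] with s hs
    exact PosSemidef.quadForm_nonneg hs v

namespace CutPair

variable {Q : Matrix (Fin m) (Fin m) ℝ} {μ : Measure ℝ} {Φ : ℝ → Matrix (Fin m) (Fin m) ℝ} {T : ℝ}

theorem compl_top (hp : CutPair Q μ Φ T) : μ (Icc (0 : ℝ) m)ᶜ = 0 :=
  measure_mono_null (compl_subset_compl.mpr (Icc_subset_Icc_right hp.lt.le)) hp.compl

theorem abs_sub_le (hp : CutPair Q μ Φ T) (hQ : IsConstraint Q) (t : ℝ) (i j : Fin m) :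
    |(Q - Φ t) i j| ≤ 2 := by
  have h1 := abs_le.mp (hp.path.abs_apply_le_one hQ t i j)
  have h2 := hQ.mem_Icc i j
  rw [Matrix.sub_apply, abs_le]
  constructor <;> linarith [h1.1, h1.2, h2.1, h2.2]

theorem integrable_hatM (hp : CutPair Q μ Φ T) (hQ : IsConstraint Q) (t : ℝ) (i j : Fin m) :
    Integrable (fun s => (Q - Φ (max s t)) i j) μ := by
  have := hp.prob
  have h := integrable_tail (μ := μ) (w := fun _ => (1 : ℝ)) (W := 1) (F := fun s => Q - Φ s)
    (C := 2)
    measurable_const (by simp) (fun i j => by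
      exact continuous_const.sub (hp.path.continuous_apply i j)) (hp.abs_sub_le hQ) t i j
  simpa using h

theorem lipschitzWith_hatM (hp : CutPair Q μ Φ T) (hQ : IsConstraint Q) :
    ∃ K : ℝ≥0, ∀ i j, LipschitzWith K fun t => hatM Q μ Φ t i j := by
  have := hp.prob
  obtain ⟨K, hK⟩ := hp.path.lipschitz
  refine ⟨(1 : ℝ).toNNReal * (0 + K), fun i j => ?_⟩
  exact lipschitzWith_tail (μ := μ) (w := fun _ => (1 : ℝ)) (F := fun s => Q - Φ s) (C := 2)
    measurable_const (by simp) (hp.abs_sub_le hQ)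
    (fun i j => (LipschitzWith.const (Q i j)).sub (hK i j)) i j

theorem measurable_hatM (hp : CutPair Q μ Φ T) (hQ : IsConstraint Q) (i j : Fin m) :
    Measurable fun t => hatM Q μ Φ t i j := by
  obtain ⟨K, hK⟩ := hp.lipschitzWith_hatM hQ
  exact (hK i j).continuous.measurable

/-- The difference is `∫ (Φ(T) - Φ(s ∨ t)) dμ(s)`, whose integrand is positive semidefinite because
`μ` lives on `[0, T]`. This keeps `Φ̂` uniformly invertible up to time `T`. -/
theorem hatM_sub_posSemidef (hp : CutPair Q μ Φ T) (hQ : IsConstraint Q) {t : ℝ} (ht : t ≤ T) :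
    (hatM Q μ Φ t - (Q - Φ T)).PosSemidef := by
  have := hp.prob
  have e : hatM Q μ Φ t - (Q - Φ T)
      = Matrix.of fun i j => ∫ s, (Φ T - Φ (max s t)) i j ∂μ := by
    ext i j
    have e1 : ∀ s, (Φ T - Φ (max s t)) i j = (Q - Φ (max s t)) i j - (Q - Φ T) i j := fun s => by
      simp
    simp only [hatM, tail, Matrix.sub_apply _ (Q - Φ T), Matrix.of_apply, one_mul, e1]
    rw [integral_sub (hp.integrable_hatM hQ t i j) (integrable_const _)]
    simp
  rw [e]
  refine posSemidef_integral (fun i j => ?_) ?_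
  · have := (hp.integrable_hatM hQ t i j).sub (integrable_const ((Q - Φ T) i j))
    refine this.congr (ae_of_all _ fun s => ?_)
    simp
  · filter_upwards [ae_mem_Icc hp.compl] with s hs
    exact hp.path.mono _ _ (max_le hs.2 ht)

/-- The difference is `∫ Φ(s ∨ t) dμ(s)`. This upper bound allows `Φ̂⁻¹` to be traded for `Q⁻¹` in
the stability estimate. -/
theorem sub_hatM_posSemidef (hp : CutPair Q μ Φ T) (hQ : IsConstraint Q) (t : ℝ) :
    (Q - hatM Q μ Φ t).PosSemidef := by
  have := hp.prob
  have e : Q - hatM Q μ Φ t = Matrix.of fun i j => ∫ s, (Φ (max s t)) i j ∂μ := by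
    ext i j
    have e1 : ∀ s, (Φ (max s t)) i j = Q i j - (Q - Φ (max s t)) i j := fun s => by simp
    simp only [hatM, tail, Matrix.sub_apply Q (Matrix.of _), Matrix.of_apply, one_mul]
    simp_rw [e1]
    rw [integral_sub (integrable_const _) (hp.integrable_hatM hQ t i j)]
    simp
  rw [e]
  refine posSemidef_integral (fun i j => ?_) (ae_of_all _ fun s => hp.path.posSemidef _)
  have := (integrable_const (Q i j)).sub (hp.integrable_hatM hQ t i j)
  refine this.congr (ae_of_all _ fun s => ?_)
  simp

theorem hatM_posDef (hp : CutPair Q μ Φ T) (hQ : IsConstraint Q) {t : ℝ} (ht : t ≤ T) :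
    (hatM Q μ Φ t).PosDef :=
  PosDef.of_le hp.posDef (hp.hatM_sub_posSemidef hQ ht)

theorem abs_inv_hatM_le (hp : CutPair Q μ Φ T) (hQ : IsConstraint Q) {t : ℝ} (ht : t ≤ T)
    (i j : Fin m) : |(hatM Q μ Φ t)⁻¹ i j| ≤ (Q - Φ T)⁻¹.trace :=
  abs_inv_apply_le hp.posDef (hp.hatM_sub_posSemidef hQ ht) i j

end CutPair

theorem abs_pathD_le {Φ : ℝ → Matrix (Fin m) (Fin m) ℝ} {K : ℝ≥0}
    (hK : ∀ i j, LipschitzWith K fun t => Φ t i j) (t : ℝ) (i j : Fin m) : |pathD Φ t i j| ≤ K :=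
  norm_deriv_le (hK i j) t

/-- The matrix `Φ̂⁻¹ Φ' Φ̂⁻¹`. -/
def resolv (Q : Matrix (Fin m) (Fin m) ℝ) (μ : Measure ℝ) (Φ : ℝ → Matrix (Fin m) (Fin m) ℝ)
    (t : ℝ) : Matrix (Fin m) (Fin m) ℝ :=
  (hatM Q μ Φ t)⁻¹ * pathD Φ t * (hatM Q μ Φ t)⁻¹

namespace CutPair

variable {Q : Matrix (Fin m) (Fin m) ℝ} {μ : Measure ℝ} {Φ : ℝ → Matrix (Fin m) (Fin m) ℝ} {T : ℝ}

theorem measurable_resolv (hp : CutPair Q μ Φ T) (hQ : IsConstraint Q) (i j : Fin m) :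
    Measurable fun t => resolv Q μ Φ t i j :=
  measurable_mul_apply (measurable_mul_apply (measurable_inv_apply (hp.measurable_hatM hQ))
    (measurable_pathD Φ)) (measurable_inv_apply (hp.measurable_hatM hQ)) i j

theorem exists_abs_resolv_le (hp : CutPair Q μ Φ T) (hQ : IsConstraint Q) :
    ∃ n : ℝ, ∀ t ≤ T, ∀ i j, |resolv Q μ Φ t i j| ≤ n := by
  obtain ⟨K, hK⟩ := hp.path.lipschitz
  exact ⟨_, fun t ht => abs_mul_apply_le (abs_mul_apply_le (hp.abs_inv_hatM_le hQ ht)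
    (abs_pathD_le hK t)) (hp.abs_inv_hatM_le hQ ht)⟩

/-- First variation of `∫ ⟨Φ̂⁻¹, Φ'⟩`: an upper bound with a quadratic error. -/
theorem exists_integral_expansion (hp : CutPair Q μ Φ T) (hQ : IsConstraint Q)
    {B R : ℝ → Matrix (Fin m) (Fin m) ℝ} {b r : ℝ} (hBm : ∀ i j, Measurable fun t => B t i j)
    (hRm : ∀ i j, Measurable fun t => R t i j) (hB : ∀ t i j, |B t i j| ≤ b)
    (hR : ∀ t i j, |R t i j| ≤ r) :
    ∃ K : ℝ, ∀ ε : ℝ, (∀ t ≤ T, (hatM Q μ Φ t + ε • B t - (Q - Φ T)).PosSemidef) →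
      ∫ t in (0 : ℝ)..T, pairing (hatM Q μ Φ t + ε • B t)⁻¹ (pathD Φ t + ε • R t)
        ≤ (∫ t in (0 : ℝ)..T, pairing (hatM Q μ Φ t)⁻¹ (pathD Φ t))
          + ε * ((∫ t in (0 : ℝ)..T, pairing (hatM Q μ Φ t)⁻¹ (R t))
            - ∫ t in (0 : ℝ)..T, pairing (resolv Q μ Φ t) (B t)) + ε ^ 2 * K := by
  obtain ⟨L, hL⟩ := hp.path.lipschitz
  obtain ⟨n, hn⟩ := hp.exists_abs_resolv_le hQ
  obtain ⟨K, -, hK⟩ := exists_pairing_inv_expansion m (Q - Φ T)⁻¹.trace b L r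
  have hAm := hp.measurable_hatM hQ
  have hsub : ∀ t ∈ uIoc 0 T, t ≤ T := fun t ht => by
    rw [uIoc_of_le hp.pos.le] at ht; exact ht.2
  have i1 : IntervalIntegrable (fun t => pairing (hatM Q μ Φ t)⁻¹ (pathD Φ t)) volume 0 T :=
    intervalIntegrable_of_bound (measurable_pairing (measurable_inv_apply hAm)
      (measurable_pathD Φ))
      fun t ht => abs_pairing_le (hp.abs_inv_hatM_le hQ (hsub t ht)) (abs_pathD_le hL t)
  have i2 : IntervalIntegrable (fun t => pairing (hatM Q μ Φ t)⁻¹ (R t)) volume 0 T :=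
    intervalIntegrable_of_bound (measurable_pairing (measurable_inv_apply hAm) hRm)
      fun t ht => abs_pairing_le (hp.abs_inv_hatM_le hQ (hsub t ht)) (hR t)
  have i3 : IntervalIntegrable (fun t => pairing (resolv Q μ Φ t) (B t)) volume 0 T :=
    intervalIntegrable_of_bound (measurable_pairing (hp.measurable_resolv hQ) hBm)
      fun t ht => abs_pairing_le (hn t (hsub t ht)) (hB t)
  refine ⟨T * K, fun ε hε => ?_⟩
  have i0 : IntervalIntegrable
      (fun t => pairing (hatM Q μ Φ t + ε • B t)⁻¹ (pathD Φ t + ε • R t)) volume 0 T := by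
    refine intervalIntegrable_of_bound (measurable_pairing (measurable_inv_apply fun i j => ?_)
      fun i j => ?_) fun t ht => abs_pairing_le (b := L + |ε| * r)
        (abs_inv_apply_le hp.posDef (hε t (hsub t ht))) fun i j => ?_
    · exact (hAm i j).add ((hBm i j).const_mul ε)
    · exact (measurable_pathD Φ i j).add ((hRm i j).const_mul ε)
    · refine (abs_add_le _ _).trans (add_le_add (abs_pathD_le hL t i j) ?_)
      rw [Matrix.smul_apply, smul_eq_mul, abs_mul]
      exact mul_le_mul_of_nonneg_left (hR t i j) (abs_nonneg _)
  have hmono := intervalIntegral.integral_mono_on hp.pos.le i0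
    ((i1.add ((i2.sub i3).const_mul ε)).add (intervalIntegrable_const (c := ε ^ 2 * K)))
    fun t ht => hK (hatM Q μ Φ t) (B t) (pathD Φ t) (R t) ε (hp.hatM_posDef hQ ht.2)
      (PosDef.of_le hp.posDef (hε t ht.2)) (hp.abs_inv_hatM_le hQ ht.2)
      (abs_inv_apply_le hp.posDef (hε t ht.2)) (hB t) (abs_pathD_le hL t) (hR t)
  refine hmono.trans_eq ?_
  rw [intervalIntegral.integral_add (i1.add ((i2.sub i3).const_mul ε)) intervalIntegrable_const,
    intervalIntegral.integral_add i1 ((i2.sub i3).const_mul ε),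
    intervalIntegral.integral_const_mul, intervalIntegral.integral_sub i2 i3]
  simp [mul_left_comm]

end CutPair

/-! ### First variation in the weights of the measure -/

theorem nonneg_of_first_variation {δ K ε₀ : ℝ} (hε₀ : 0 < ε₀)
    (h : ∀ ε, 0 < ε → ε ≤ ε₀ → 0 ≤ ε * δ + ε ^ 2 * K) : 0 ≤ δ := by
  by_contra! hδ
  have hK : 0 < |K| + 1 := by positivity
  -- This size makes `ε |K| < -δ/2`, so the quadratic error cannot offset a negative slope `δ`.
  set ε := min ε₀ (-δ / (2 * (|K| + 1))) with hε
  have h0 : 0 < ε := lt_min hε₀ (div_pos (by linarith) (by positivity))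
  have h1 := h ε h0 (min_le_left _ _)
  have h2 : ε * (2 * (|K| + 1)) ≤ -δ := by
    rw [← le_div_iff₀ (by positivity)]; exact min_le_right _ _
  have h3 : 0 ≤ δ + ε * K := by
    have : ε * δ + ε ^ 2 * K = ε * (δ + ε * K) := by ring
    rw [this] at h1
    exact nonneg_of_mul_nonneg_right h1 h0
  nlinarith [le_abs_self K]

/-- The part of twice the Crisanti-Sommers functional that varies with the pair when the value of
the path at `T` is kept. -/
def reduced (β : ℕ → Fin m → ℝ) (h : Fin m → ℝ) (Q : Matrix (Fin m) (Fin m) ℝ) (μ : Measure ℝ)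
    (Φ : ℝ → Matrix (Fin m) (Fin m) ℝ) (T : ℝ) : ℝ :=
  (∫ s, (potential β h Q - potential β h (Φ s)) ∂μ)
    + ∫ t in (0 : ℝ)..T, pairing (hatM Q μ Φ t)⁻¹ (pathD Φ t)

theorem CutPair.crisantiSommers_eq_reduced {β : ℕ → Fin m → ℝ} (hβ : IsMixedEvenModel β)
    (h : Fin m → ℝ) {Q : Matrix (Fin m) (Fin m) ℝ} (hQ : IsConstraint Q) {μ : Measure ℝ}
    {Φ : ℝ → Matrix (Fin m) (Fin m) ℝ} {T : ℝ} (hp : CutPair Q μ Φ T) :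
    crisantiSommers β h T μ Φ
      = (1 / 2) * (reduced β h Q μ Φ T + Real.log (Q - Φ T).det) := by
  have := hp.prob
  rw [crisantiSommers_eq hβ h hQ hp.path hp.compl_top ⟨hp.pos.le, hp.lt.le⟩, reduced]
  ring

/-- The measure `(1 + ε w) μ`. -/
def tilt (μ : Measure ℝ) (w : ℝ → ℝ) (ε : ℝ) : Measure ℝ :=
  μ.withDensity fun s => ENNReal.ofReal (1 + ε * w s)

section Tilt

variable {μ : Measure ℝ} {w : ℝ → ℝ} {W ε : ℝ}

/-- `ENNReal.ofReal` truncates negative values at `0`; for `|ε| W ≤ 1` the density in `tilt` is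
never truncated, so integrals against it are affine in `ε`. -/
theorem one_add_nonneg (hW : ∀ s, |w s| ≤ W) (hε : |ε| * W ≤ 1) (s : ℝ) : 0 ≤ 1 + ε * w s := by
  have h1 : |ε * w s| ≤ 1 := by
    rw [abs_mul]
    exact (mul_le_mul_of_nonneg_left (hW s) (abs_nonneg ε)).trans hε
  linarith [(abs_le.mp h1).1]

theorem integral_tilt (hw : Measurable w) (hW : ∀ s, |w s| ≤ W) (hε : |ε| * W ≤ 1) {g : ℝ → ℝ}
    (hg : Integrable g μ) (hwg : Integrable (fun s => w s * g s) μ) :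
    ∫ s, g s ∂(tilt μ w ε) = (∫ s, g s ∂μ) + ε * ∫ s, w s * g s ∂μ := by
  have hd : Measurable fun s => ENNReal.ofReal (1 + ε * w s) :=
    ENNReal.measurable_ofReal.comp (measurable_const.add (hw.const_mul ε))
  rw [tilt, integral_withDensity_eq_integral_toReal_smul hd
    (ae_of_all _ fun s => ENNReal.ofReal_lt_top), ← integral_const_mul,
    ← integral_add hg (hwg.const_mul ε)]
  refine integral_congr_ae (ae_of_all _ fun s => ?_)
  simp only [smul_eq_mul]
  rw [ENNReal.toReal_ofReal (one_add_nonneg hW hε s)]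
  ring

theorem isProbabilityMeasure_tilt [IsProbabilityMeasure μ] (hw : Measurable w)
    (hW : ∀ s, |w s| ≤ W) (hε : |ε| * W ≤ 1)
    (h0 : ∫ s, w s ∂μ = 0) : IsProbabilityMeasure (tilt μ w ε) := by
  have hi : Integrable w μ := integrable_of_bound hw hW
  have hi' : Integrable (fun s => 1 + ε * w s) μ := (integrable_const 1).add (hi.const_mul ε)
  constructor
  rw [tilt, withDensity_apply _ MeasurableSet.univ, Measure.restrict_univ,
    ← ofReal_integral_eq_lintegral_ofReal hi'
      (ae_of_all _ fun s => one_add_nonneg hW hε s),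
    integral_add (integrable_const _) (hi.const_mul ε), integral_const_mul, h0]
  simp

end Tilt

theorem tilt_absolutelyContinuous (μ : Measure ℝ) (w : ℝ → ℝ) (ε : ℝ) : tilt μ w ε ≪ μ :=
  withDensity_absolutelyContinuous _ _

/-- The derivative of the functional in the direction of a point mass at `s`. -/
def massDeriv (β : ℕ → Fin m → ℝ) (h : Fin m → ℝ) (Q : Matrix (Fin m) (Fin m) ℝ) (μ : Measure ℝ)
    (Φ : ℝ → Matrix (Fin m) (Fin m) ℝ) (T s : ℝ) : ℝ :=
  potential β h Q - potential β h (Φ s)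
    - ∫ t in (0 : ℝ)..T, pairing (resolv Q μ Φ t) (Q - Φ (max s t))

theorem GlobalPath.exists_abs_potential_le {β : ℕ → Fin m → ℝ} (hβ : IsMixedEvenModel β)
    (h : Fin m → ℝ) {Q : Matrix (Fin m) (Fin m) ℝ} (hQ : IsConstraint Q)
    {Φ : ℝ → Matrix (Fin m) (Fin m) ℝ} (hΦ : GlobalPath Q Φ) :
    ∃ C : ℝ, ∀ s, |potential β h (Φ s)| ≤ C := by
  obtain ⟨K, hK⟩ := exists_lipschitzWith_potential hβ h hQ hΦ
  obtain ⟨C, hC⟩ := (isCompact_Icc (a := (0 : ℝ)) (b := m)).exists_bound_of_continuousOn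
    hK.continuous.continuousOn
  have hm0 : (0 : ℝ) ≤ m := Nat.cast_nonneg m
  refine ⟨C, fun s => ?_⟩
  rcases le_total s 0 with h1 | h1
  · have := hC 0 ⟨le_rfl, hm0⟩
    rwa [hΦ.eq_zero 0 le_rfl, ← hΦ.eq_zero s h1] at this
  · rcases le_total s m with h2 | h2
    · exact hC s ⟨h1, h2⟩
    · have := hC m ⟨hm0, le_rfl⟩
      rwa [hΦ.eq_top m le_rfl, ← hΦ.eq_top s h2] at this

namespace CutPair

variable {β : ℕ → Fin m → ℝ} {h : Fin m → ℝ} {Q : Matrix (Fin m) (Fin m) ℝ} {μ : Measure ℝ}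
  {Φ : ℝ → Matrix (Fin m) (Fin m) ℝ} {T : ℝ}

theorem mem_uIoc_le (hp : CutPair Q μ Φ T) {t : ℝ} (ht : t ∈ uIoc 0 T) : t ≤ T := by
  rw [uIoc_of_le hp.pos.le] at ht; exact ht.2

theorem intervalIntegrable_resolv (hp : CutPair Q μ Φ T) (hQ : IsConstraint Q)
    {F : ℝ → Matrix (Fin m) (Fin m) ℝ} {C : ℝ} (hF : ∀ i j, Measurable fun t => F t i j)
    (hC : ∀ t i j, |F t i j| ≤ C) :
    IntervalIntegrable (fun t => pairing (resolv Q μ Φ t) (F t)) volume 0 T := by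
  obtain ⟨n, hn⟩ := hp.exists_abs_resolv_le hQ
  exact intervalIntegrable_of_bound (measurable_pairing (hp.measurable_resolv hQ) hF)
    fun t ht => abs_pairing_le (hn t (hp.mem_uIoc_le ht)) (hC t)

theorem measurable_max (hp : CutPair Q μ Φ T) (s : ℝ) (i j : Fin m) :
    Measurable fun t => (Q - Φ (max s t)) i j :=
  (measurable_const.sub (hp.path.continuous_apply i j).measurable).comp
    (measurable_const.max measurable_id)

theorem continuous_massDeriv (hβ : IsMixedEvenModel β) (h : Fin m → ℝ) (hQ : IsConstraint Q)
    (hp : CutPair Q μ Φ T) : Continuous (massDeriv β h Q μ Φ T) := by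
  obtain ⟨K, hK⟩ := exists_lipschitzWith_potential hβ h hQ hp.path
  obtain ⟨n, hn⟩ := hp.exists_abs_resolv_le hQ
  refine (continuous_const.sub hK.continuous).sub ?_
  refine intervalIntegral.continuous_of_dominated_interval
    (bound := fun _ => m * (m * (n * 2))) (fun s => ?_) (fun s => ?_) intervalIntegrable_const ?_
  · exact (measurable_pairing (hp.measurable_resolv hQ) (hp.measurable_max s)).aestronglyMeasurable
  · refine ae_of_all _ fun t ht => ?_
    exact abs_pairing_le (hn t (hp.mem_uIoc_le ht)) (hp.abs_sub_le hQ _)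
  · refine ae_of_all _ fun t _ => ?_
    simp only [pairing_eq_sum]
    refine continuous_finsetSum _ fun i _ => continuous_finsetSum _ fun j _ => ?_
    refine continuous_const.mul (continuous_const.sub ?_)
    exact (hp.path.continuous_apply j i).comp (continuous_id.max continuous_const)

theorem exists_abs_massDeriv_le (hβ : IsMixedEvenModel β) (h : Fin m → ℝ) (hQ : IsConstraint Q)
    (hp : CutPair Q μ Φ T) : ∃ C : ℝ, ∀ s, |massDeriv β h Q μ Φ T s| ≤ C := by
  obtain ⟨C, hC⟩ := hp.path.exists_abs_potential_le hβ h hQ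
  obtain ⟨n, hn⟩ := hp.exists_abs_resolv_le hQ
  refine ⟨|potential β h Q| + C + m * (m * (n * 2)) * |T - 0|, fun s => ?_⟩
  have h1 := intervalIntegral.norm_integral_le_of_norm_le_const (a := 0) (b := T)
    (C := m * (m * (n * 2))) (f := fun t => pairing (resolv Q μ Φ t) (Q - Φ (max s t)))
    fun t ht => abs_pairing_le (hn t (hp.mem_uIoc_le ht)) (hp.abs_sub_le hQ _)
  rw [Real.norm_eq_abs] at h1
  unfold massDeriv
  refine (abs_sub _ _).trans (add_le_add ((abs_sub _ _).trans (add_le_add le_rfl (hC s))) h1)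

theorem tilt (hp : CutPair Q μ Φ T) {w : ℝ → ℝ} {W ε : ℝ} (hw : Measurable w)
    (hW : ∀ s, |w s| ≤ W) (hε : |ε| * W ≤ 1) (h0 : ∫ s, w s ∂μ = 0) :
    CutPair Q (tilt μ w ε) Φ T :=
  have := hp.prob
  { path := hp.path
    prob := isProbabilityMeasure_tilt hw hW hε h0
    compl := tilt_absolutelyContinuous μ w ε hp.compl
    pos := hp.pos
    lt := hp.lt
    posDef := hp.posDef }

/-- Stationarity under changes of the weights of the measure. -/
theorem integral_mul_massDeriv_nonneg (hβ : IsMixedEvenModel β) (h : Fin m → ℝ)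
    (hQ : IsConstraint Q) (hp : CutPair Q μ Φ T) {w : ℝ → ℝ} {W : ℝ} (hw : Measurable w)
    (hW : ∀ s, |w s| ≤ W) (h0 : ∫ s, w s ∂μ = 0)
    (hmin : ∀ ε, 0 < ε → ε * W ≤ 1 →
      reduced β h Q μ Φ T ≤ reduced β h Q (VectorSpin.tilt μ w ε) Φ T) :
    0 ≤ ∫ s, w s * massDeriv β h Q μ Φ T s ∂μ := by
  have := hp.prob
  obtain ⟨K, hK⟩ := exists_lipschitzWith_potential hβ h hQ hp.path
  obtain ⟨C, hC⟩ := hp.path.exists_abs_potential_le hβ h hQ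
  obtain ⟨n, hn⟩ := hp.exists_abs_resolv_le hQ
  obtain ⟨L, hL⟩ := hp.path.lipschitz
  have hW0 : 0 ≤ W := (abs_nonneg _).trans (hW 0)
  have hFc : ∀ i j, Continuous fun t => (Q - Φ t) i j := fun i j =>
    continuous_const.sub (hp.path.continuous_apply i j)
  have hF2 := hp.abs_sub_le hQ
  set B := VectorSpin.tail μ w fun s => Q - Φ s with hB
  have hBm : ∀ i j, Measurable fun t => B t i j := fun i j =>
    (lipschitzWith_tail (μ := μ) (K := 0 + L) hw hW hF2
      (fun i j => (LipschitzWith.const (Q i j)).sub (hL i j)) i j).continuous.measurable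
  -- The path is not moved, hence `R = 0`; only `Φ̂` varies, in the direction `B`.
  obtain ⟨E, hE⟩ := hp.exists_integral_expansion hQ (B := B) (R := fun _ => 0) (b := W * 2) (r := 0)
    hBm (by simp) (abs_tail_le hW hF2) (by simp)
  have hg : ∀ s, |potential β h Q - potential β h (Φ s)| ≤ |potential β h Q| + C := fun s =>
    (abs_sub _ _).trans (add_le_add le_rfl (hC s))
  have hgm : Measurable fun s => potential β h Q - potential β h (Φ s) :=
    measurable_const.sub hK.continuous.measurable
  have hwgi : Integrable (fun s => w s * (potential β h Q - potential β h (Φ s))) μ :=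
    integrable_of_bound (C := W * (|potential β h Q| + C)) (hw.mul hgm) fun s => by
      rw [abs_mul]; exact mul_le_mul (hW s) (hg s) (abs_nonneg _) hW0
  have key : 0 ≤ (∫ s, w s * (potential β h Q - potential β h (Φ s)) ∂μ)
      - ∫ t in (0 : ℝ)..T, pairing (resolv Q μ Φ t) (B t) := by
    refine nonneg_of_first_variation (K := E) (ε₀ := 1 / (W + 1)) (by positivity)
      fun ε hε0 hε1 => ?_
    have hεW : ε * W ≤ 1 := by
      rw [le_div_iff₀ (by positivity)] at hε1
      nlinarith
    have hεW' : |ε| * W ≤ 1 := by rwa [abs_of_pos hε0]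
    have hpε := hp.tilt hw hW hεW' h0
    have e1 : ∀ t, hatM Q (VectorSpin.tilt μ w ε) Φ t = hatM Q μ Φ t + ε • B t := fun t => by
      ext i j
      simp only [hatM, hB, tail, Matrix.add_apply, Matrix.smul_apply, Matrix.of_apply, smul_eq_mul,
        one_mul]
      exact integral_tilt hw hW hεW' (hp.integrable_hatM hQ t i j)
        (integrable_tail hw hW hFc hF2 t i j)
    have h1 := hE ε fun t ht => by rw [← e1]; exact hpε.hatM_sub_posSemidef hQ ht
    have h2 := hmin ε hε0 hεW
    unfold reduced at h2
    rw [integral_tilt hw hW hεW' (integrable_of_bound hgm hg) hwgi] at h2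
    have e2 : ∫ t in (0 : ℝ)..T, pairing (hatM Q (VectorSpin.tilt μ w ε) Φ t)⁻¹ (pathD Φ t)
        = ∫ t in (0 : ℝ)..T, pairing (hatM Q μ Φ t + ε • B t)⁻¹
          (pathD Φ t + ε • (0 : Matrix (Fin m) (Fin m) ℝ)) := by
      simp [e1]
    have e3 : ∫ t in (0 : ℝ)..T, pairing (hatM Q μ Φ t)⁻¹ (0 : Matrix (Fin m) (Fin m) ℝ) = 0 := by
      simp [pairing]
    rw [e3] at h1
    rw [e2] at h2
    linarith
  rw [hB, integral_pairing_tail hw hW hFc hF2 (hp.measurable_resolv hQ) hp.pos.le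
    (fun t ht => hn t ht.2), ← integral_sub hwgi] at key
  · refine key.trans_eq (integral_congr_ae (ae_of_all _ fun s => ?_))
    simp only [massDeriv]
    ring
  · have hmc := hp.continuous_massDeriv hβ h hQ
    obtain ⟨D, hD⟩ := hp.exists_abs_massDeriv_le hβ h hQ
    have i1 : Integrable (fun s => w s * massDeriv β h Q μ Φ T s) μ :=
      integrable_of_bound (C := W * D) (hw.mul hmc.measurable) fun s => by
        rw [abs_mul]; exact mul_le_mul (hW s) (hD s) (abs_nonneg _) hW0
    refine (hwgi.sub i1).congr (ae_of_all _ fun s => ?_)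
    simp only [massDeriv, Pi.sub_apply]
    ring

/-- At a minimizer the mass derivative is constant on the support. -/
theorem massDeriv_eq_of_mem_support (hβ : IsMixedEvenModel β) (h : Fin m → ℝ)
    (hQ : IsConstraint Q) (hp : CutPair Q μ Φ T)
    (hmin : ∀ (w : ℝ → ℝ) (W ε : ℝ), Measurable w → (∀ s, |w s| ≤ W) → ∫ s, w s ∂μ = 0 → 0 < ε →
      ε * W ≤ 1 → reduced β h Q μ Φ T ≤ reduced β h Q (VectorSpin.tilt μ w ε) Φ T)
    {s u : ℝ} (hs : s ∈ μ.support) (hu : u ∈ μ.support) :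
    massDeriv β h Q μ Φ T s = massDeriv β h Q μ Φ T u := by
  have := hp.prob
  have hc := hp.continuous_massDeriv hβ h hQ
  obtain ⟨C, hC⟩ := hp.exists_abs_massDeriv_le hβ h hQ
  set f := massDeriv β h Q μ Φ T with hf
  set a := ∫ s, f s ∂μ with ha
  have hfi : Integrable f μ := integrable_of_bound hc.measurable hC
  -- The test weight `a - f`, with `a` the mean of `f`, has zero integral. Stationarity in this
  -- direction says that minus the variance of `f` is nonnegative.
  have hw : Measurable fun s => a - f s := measurable_const.sub hc.measurable
  have hW : ∀ s, |a - f s| ≤ |a| + C := fun s => (abs_sub _ _).trans (add_le_add le_rfl (hC s))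
  have h0 : ∫ s, (a - f s) ∂μ = 0 := by
    rw [integral_sub (integrable_const _) hfi]; simp [ha]
  have h1 := hp.integral_mul_massDeriv_nonneg hβ h hQ hw hW h0
    fun ε hε hεW => hmin _ _ ε hw hW h0 hε hεW
  rw [← hf] at h1
  have hwi : Integrable (fun s => a - f s) μ := (integrable_const _).sub hfi
  have hsqi : Integrable (fun s => (a - f s) ^ 2) μ :=
    integrable_of_bound (C := (|a| + C) ^ 2) (hw.pow_const 2) fun s => by
      rw [abs_pow]; exact pow_le_pow_left₀ (abs_nonneg _) (hW s) 2
  have h2 : ∫ s, (a - f s) ^ 2 ∂μ ≤ 0 := by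
    have e : ∫ s, (a - f s) * f s ∂μ = a * (∫ s, (a - f s) ∂μ) - ∫ s, (a - f s) ^ 2 ∂μ := by
      rw [← integral_const_mul, ← integral_sub (hwi.const_mul a) hsqi]
      exact integral_congr_ae (ae_of_all _ fun s => by ring)
    rw [e, h0] at h1
    linarith
  have h3 : (fun s => (a - f s) ^ 2) =ᵐ[μ] 0 :=
    (integral_eq_zero_iff_of_nonneg (fun s => sq_nonneg _) hsqi).mp
      (le_antisymm h2 (integral_nonneg fun s => sq_nonneg _))
  -- By continuity of `f`, the full-measure set `{f = a}` is closed and so contains the whole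
  -- support.
  have h4 : μ.support ⊆ {s | f s = a} := by
    refine Measure.support_subset_of_isClosed (isClosed_eq hc continuous_const) ?_
    filter_upwards [h3] with s hs
    have : a - f s = 0 := by simpa using hs
    show f s = a
    linarith
  have hs' : f s = a := h4 hs
  have hu' : f u = a := h4 hu
  rw [hs', hu']

end CutPair

/-! ### Differentiating `Φ̂⁻¹` and integrating by parts -/

/-- Entries of the inverse of a matrix path: differentiability. -/
theorem hasDerivAt_inv_apply {A : ℝ → Matrix (Fin m) (Fin m) ℝ} {A' : Matrix (Fin m) (Fin m) ℝ}
    {t : ℝ} (hA : ∀ i j, HasDerivAt (fun s => A s i j) (A' i j) t)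
    (hpd : ∀ᶠ s in 𝓝 t, (A s).PosDef)
    (hinv : ∀ i j, ContinuousAt (fun s => (A s)⁻¹ i j) t) (i j : Fin m) :
    HasDerivAt (fun s => (A s)⁻¹ i j) (-((A t)⁻¹ * A' * (A t)⁻¹) i j) t := by
  rw [hasDerivAt_iff_tendsto_slope]
  -- By the resolvent identity the slope of the inverse is `-A(s)⁻¹ · slope · A(t)⁻¹`, so continuity
  -- of `A(s)⁻¹` is enough to pass to the limit.
  have hlim : Tendsto (fun s => -∑ l, (∑ k, (A s)⁻¹ i k * slope (fun r => A r k l) t s)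
      * (A t)⁻¹ l j) (𝓝[≠] t) (𝓝 (-((A t)⁻¹ * A' * (A t)⁻¹) i j)) := by
    simp only [Matrix.mul_apply]
    refine (tendsto_finsetSum _ fun l _ => ?_).neg
    refine Tendsto.mul_const _ (tendsto_finsetSum _ fun k _ => ?_)
    exact ((hinv i k).tendsto.mono_left nhdsWithin_le_nhds).mul
      (hasDerivAt_iff_tendsto_slope.mp (hA k l))
  refine hlim.congr' ?_
  filter_upwards [hpd.filter_mono nhdsWithin_le_nhds] with s hs
  have e := inv_sub_inv_of_posDef hs hpd.self_of_nhds
  have e1 := congrFun (congrFun e i) j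
  rw [Matrix.sub_apply] at e1
  rw [slope_def_field, e1]
  simp only [Matrix.mul_apply, slope_def_field, Matrix.sub_apply, Finset.sum_mul, Finset.sum_div]
  rw [← Finset.sum_neg_distrib]
  refine Finset.sum_congr rfl fun l _ => ?_
  rw [← Finset.sum_neg_distrib]
  refine Finset.sum_congr rfl fun k _ => ?_
  ring

namespace CutPair

variable {Q : Matrix (Fin m) (Fin m) ℝ} {μ : Measure ℝ} {Φ : ℝ → Matrix (Fin m) (Fin m) ℝ} {T : ℝ}

/-- The resolvent identity turns the Lipschitz bound for `Φ̂` into one for its inverse. It gives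
absolute continuity for integration by parts and, later, the error made by freezing `Φ̂` at `u`. -/
theorem abs_inv_hatM_sub_le (hp : CutPair Q μ Φ T) (hQ : IsConstraint Q) :
    ∃ K : ℝ≥0, ∀ s ≤ T, ∀ t ≤ T, ∀ i j,
      |((hatM Q μ Φ s)⁻¹ - (hatM Q μ Φ t)⁻¹) i j| ≤ K * |s - t| := by
  obtain ⟨L, hL⟩ := hp.lipschitzWith_hatM hQ
  set c := (Q - Φ T)⁻¹.trace with hc
  have hc0 : 0 ≤ c := hp.posDef.inv.posSemidef.trace_nonneg
  refine ⟨⟨m * (m * (c * L) * c), by positivity⟩, fun s hs t ht i j => ?_⟩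
  rw [inv_sub_inv_of_posDef (hp.hatM_posDef hQ hs) (hp.hatM_posDef hQ ht)]
  have h1 := abs_mul_apply_le (abs_mul_apply_le (hp.abs_inv_hatM_le hQ hs)
    (B := hatM Q μ Φ t - hatM Q μ Φ s) (b := L * |s - t|) fun k l => by
      rw [abs_sub_comm s t]; exact abs_sub_le_of_lipschitzWith (hL k l) t s)
    (hp.abs_inv_hatM_le hQ ht) i j
  refine h1.trans_eq ?_
  change _ = m * (m * (c * L) * c) * |s - t|
  ring

/-- Near `t` one has `Φ̂(s) = ∫_s^m x Φ'`, so Lebesgue differentiation gives `Φ̂' = -x Φ'` almost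
everywhere. No continuity of `x` or `Φ'` is assumed. -/
theorem ae_hasDerivAt_hatM (hp : CutPair Q μ Φ T) :
    ∀ᵐ t : ℝ, t ∈ Ioo 0 T → ∀ i j,
      HasDerivAt (fun s => hatM Q μ Φ s i j) (-(distr μ t • pathD Φ t) i j) t := by
  have := hp.prob
  obtain ⟨K, hK⟩ := hp.path.lipschitz
  have h : ∀ i j, ∀ᵐ t : ℝ, t ∈ Ioo 0 T →
      HasDerivAt (fun s => hatM Q μ Φ s i j) (-(distr μ t • pathD Φ t) i j) t := by
    intro i j
    have hloc : IntervalIntegrable (fun s => distr μ s * deriv (fun r => Φ r i j) s)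
        volume 0 m := by
      refine intervalIntegrable_of_bound (C := 1 * K)
        ((distr_mono μ).measurable.mul (measurable_deriv _)) fun t _ => ?_
      rw [abs_mul, abs_of_nonneg (distr_nonneg μ t)]
      exact mul_le_mul (distr_le_one μ t) (norm_deriv_le (hK i j) t) (abs_nonneg _) zero_le_one
    have hm0 : (0 : ℝ) ≤ m := Nat.cast_nonneg m
    filter_upwards [hloc.ae_hasDerivAt_integral] with t ht hmem
    have htm : t ∈ uIcc (0 : ℝ) m := by
      rw [uIcc_of_le hm0]; exact ⟨hmem.1.le, hmem.2.le.trans hp.lt.le⟩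
    have h1 := (ht htm m right_mem_uIcc).neg
    refine HasDerivAt.congr_of_eventuallyEq ?_ (f := fun x => -∫ s in (m : ℝ)..x,
      distr μ s * deriv (fun r => Φ r i j) s) ?_
    · exact h1
    · filter_upwards [Iio_mem_nhds (hmem.2.trans hp.lt)] with s hs
      rw [← intervalIntegral.integral_symm,
        integral_distr_mul_deriv hp.compl_top (hK i j) (le_of_lt hs), hp.path.eq_top m le_rfl]
      simp [hatM, tail]
  filter_upwards [ae_all_iff.mpr fun i => ae_all_iff.mpr fun j => h i j] with t ht hmem i j
  exact ht i j hmem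

theorem ae_hasDerivAt_inv_hatM (hp : CutPair Q μ Φ T) (hQ : IsConstraint Q) :
    ∀ᵐ t : ℝ, t ∈ Ioo 0 T → ∀ i j,
      HasDerivAt (fun s => (hatM Q μ Φ s)⁻¹ i j) (distr μ t * resolv Q μ Φ t i j) t := by
  obtain ⟨K, hK⟩ := hp.abs_inv_hatM_sub_le hQ
  filter_upwards [hp.ae_hasDerivAt_hatM] with t ht hmem i j
  have h1 := hasDerivAt_inv_apply (A := hatM Q μ Φ) (A' := -(distr μ t • pathD Φ t)) (t := t)
    (fun i j => ht hmem i j) ?_ ?_ i j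
  · refine h1.congr_deriv ?_
    simp [resolv]
  · filter_upwards [Iio_mem_nhds hmem.2] with s hs
    exact hp.hatM_posDef hQ (le_of_lt hs)
  · intro i j
    have hl : LipschitzOnWith K (fun s => (hatM Q μ Φ s)⁻¹ i j) (Iic T) :=
      LipschitzOnWith.of_dist_le_mul fun s hs t ht => hK s hs t ht i j
    exact hl.continuousOn.continuousAt (Iic_mem_nhds hmem.2)

/-- Integration by parts for `∫ ⟨Φ̂⁻¹, Ψ'⟩`. -/
theorem integral_pairing_inv_hatM (hp : CutPair Q μ Φ T) (hQ : IsConstraint Q)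
    {Ψ : ℝ → Matrix (Fin m) (Fin m) ℝ} {L : ℝ≥0} (hΨ : ∀ i j, LipschitzWith L fun t => Ψ t i j)
    (h0 : Ψ 0 = 0) (hT : Ψ T = 0) :
    ∫ t in (0 : ℝ)..T, pairing (hatM Q μ Φ t)⁻¹ (pathD Ψ t)
      = -∫ t in (0 : ℝ)..T, distr μ t * pairing (resolv Q μ Φ t) (Ψ t) := by
  have := hp.prob
  obtain ⟨K, hK⟩ := hp.abs_inv_hatM_sub_le hQ
  obtain ⟨n, hn⟩ := hp.exists_abs_resolv_le hQ
  have hsub : uIcc 0 T ⊆ Iic T := by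
    rw [uIcc_of_le hp.pos.le]; exact fun t ht => ht.2
  have hac : ∀ i j, AbsolutelyContinuousOnInterval (fun s => (hatM Q μ Φ s)⁻¹ i j) 0 T := by
    intro i j
    have hl : LipschitzOnWith K (fun s => (hatM Q μ Φ s)⁻¹ i j) (uIcc 0 T) :=
      LipschitzOnWith.of_dist_le_mul fun s hs t ht => hK s (hsub hs) t (hsub ht) i j
    exact hl.absolutelyContinuousOnInterval
  have hacΨ : ∀ i j, AbsolutelyContinuousOnInterval (fun s => Ψ s i j) 0 T := fun i j =>
    ((hΨ i j).lipschitzOnWith (s := uIcc 0 T)).absolutelyContinuousOnInterval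
  have hparts : ∀ i j, ∫ t in (0 : ℝ)..T, (hatM Q μ Φ t)⁻¹ i j * pathD Ψ t j i
      = -∫ t in (0 : ℝ)..T, distr μ t * (resolv Q μ Φ t i j * Ψ t j i) := by
    intro i j
    -- Both boundary terms vanish because `Ψ` is zero at `0` and at `T`.
    have e := (hac i j).integral_mul_deriv_eq_deriv_mul (hacΨ j i)
    rw [h0, hT] at e
    have e1 : ∫ t in (0 : ℝ)..T, deriv (fun s => (hatM Q μ Φ s)⁻¹ i j) t * Ψ t j i
        = ∫ t in (0 : ℝ)..T, distr μ t * (resolv Q μ Φ t i j * Ψ t j i) := by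
      refine intervalIntegral.integral_congr_ae ?_
      have hT' : ∀ᵐ s : ℝ, s ≠ T := by simp [ae_iff]
      filter_upwards [hp.ae_hasDerivAt_inv_hatM hQ, hT'] with t ht htT hmem
      rw [uIoc_of_le hp.pos.le] at hmem
      rw [(ht ⟨hmem.1, lt_of_le_of_ne hmem.2 htT⟩ i j).deriv]
      ring
    rw [e1] at e
    simpa [pathD] using e
  have i1 : ∀ i j, IntervalIntegrable (fun t => (hatM Q μ Φ t)⁻¹ i j * pathD Ψ t j i)
      volume 0 T := fun i j => by
    refine intervalIntegrable_of_bound (C := (Q - Φ T)⁻¹.trace * L)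
      ((measurable_inv_apply (hp.measurable_hatM hQ) i j).mul (measurable_pathD Ψ j i))
      fun t ht => ?_
    rw [abs_mul]
    have h1 := hp.abs_inv_hatM_le hQ (hp.mem_uIoc_le ht) i j
    exact mul_le_mul h1 (abs_pathD_le hΨ t j i) (abs_nonneg _) ((abs_nonneg _).trans h1)
  have i2 : ∀ i j, IntervalIntegrable
      (fun t => distr μ t * (resolv Q μ Φ t i j * Ψ t j i)) volume 0 T := fun i j => by
    obtain ⟨C, hC⟩ := (isCompact_Icc (a := (0 : ℝ)) (b := T)).exists_bound_of_continuousOn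
      (hΨ j i).continuous.continuousOn
    refine intervalIntegrable_of_bound (C := 1 * (n * C)) ((distr_mono μ).measurable.mul
      ((hp.measurable_resolv hQ i j).mul (hΨ j i).continuous.measurable)) fun t ht => ?_
    have ht' := ht
    rw [uIoc_of_le hp.pos.le] at ht'
    have h1 := hn t ht'.2 i j
    have h2 : |Ψ t j i| ≤ C := hC t ⟨ht'.1.le, ht'.2⟩
    rw [abs_mul, abs_mul, abs_of_nonneg (distr_nonneg μ t)]
    exact mul_le_mul (distr_le_one μ t) (mul_le_mul h1 h2 (abs_nonneg _)
      ((abs_nonneg _).trans h1)) (by positivity) zero_le_one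
  simp only [pairing_eq_sum, Finset.mul_sum]
  rw [intervalIntegral.integral_finsetSum fun i _ => ?_,
    intervalIntegral.integral_finsetSum fun i _ => ?_, ← Finset.sum_neg_distrib]
  · refine Finset.sum_congr rfl fun i _ => ?_
    rw [intervalIntegral.integral_finsetSum fun j _ => i1 i j,
      intervalIntegral.integral_finsetSum fun j _ => i2 i j, ← Finset.sum_neg_distrib]
    exact Finset.sum_congr rfl fun j _ => hparts i j
  · simpa only [Finset.sum_fn] using IntervalIntegrable.sum Finset.univ fun j _ => i2 i j
  · simpa only [Finset.sum_fn] using IntervalIntegrable.sum Finset.univ fun j _ => i1 i j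

end CutPair

/-! ### First variation in the path -/

/-- Fubini for `∫ x(t) g(t) dt`. -/
theorem integral_distr_mul {μ : Measure ℝ} [IsProbabilityMeasure μ] {b : ℝ}
    (h : μ (Icc 0 b)ᶜ = 0) {g : ℝ → ℝ} (hg : Measurable g) {T n : ℝ} (hT : 0 ≤ T)
    (hn : ∀ t ∈ Ioc 0 T, |g t| ≤ n) :
    ∫ t in (0 : ℝ)..T, distr μ t * g t
      = ∫ s, (∫ t in (0 : ℝ)..T, (Ici s).indicator g t) ∂μ := by
  have e1 : ∀ t, distr μ t * g t = ∫ s, (Ici s).indicator g t ∂μ := fun t => by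
    rw [distr_eq_integral h, ← integral_mul_const]
    refine integral_congr_ae (ae_of_all _ fun s => ?_)
    by_cases hs : s ≤ t <;> simp [indicator, hs]
  simp_rw [e1]
  rw [intervalIntegral.integral_of_le hT]
  simp_rw [intervalIntegral.integral_of_le hT]
  refine integral_integral_swap ?_
  have hmeas : Measurable fun q : ℝ × ℝ => (Ici q.2).indicator g q.1 := by
    have : (fun q : ℝ × ℝ => (Ici q.2).indicator g q.1)
        = {q : ℝ × ℝ | q.2 ≤ q.1}.indicator fun q => g q.1 := by
      ext q; simp [indicator]
    rw [this]
    exact (hg.comp measurable_fst).indicator (measurableSet_le measurable_snd measurable_fst)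
  refine Integrable.of_bound (C := n) hmeas.aestronglyMeasurable ?_
  have hae : ∀ᵐ q ∂((volume.restrict (Ioc 0 T)).prod μ), q.1 ∈ Ioc 0 T :=
    Measure.quasiMeasurePreserving_fst.ae (ae_restrict_mem measurableSet_Ioc)
  filter_upwards [hae] with q hq
  exact (norm_indicator_le_norm_self _ _).trans (hn _ hq)

theorem pathD_add_smul {Φ Ψ : ℝ → Matrix (Fin m) (Fin m) ℝ} {t : ℝ} (ε : ℝ)
    (hΦ : ∀ i j, DifferentiableAt ℝ (fun s => Φ s i j) t)
    (hΨ : ∀ i j, DifferentiableAt ℝ (fun s => Ψ s i j) t) :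
    pathD (fun s => Φ s + ε • Ψ s) t = pathD Φ t + ε • pathD Ψ t := by
  ext i j
  exact ((hΦ i j).hasDerivAt.add ((hΨ i j).hasDerivAt.const_mul ε)).deriv

theorem GlobalPath.continuous_xiEntryD {β : ℕ → Fin m → ℝ} (hβ : IsMixedEvenModel β)
    {Q : Matrix (Fin m) (Fin m) ℝ} (hQ : IsConstraint Q) {Φ : ℝ → Matrix (Fin m) (Fin m) ℝ}
    (hΦ : GlobalPath Q Φ) (i j : Fin m) : Continuous fun s => xiEntryD β i j (Φ s i j) :=
  (continuousOn_xiEntryD hβ i j).comp_continuous (hΦ.continuous_apply i j)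
    fun s => abs_le.mp (hΦ.abs_apply_le_one hQ s i j)

theorem exists_lipschitz_diff {Ψ : ℝ → Matrix (Fin m) (Fin m) ℝ} {L : ℝ≥0}
    (hΨ : ∀ i j, LipschitzWith L fun t => Ψ t i j) :
    ∀ᵐ t : ℝ, ∀ i j, DifferentiableAt ℝ (fun s => Ψ s i j) t :=
  ae_all_iff.mpr fun i => ae_all_iff.mpr fun j => (hΨ i j).ae_differentiableAt_real

namespace CutPair

variable {β : ℕ → Fin m → ℝ} {Q : Matrix (Fin m) (Fin m) ℝ} {μ : Measure ℝ}
  {Φ : ℝ → Matrix (Fin m) (Fin m) ℝ} {T : ℝ}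

/-- Stationarity under displacements of the path. -/
theorem path_variation_nonneg (hβ : IsMixedEvenModel β) (h : Fin m → ℝ)
    (hQ : IsConstraint Q) (hp : CutPair Q μ Φ T) {Ψ : ℝ → Matrix (Fin m) (Fin m) ℝ} {L : ℝ≥0}
    {C : ℝ} (hΨ : ∀ i j, LipschitzWith L fun t => Ψ t i j) (hC : ∀ t i j, |Ψ t i j| ≤ C)
    (h0 : Ψ 0 = 0) (hT : Ψ T = 0) {ε₀ : ℝ} (hε₀ : 0 < ε₀)
    (hpε : ∀ ε, 0 < ε → ε ≤ ε₀ → CutPair Q μ (fun s => Φ s + ε • Ψ s) T)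
    (hconv : ∀ ε, 0 < ε → ε ≤ ε₀ → ∀ s, potential β h (Φ s)
      + ε * pairing (xiD β (Φ s) + Matrix.vecMulVec h h) (Ψ s) ≤ potential β h (Φ s + ε • Ψ s))
    (hmin : ∀ ε, 0 < ε → ε ≤ ε₀ →
      reduced β h Q μ Φ T ≤ reduced β h Q μ (fun s => Φ s + ε • Ψ s) T) :
    Integrable (fun s => (∫ t in (0 : ℝ)..T,
        (Iio s).indicator (fun t => pairing (resolv Q μ Φ t) (Ψ s)) t)
      - pairing (xiD β (Φ s) + Matrix.vecMulVec h h) (Ψ s)) μ ∧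
    0 ≤ ∫ s, ((∫ t in (0 : ℝ)..T, (Iio s).indicator (fun t => pairing (resolv Q μ Φ t) (Ψ s)) t)
      - pairing (xiD β (Φ s) + Matrix.vecMulVec h h) (Ψ s)) ∂μ := by
  have := hp.prob
  obtain ⟨M, hM⟩ := exists_xiEntryD_bound hβ
  obtain ⟨n, hn⟩ := hp.exists_abs_resolv_le hQ
  have hΨc : ∀ i j, Continuous fun t => Ψ t i j := fun i j => (hΨ i j).continuous
  have hΨc' : ∀ i j, Continuous fun t => (-Ψ t) i j := fun i j => (hΨc i j).neg
  have hC' : ∀ t i j, |(-Ψ t) i j| ≤ C := fun t i j => by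
    rw [Matrix.neg_apply, abs_neg]; exact hC t i j
  set w : ℝ → ℝ := fun _ => 1 with hw
  have hwm : Measurable w := measurable_const
  have hW : ∀ s, |w s| ≤ 1 := by simp [hw]
  set g := fun s => pairing (xiD β (Φ s) + Matrix.vecMulVec h h) (Ψ s) with hg
  have hgc : Continuous g := by
    simp only [hg, pairing_eq_sum]
    refine continuous_finsetSum _ fun i _ => continuous_finsetSum _ fun j _ => ?_
    exact ((hp.path.continuous_xiEntryD hβ hQ i j).add continuous_const).mul (hΨc j i)
  obtain ⟨H, hH⟩ : ∃ H : ℝ, ∀ i j, |Matrix.vecMulVec h h i j| ≤ H :=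
    ⟨∑ i, ∑ j, |Matrix.vecMulVec h h i j|, fun i j =>
      (Finset.single_le_sum (f := fun j => |Matrix.vecMulVec h h i j|)
        (fun _ _ => abs_nonneg _) (Finset.mem_univ j)).trans
      (Finset.single_le_sum (f := fun i => ∑ j, |Matrix.vecMulVec h h i j|)
        (fun _ _ => Finset.sum_nonneg fun _ _ => abs_nonneg _) (Finset.mem_univ i))⟩
  have hgi : Integrable g μ := integrable_of_bound hgc.measurable fun s =>
    abs_pairing_le (a := M + H) (fun i j => (abs_add_le _ _).trans
      (add_le_add (hM i j _ (hp.path.abs_apply_le_one hQ s i j)) (hH i j))) (hC s)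
  set B := VectorSpin.tail μ w fun s => -Ψ s with hB
  have hBm : ∀ i j, Measurable fun t => B t i j := fun i j =>
    (lipschitzWith_tail (μ := μ) (K := L) hwm hW hC' (fun i j => (hΨ i j).neg)
      i j).continuous.measurable
  obtain ⟨E, hE⟩ := hp.exists_integral_expansion hQ (B := B) (R := pathD Ψ) (b := 1 * C) (r := L)
    hBm (measurable_pathD Ψ) (abs_tail_le hW hC') (abs_pathD_le hΨ)
  obtain ⟨K, hK⟩ := exists_lipschitzWith_potential hβ h hQ hp.path
  obtain ⟨P, hP⟩ := hp.path.exists_abs_potential_le hβ h hQ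
  have hpoti : Integrable (fun s => potential β h (Φ s)) μ :=
    integrable_of_bound hK.continuous.measurable hP
  have key : 0 ≤ (∫ t in (0 : ℝ)..T, pairing (hatM Q μ Φ t)⁻¹ (pathD Ψ t))
      - (∫ t in (0 : ℝ)..T, pairing (resolv Q μ Φ t) (B t)) - ∫ s, g s ∂μ := by
    refine nonneg_of_first_variation (K := E) hε₀ fun ε hε0 hε1 => ?_
    have hq := hpε ε hε0 hε1
    have e1 : ∀ t, hatM Q μ (fun s => Φ s + ε • Ψ s) t = hatM Q μ Φ t + ε • B t := fun t => by
      ext i j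
      simp only [hatM, hB, hw, tail, Matrix.add_apply, Matrix.smul_apply, Matrix.of_apply,
        smul_eq_mul, one_mul]
      have hi := integrable_tail (μ := μ) hwm hW hΨc' hC' t i j
      simp only [hw, one_mul] at hi
      rw [← integral_const_mul, ← integral_add (hp.integrable_hatM hQ t i j) (hi.const_mul ε)]
      refine integral_congr_ae (ae_of_all _ fun s => ?_)
      simp only [Matrix.sub_apply, Matrix.add_apply, Matrix.smul_apply, Matrix.neg_apply,
        smul_eq_mul]
      ring
    -- Since `Ψ(T) = 0`, the perturbed pair keeps the lower bound `Q - Φ(T)`, hence bounds on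
    -- inverses that do not depend on `ε`.
    have eT : Q - (Φ T + ε • Ψ T) = Q - Φ T := by rw [hT]; simp
    have h1 := hE ε fun t ht => by
      have := hq.hatM_sub_posSemidef hQ ht
      rwa [e1, eT] at this
    have h2 := hmin ε hε0 hε1
    unfold reduced at h2
    have e2 : ∫ t in (0 : ℝ)..T, pairing (hatM Q μ (fun s => Φ s + ε • Ψ s) t)⁻¹
          (pathD (fun s => Φ s + ε • Ψ s) t)
        = ∫ t in (0 : ℝ)..T, pairing (hatM Q μ Φ t + ε • B t)⁻¹ (pathD Φ t + ε • pathD Ψ t) := by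
      refine intervalIntegral.integral_congr_ae ?_
      filter_upwards [ae_differentiableAt hp.path, exists_lipschitz_diff hΨ] with t ht1 ht2 _
      rw [e1, pathD_add_smul ε ht1 ht2]
    obtain ⟨K', hK'⟩ := exists_lipschitzWith_potential hβ h hQ hq.path
    obtain ⟨P', hP'⟩ := hq.path.exists_abs_potential_le hβ h hQ
    have hpoti' : Integrable (fun s => potential β h (Φ s + ε • Ψ s)) μ :=
      integrable_of_bound hK'.continuous.measurable hP'
    -- Minimality needs only an upper bound for the perturbed functional, and convexity supplies it
    -- without any second-order control of the potential.
    have h3 : ∫ s, (potential β h Q - potential β h (Φ s + ε • Ψ s)) ∂μ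
        ≤ (∫ s, (potential β h Q - potential β h (Φ s)) ∂μ) - ε * ∫ s, g s ∂μ := by
      have hd : Integrable (fun s => potential β h Q - potential β h (Φ s)) μ :=
        (integrable_const _).sub hpoti
      rw [← integral_const_mul, ← integral_sub hd (hgi.const_mul ε)]
      refine integral_mono ((integrable_const _).sub hpoti')
        (((integrable_const _).sub hpoti).sub (hgi.const_mul ε)) fun s => ?_
      have := hconv ε hε0 hε1 s
      simp only [hg]
      linarith
    rw [e2] at h2
    linarith
  have f1 := integral_pairing_tail (μ := μ) hwm hW hΨc' hC' (hp.measurable_resolv hQ) hp.pos.le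
    (fun t ht => hn t ht.2)
  have hgm : Measurable fun t => pairing (resolv Q μ Φ t) (Ψ t) :=
    measurable_pairing (hp.measurable_resolv hQ) fun i j => (hΨc i j).measurable
  have f2 := integral_distr_mul hp.compl hgm hp.pos.le
    (fun t ht => abs_pairing_le (hn t ht.2) (hC t))
  rw [hp.integral_pairing_inv_hatM hQ hΨ h0 hT, hB, f1, f2] at key
  set a := fun s => w s * ∫ t in (0 : ℝ)..T, pairing (resolv Q μ Φ t) (-Ψ (max s t)) with ha
  set b := fun s => ∫ t in (0 : ℝ)..T,
    (Ici s).indicator (fun t => pairing (resolv Q μ Φ t) (Ψ t)) t with hb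
  -- The variation of `Φ̂` contributes `⟨resolv(t), Ψ(s ∨ t)⟩` for all `t`; integrating `Ψ'` by
  -- parts contributes `-⟨resolv(t), Ψ(t)⟩` for `t ≥ s`. They cancel for `t ≥ s`, leaving
  -- `⟨resolv(t), Ψ(s)⟩` on `t < s`.
  have hrel : ∀ s, ∫ t in (0 : ℝ)..T, (Iio s).indicator
      (fun t => pairing (resolv Q μ Φ t) (Ψ s)) t = -(a s) - b s := by
    intro s
    have hma : ∀ i j, Measurable fun t => (-Ψ (max s t)) i j := fun i j =>
      (hΨc' i j).measurable.comp (measurable_const.max measurable_id)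
    have ia : IntervalIntegrable (fun t => -pairing (resolv Q μ Φ t) (-Ψ (max s t))) volume 0 T :=
      (hp.intervalIntegrable_resolv hQ hma (fun t => hC' (max s t))).neg
    have ib : IntervalIntegrable ((Ici s).indicator fun t => pairing (resolv Q μ Φ t) (Ψ t))
        volume 0 T :=
      intervalIntegrable_of_bound (hgm.indicator measurableSet_Ici) fun t ht =>
        (norm_indicator_le_norm_self (fun t => pairing (resolv Q μ Φ t) (Ψ t)) t).trans
          (abs_pairing_le (hn t (hp.mem_uIoc_le ht)) (hC t))
    simp only [ha, hb, hw, one_mul]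
    rw [← intervalIntegral.integral_neg, ← intervalIntegral.integral_sub ia ib]
    refine intervalIntegral.integral_congr fun t _ => ?_
    simp only [indicator, mem_Iio, mem_Ici]
    rcases lt_or_ge t s with hts | hts
    · simp [hts, hts.le, not_le.mpr hts, pairing]
    · simp [hts, not_lt.mpr hts, pairing]
  have hmeas_a : Measurable a := by
    have hm2 : Measurable fun q : ℝ × ℝ => pairing (resolv Q μ Φ q.2) (-Ψ (max q.1 q.2)) :=
      measurable_pairing (fun i j => (hp.measurable_resolv hQ i j).comp measurable_snd)
        fun i j => (hΨc' i j).measurable.comp (measurable_fst.max measurable_snd)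
    simp only [ha, hw, one_mul, intervalIntegral.integral_of_le hp.pos.le]
    exact hm2.stronglyMeasurable.integral_prod_right'.measurable
  have hmeas_b : Measurable b := by
    have hm2 : Measurable fun q : ℝ × ℝ =>
        (Ici q.1).indicator (fun t => pairing (resolv Q μ Φ t) (Ψ t)) q.2 := by
      have : (fun q : ℝ × ℝ => (Ici q.1).indicator (fun t => pairing (resolv Q μ Φ t) (Ψ t)) q.2)
          = {q : ℝ × ℝ | q.1 ≤ q.2}.indicator fun q => pairing (resolv Q μ Φ q.2) (Ψ q.2) := by
        ext q; simp [indicator]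
      rw [this]
      exact (hgm.comp measurable_snd).indicator (measurableSet_le measurable_fst measurable_snd)
    simp only [hb, intervalIntegral.integral_of_le hp.pos.le]
    exact hm2.stronglyMeasurable.integral_prod_right'.measurable
  have hia : Integrable a μ := by
    refine integrable_of_bound hmeas_a (C := m * (m * (n * C)) * |T - 0|) fun s => ?_
    simp only [ha, hw, one_mul, ← Real.norm_eq_abs (∫ _ in (0 : ℝ)..T, _)]
    refine intervalIntegral.norm_integral_le_of_norm_le_const fun t ht => ?_
    exact abs_pairing_le (hn t (hp.mem_uIoc_le ht)) (hC' _)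
  have hib : Integrable b μ := by
    refine integrable_of_bound hmeas_b (C := m * (m * (n * C)) * |T - 0|) fun s => ?_
    simp only [hb, ← Real.norm_eq_abs (∫ _ in (0 : ℝ)..T, _)]
    refine intervalIntegral.norm_integral_le_of_norm_le_const fun t ht => ?_
    exact (norm_indicator_le_norm_self (fun t => pairing (resolv Q μ Φ t) (Ψ t)) t).trans
      (abs_pairing_le (hn t (hp.mem_uIoc_le ht)) (hC t))
  simp_rw [hrel]
  have hna : Integrable (fun s => -(a s)) μ := hia.neg
  have hnab : Integrable (fun s => -(a s) - b s) μ := hna.sub hib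
  refine ⟨hnab.sub hgi, ?_⟩
  change 0 ≤ ∫ s, (-(a s) - b s - g s) ∂μ
  rw [integral_sub hnab hgi, integral_sub hna hib, integral_neg]
  linarith

end CutPair

/-! ### Second-order comparison of the two variations near `u` -/

/-- The quadratic form `⟨ξ''(Q), D^{∘2}⟩ - ⟨Q⁻¹ D, Q⁻¹ D⟩`. -/
def stabForm (β : ℕ → Fin m → ℝ) (Q D : Matrix (Fin m) (Fin m) ℝ) : ℝ :=
  pairing (xiDD β Q) (D ⊙ D) - pairing (Q⁻¹ * D) (Q⁻¹ * D)

theorem stabForm_smul (β : ℕ → Fin m → ℝ) (Q D : Matrix (Fin m) (Fin m) ℝ) (c : ℝ) :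
    stabForm β Q (c • D) = c ^ 2 * stabForm β Q D := by
  have e : (c • D) ⊙ (c • D) = c ^ 2 • (D ⊙ D) := by
    ext i j; simp; ring
  rw [stabForm, stabForm, e, pairing_smul_right, Matrix.mul_smul, pairing_smul_left,
    pairing_smul_right]
  ring

theorem tendsto_pairing {α : Type*} {l : Filter α} {A B : α → Matrix (Fin m) (Fin m) ℝ}
    {A₀ B₀ : Matrix (Fin m) (Fin m) ℝ} (hA : ∀ i j, Tendsto (fun t => A t i j) l (𝓝 (A₀ i j)))
    (hB : ∀ i j, Tendsto (fun t => B t i j) l (𝓝 (B₀ i j))) :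
    Tendsto (fun t => pairing (A t) (B t)) l (𝓝 (pairing A₀ B₀)) := by
  simp only [pairing_eq_sum]
  exact tendsto_finsetSum _ fun i _ => tendsto_finsetSum _ fun j _ => (hA i j).mul (hB j i)

theorem tendsto_stabForm (β : ℕ → Fin m → ℝ) (Q : Matrix (Fin m) (Fin m) ℝ) {α : Type*}
    {l : Filter α} {D : α → Matrix (Fin m) (Fin m) ℝ} {V : Matrix (Fin m) (Fin m) ℝ}
    (hD : ∀ i j, Tendsto (fun t => D t i j) l (𝓝 (V i j))) :
    Tendsto (fun t => stabForm β Q (D t)) l (𝓝 (stabForm β Q V)) := by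
  have h1 : ∀ i j, Tendsto (fun t => (Q⁻¹ * D t) i j) l (𝓝 ((Q⁻¹ * V) i j)) := fun i j => by
    simp only [Matrix.mul_apply]
    exact tendsto_finsetSum _ fun k _ => (hD k j).const_mul _
  have h2 : ∀ i j, Tendsto (fun t => (D t ⊙ D t) i j) l (𝓝 ((V ⊙ V) i j)) := fun i j => by
    simp only [Matrix.hadamard_apply]
    exact (hD i j).mul (hD i j)
  have h3 := tendsto_pairing (A := fun _ => xiDD β Q) (l := l) (fun i j => tendsto_const_nhds) h2
  exact h3.sub (tendsto_pairing h1 h1)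

/-- Where the path is differentiable with unstable derivative, the form is negative definite
along increments. -/
theorem exists_stabForm_le {β : ℕ → Fin m → ℝ} {Q : Matrix (Fin m) (Fin m) ℝ}
    {Φ : ℝ → Matrix (Fin m) (Fin m) ℝ} {u : ℝ}
    (hdiff : ∀ i j, DifferentiableWithinAt ℝ (fun t => Φ t i j) (Icc (0 : ℝ) m) u)
    (hlt : stabForm β Q (pathDeriv Φ u) < 0) :
    ∃ c > 0, ∃ δ > 0, ∀ s ∈ Icc (0 : ℝ) m, |s - u| < δ → s ≠ u →
      stabForm β Q (Φ s - Φ u) ≤ -c * (s - u) ^ 2 := by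
  have h1 : ∀ i j, Tendsto (fun s => ((s - u)⁻¹ • (Φ s - Φ u)) i j) (𝓝[Icc (0 : ℝ) m \ {u}] u)
      (𝓝 (pathDeriv Φ u i j)) := fun i j => by
    have := hasDerivWithinAt_iff_tendsto_slope.mp (hdiff i j).hasDerivWithinAt
    exact this
  -- The slopes converge to `Φ'(u)` within `[0, m]`, so near `u` the form on slopes stays below half
  -- its limit. Homogeneity of degree two then transfers the bound to increments.
  have h2 := (tendsto_stabForm β Q h1).eventually (gt_mem_nhds
    (show stabForm β Q (pathDeriv Φ u) < stabForm β Q (pathDeriv Φ u) / 2 by linarith))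
  obtain ⟨δ, hδ, hb⟩ := Metric.mem_nhdsWithin_iff.mp h2
  refine ⟨-(stabForm β Q (pathDeriv Φ u) / 2), by linarith, δ, hδ, fun s hs hsd hsu => ?_⟩
  have h3 : stabForm β Q ((s - u)⁻¹ • (Φ s - Φ u)) < stabForm β Q (pathDeriv Φ u) / 2 :=
    hb ⟨by simpa [Real.dist_eq] using hsd, hs, hsu⟩
  have hne : s - u ≠ 0 := sub_ne_zero.mpr hsu
  have e : stabForm β Q (Φ s - Φ u)
      = (s - u) ^ 2 * stabForm β Q ((s - u)⁻¹ • (Φ s - Φ u)) := by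
    rw [stabForm_smul]; field_simp
  rw [e]
  nlinarith [sq_nonneg (s - u)]

/-- The derivative of the functional under displacement of the path at `s` towards `Φ(u)`. -/
def pullDeriv (β : ℕ → Fin m → ℝ) (h : Fin m → ℝ) (Q : Matrix (Fin m) (Fin m) ℝ) (μ : Measure ℝ)
    (Φ : ℝ → Matrix (Fin m) (Fin m) ℝ) (T u s : ℝ) : ℝ :=
  pairing (xiD β (Φ s) + Matrix.vecMulVec h h) (Φ s - Φ u)
    - ∫ t in (0 : ℝ)..T, (Iio s).indicator (fun t => pairing (resolv Q μ Φ t) (Φ s - Φ u)) t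

theorem GlobalPath.sub_posSemidef_or {Q : Matrix (Fin m) (Fin m) ℝ}
    {Φ : ℝ → Matrix (Fin m) (Fin m) ℝ} (hΦ : GlobalPath Q Φ) (s u : ℝ) :
    (Φ s - Φ u).PosSemidef ∨ (-(Φ s - Φ u)).PosSemidef := by
  rcases le_total u s with hus | hus
  · exact Or.inl (hΦ.mono u s hus)
  · right; rw [neg_sub]; exact hΦ.mono s u hus

theorem GlobalPath.sub_symm {Q : Matrix (Fin m) (Fin m) ℝ}
    {Φ : ℝ → Matrix (Fin m) (Fin m) ℝ} (hΦ : GlobalPath Q Φ) (s u : ℝ) :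
    (Φ s - Φ u).IsHermitian :=
  (hΦ.posSemidef s).isHermitian.sub (hΦ.posSemidef u).isHermitian

theorem GlobalPath.abs_sub_apply_le {Q : Matrix (Fin m) (Fin m) ℝ} (hQ : IsConstraint Q)
    {Φ : ℝ → Matrix (Fin m) (Fin m) ℝ} (hΦ : GlobalPath Q Φ) (s u : ℝ) (i j : Fin m) :
    |(Φ s - Φ u) i j| ≤ 2 := by
  have h1 := hΦ.abs_apply_le_one hQ s i j
  have h2 := hΦ.abs_apply_le_one hQ u i j
  rw [Matrix.sub_apply]
  linarith [abs_sub (Φ s i j) (Φ u i j)]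

/-- The derivative of `½ ⟨X D X, D⟩` along the increments `D = Φ(t) - Φ(u)`. -/
theorem integral_pairing_conj {Q : Matrix (Fin m) (Fin m) ℝ} (hQ : IsConstraint Q)
    {Φ : ℝ → Matrix (Fin m) (Fin m) ℝ} (hΦ : GlobalPath Q Φ)
    (X : Matrix (Fin m) (Fin m) ℝ) (u s : ℝ) :
    ∫ t in u..s, pairing (X * pathD Φ t * X) (Φ t - Φ u)
      = pairing (X * (Φ s - Φ u) * X) (Φ s - Φ u) / 2 := by
  obtain ⟨K, hK⟩ := hΦ.lipschitz
  have hDl : ∀ i j, ∃ K : ℝ≥0, LipschitzWith K fun t => (Φ t - Φ u) i j := fun i j =>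
    ⟨K + 0, (hK i j).sub (LipschitzWith.const (Φ u i j))⟩
  have hXl : ∀ i j, ∃ K : ℝ≥0, LipschitzWith K fun t => (X * (Φ t - Φ u) * X) i j := fun i j => by
    simp only [Matrix.mul_apply, mul_comm _ (X _ j)]
    exact exists_lipschitzWith_sum _ fun k _ => exists_lipschitzWith_const_mul _
      (exists_lipschitzWith_sum _ fun l _ => exists_lipschitzWith_const_mul _ (hDl l k))
  obtain ⟨x, hx⟩ : ∃ x : ℝ, ∀ i j, |X i j| ≤ x :=
    ⟨∑ i, ∑ j, |X i j|, fun i j =>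
      (Finset.single_le_sum (f := fun j => |X i j|)
        (fun _ _ => abs_nonneg _) (Finset.mem_univ j)).trans
      (Finset.single_le_sum (f := fun i => ∑ j, |X i j|)
        (fun _ _ => Finset.sum_nonneg fun _ _ => abs_nonneg _) (Finset.mem_univ i))⟩
  have hb := fun t => abs_mul_apply_le (abs_mul_apply_le hx (hΦ.abs_sub_apply_le hQ t u)) hx
  obtain ⟨L, hL⟩ : ∃ L : ℝ≥0, LipschitzWith L fun t =>
      pairing (X * (Φ t - Φ u) * X) (Φ t - Φ u) := by
    simp only [pairing_eq_sum]
    exact exists_lipschitzWith_sum _ fun i _ => exists_lipschitzWith_sum _ fun j _ =>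
      exists_lipschitzWith_mul (hXl i j) (hDl j i) (fun t => hb t i j)
        fun t => hΦ.abs_sub_apply_le hQ t u j i
  have e := integral_deriv_of_lipschitzWith hL u s
  have e0 : pairing (X * (Φ u - Φ u) * X) (Φ u - Φ u) = 0 := by simp [pairing]
  rw [e0, sub_zero] at e
  rw [← e, eq_div_iff two_ne_zero, ← intervalIntegral.integral_mul_const]
  refine intervalIntegral.integral_congr_ae ?_
  filter_upwards [ae_differentiableAt hΦ] with t ht _
  have hd : ∀ i j, HasDerivAt (fun r => (Φ r - Φ u) i j) (pathD Φ t i j) t := fun i j =>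
    (ht i j).hasDerivAt.sub_const (Φ u i j)
  have hd2 : ∀ i j, HasDerivAt (fun r => (X * (Φ r - Φ u) * X) i j)
      ((X * pathD Φ t * X) i j) t := fun i j => by
    simp only [Matrix.mul_apply]
    exact HasDerivAt.fun_sum fun k _ =>
      (HasDerivAt.fun_sum fun l _ => (hd l k).const_mul _).mul_const _
  have hd3 : HasDerivAt (fun r => pairing (X * (Φ r - Φ u) * X) (Φ r - Φ u))
      (pairing (X * pathD Φ t * X) (Φ t - Φ u) + pairing (X * (Φ t - Φ u) * X) (pathD Φ t)) t := by
    simp only [pairing_eq_sum, ← Finset.sum_add_distrib]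
    exact HasDerivAt.fun_sum fun i _ => HasDerivAt.fun_sum fun j _ => (hd2 i j).mul (hd j i)
  -- The product rule gives two terms that coincide by cyclicity of the trace, which accounts for
  -- the factor `1/2`.
  rw [hd3.deriv, pairing_conj_comm X (Φ t - Φ u)]
  ring

namespace CutPair

variable {β : ℕ → Fin m → ℝ} {Q : Matrix (Fin m) (Fin m) ℝ} {μ : Measure ℝ}
  {Φ : ℝ → Matrix (Fin m) (Fin m) ℝ} {T : ℝ}

/-- Difference of the two first variations. -/
theorem pullDeriv_eq (hp : CutPair Q μ Φ T) (hQ : IsConstraint Q) (h : Fin m → ℝ) {u s : ℝ}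
    (hu : u ∈ Icc 0 T) (hs : s ∈ Icc 0 T) :
    pullDeriv β h Q μ Φ T u s + massDeriv β h Q μ Φ T s - massDeriv β h Q μ Φ T u
      = pairing (xiD β (Φ s) + Matrix.vecMulVec h h) (Φ s - Φ u)
        - (potential β h (Φ s) - potential β h (Φ u))
        - ∫ t in u..s, pairing (resolv Q μ Φ t) (Φ t - Φ u) := by
  obtain ⟨n, hn⟩ := hp.exists_abs_resolv_le hQ
  have hcm : Measurable fun t => pairing (resolv Q μ Φ t) (Φ s - Φ u) :=
    measurable_pairing (hp.measurable_resolv hQ) fun i j => measurable_const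
  have i1 : IntervalIntegrable
      ((Iio s).indicator fun t => pairing (resolv Q μ Φ t) (Φ s - Φ u)) volume 0 T :=
    intervalIntegrable_of_bound (hcm.indicator measurableSet_Iio) fun t ht =>
      (norm_indicator_le_norm_self (fun t => pairing (resolv Q μ Φ t) (Φ s - Φ u)) t).trans
        (abs_pairing_le (hn t (hp.mem_uIoc_le ht)) (hp.path.abs_sub_apply_le hQ s u))
  have i2 := fun r => hp.intervalIntegrable_resolv hQ (hp.measurable_max r)
    (fun t => hp.abs_sub_le hQ (max r t))
  have hne : ∀ᵐ t : ℝ, t ≠ s := by simp [ae_iff]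
  -- Pointwise in `t` the three integrands add up to `⟨resolv(t), Φ(t) - Φ(u)⟩` between `u` and `s`,
  -- with the sign of the orientation, and to `0` elsewhere.
  have hmain : (∫ t in (0 : ℝ)..T,
        (Iio s).indicator (fun t => pairing (resolv Q μ Φ t) (Φ s - Φ u)) t)
      + (∫ t in (0 : ℝ)..T, pairing (resolv Q μ Φ t) (Q - Φ (max s t)))
      - (∫ t in (0 : ℝ)..T, pairing (resolv Q μ Φ t) (Q - Φ (max u t)))
      = ∫ t in u..s, pairing (resolv Q μ Φ t) (Φ t - Φ u) := by
    rw [← intervalIntegral.integral_add i1 (i2 s), ← intervalIntegral.integral_sub (i1.add (i2 s))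
      (i2 u)]
    rcases le_total u s with hus | hus
    · rw [intervalIntegral.integral_of_le hp.pos.le, intervalIntegral.integral_of_le hus,
        ← inter_eq_right.mpr (Ioc_subset_Ioc hu.1 hs.2 : Ioc u s ⊆ Ioc 0 T),
        ← setIntegral_indicator measurableSet_Ioc]
      refine integral_congr_ae (ae_restrict_of_ae ?_)
      filter_upwards [hne] with t ht
      rcases lt_trichotomy t s with hts | hts | hts
      · rcases le_or_gt t u with htu | htu
        · simp [indicator, hts, hts.le, htu, not_lt.mpr htu, pairing_sub_right]
        · simp [indicator, hts, hts.le, htu, htu.le, pairing_sub_right]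
      · exact absurd hts ht
      · have htu : u ≤ t := hus.trans hts.le
        simp [indicator, not_lt.mpr hts.le, not_le.mpr hts, hts.le, htu, pairing_sub_right]
    · rw [intervalIntegral.integral_symm s u, intervalIntegral.integral_of_le hp.pos.le,
        intervalIntegral.integral_of_le hus, ← integral_neg,
        ← inter_eq_right.mpr (Ioc_subset_Ioc hs.1 hu.2 : Ioc s u ⊆ Ioc 0 T),
        ← setIntegral_indicator measurableSet_Ioc]
      refine integral_congr_ae (ae_restrict_of_ae ?_)
      filter_upwards [hne] with t ht
      rcases lt_trichotomy t s with hts | hts | hts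
      · have htu : t ≤ u := hts.le.trans hus
        simp [indicator, hts, hts.le, not_lt.mpr hts.le, htu, pairing_sub_right]
      · exact absurd hts ht
      · rcases le_or_gt t u with htu | htu
        · simp [indicator, hts, not_lt.mpr hts.le, hts.le, htu, pairing_sub_right]
        · simp [indicator, hts, not_lt.mpr hts.le, hts.le, htu.le, not_le.mpr htu,
            pairing_sub_right]
  unfold pullDeriv massDeriv
  linarith

/-- Comparison of `∫ ⟨Φ̂⁻¹ Φ' Φ̂⁻¹, Φ - Φ(u)⟩` with its value for a frozen `Φ̂`. -/
theorem exists_integral_resolv_ge (hp : CutPair Q μ Φ T) (hQ : IsConstraint Q) {u : ℝ}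
    (hu : u ≤ T) :
    ∃ C : ℝ, ∀ s ≤ T, pairing (Q⁻¹ * (Φ s - Φ u)) (Q⁻¹ * (Φ s - Φ u)) / 2 - C * |s - u| ^ 3
      ≤ ∫ t in u..s, pairing (resolv Q μ Φ t) (Φ t - Φ u) := by
  obtain ⟨K, hK⟩ := hp.path.lipschitz
  obtain ⟨L, hL⟩ := hp.abs_inv_hatM_sub_le hQ
  obtain ⟨n, hn⟩ := hp.exists_abs_resolv_le hQ
  set c := (Q - Φ T)⁻¹.trace with hc
  set X := (hatM Q μ Φ u)⁻¹ with hX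
  have hXc : ∀ i j, |X i j| ≤ c := hp.abs_inv_hatM_le hQ hu
  -- The cubic error has one factor `|s - u|` from freezing `Φ̂⁻¹`, one from the increment `Φ(t) -
  -- Φ(u)`, and one from the length of the interval. The two summands correspond to the two inverses
  -- in `resolv`.
  refine ⟨m * (m * ((m * (m * (L * K) * c) + m * (m * (c * K) * L)) * K)), fun s hs => ?_⟩
  have hle : ∀ t ∈ uIoc u s, t ≤ T := fun t ht => by
    have := ht.2
    exact this.trans (sup_le hu hs)
  have htu : ∀ t ∈ uIoc u s, |t - u| ≤ |s - u| := fun t ht =>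
    abs_sub_left_of_mem_uIcc (uIoc_subset_uIcc ht)
  have hDm : ∀ i j, Measurable fun t => (Φ t - Φ u) i j := fun i j =>
    ((hp.path.continuous_apply i j).sub continuous_const).measurable
  have i1 : IntervalIntegrable (fun t => pairing (resolv Q μ Φ t) (Φ t - Φ u)) volume u s :=
    intervalIntegrable_of_bound (measurable_pairing (hp.measurable_resolv hQ) hDm)
      fun t ht => abs_pairing_le (hn t (hle t ht)) (hp.path.abs_sub_apply_le hQ t u)
  have i2 : IntervalIntegrable (fun t => pairing (X * pathD Φ t * X) (Φ t - Φ u)) volume u s :=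
    intervalIntegrable_of_bound (measurable_pairing (measurable_mul_apply (measurable_mul_apply
      (fun i j => measurable_const) (measurable_pathD Φ)) fun i j => measurable_const) hDm)
      fun t ht => abs_pairing_le (abs_mul_apply_le (abs_mul_apply_le hXc (abs_pathD_le hK t)) hXc)
        (hp.path.abs_sub_apply_le hQ t u)
  have hdiff : |(∫ t in u..s, pairing (resolv Q μ Φ t) (Φ t - Φ u))
      - ∫ t in u..s, pairing (X * pathD Φ t * X) (Φ t - Φ u)|
      ≤ m * (m * ((m * (m * (L * K) * c) + m * (m * (c * K) * L)) * K)) * |s - u| ^ 3 := by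
    rw [← intervalIntegral.integral_sub i1 i2]
    have hbound := intervalIntegral.norm_integral_le_of_norm_le_const (a := u) (b := s)
      (C := m * (m * ((m * (m * (L * K) * c) + m * (m * (c * K) * L)) * K)) * |s - u| ^ 2)
      (f := fun t => pairing (resolv Q μ Φ t) (Φ t - Φ u)
        - pairing (X * pathD Φ t * X) (Φ t - Φ u)) fun t ht => ?_
    · rw [Real.norm_eq_abs] at hbound
      refine hbound.trans_eq ?_
      ring
    · have hY : ∀ i j, |((hatM Q μ Φ t)⁻¹ - X) i j| ≤ L * |s - u| := fun i j =>
        (hL t (hle t ht) u hu i j).trans (mul_le_mul_of_nonneg_left (htu t ht) L.2)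
      have hD : ∀ i j, |(Φ t - Φ u) i j| ≤ K * |s - u| := fun i j =>
        (abs_sub_le_of_lipschitzWith (hK i j) t u).trans
          (mul_le_mul_of_nonneg_left (htu t ht) K.2)
      have e : resolv Q μ Φ t - X * pathD Φ t * X
          = ((hatM Q μ Φ t)⁻¹ - X) * pathD Φ t * (hatM Q μ Φ t)⁻¹
            + X * pathD Φ t * ((hatM Q μ Φ t)⁻¹ - X) := by
        simp only [resolv, sub_mul, mul_sub]
        abel
      rw [← pairing_sub_left, e, Real.norm_eq_abs]
      have hsum := abs_pairing_le (A := ((hatM Q μ Φ t)⁻¹ - X) * pathD Φ t * (hatM Q μ Φ t)⁻¹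
            + X * pathD Φ t * ((hatM Q μ Φ t)⁻¹ - X)) (fun i j => (abs_add_le _ _).trans (add_le_add
        (abs_mul_apply_le (abs_mul_apply_le hY (abs_pathD_le hK t))
          (hp.abs_inv_hatM_le hQ (hle t ht)) i j)
        (abs_mul_apply_le (abs_mul_apply_le hXc (abs_pathD_le hK t)) hY i j))) hD
      refine hsum.trans_eq ?_
      ring
  rw [integral_pairing_conj hQ hp.path X u s] at hdiff
  -- The frozen matrix satisfies `Φ̂(u) ≤ Q`, so passing to `Q⁻¹` only lowers the quadratic form.
  have hmono := pairing_inv_mul_self_mono (hp.hatM_posDef hQ hu) (hp.sub_hatM_posSemidef hQ u)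
    (hp.path.sub_symm s u)
  linarith [(abs_le.mp hdiff).1]

/-- When the mass derivatives agree, `pullDeriv_eq` leaves only terms of second order in the
increment: the Taylor remainder is bounded above through `ξ''(Q)` and the integral below through
`Q⁻¹`. -/
theorem exists_pullDeriv_le (hβ : IsMixedEvenModel β) (h : Fin m → ℝ) (hQ : IsConstraint Q)
    (hp : CutPair Q μ Φ T) {u : ℝ} (hu : u ∈ Icc 0 T) :
    ∃ C : ℝ, ∀ s ∈ Icc 0 T, massDeriv β h Q μ Φ T s = massDeriv β h Q μ Φ T u →
      pullDeriv β h Q μ Φ T u s ≤ stabForm β Q (Φ s - Φ u) / 2 + C * |s - u| ^ 3 := by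
  obtain ⟨C, hC⟩ := hp.exists_integral_resolv_ge hQ hu.2
  refine ⟨C, fun s hs hms => ?_⟩
  have h1 := hp.pullDeriv_eq (β := β) hQ h hu hs
  have h2 := potential_taylor_le hβ h (hp.path.posSemidef u) (hp.path.posSemidef s) hQ.posSemidef
    (hp.path.le_top u) (hp.path.le_top s) (hp.path.abs_apply_le_one hQ u)
    (hp.path.abs_apply_le_one hQ s) (fun i j => abs_le.mpr (hQ.mem_Icc i j))
    (hp.path.sub_posSemidef_or s u)
  have h3 := hC s hs.2
  unfold stabForm
  linarith

/-- Near `u`, the displacement derivative is negative on the support. -/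
theorem exists_pullDeriv_neg (hβ : IsMixedEvenModel β) (h : Fin m → ℝ) (hQ : IsConstraint Q)
    (hp : CutPair Q μ Φ T) {u : ℝ} (hu : u ∈ Icc 0 T)
    (hdiff : ∀ i j, DifferentiableWithinAt ℝ (fun t => Φ t i j) (Icc (0 : ℝ) m) u)
    (hlt : stabForm β Q (pathDeriv Φ u) < 0) :
    ∃ δ > 0, ∀ s ∈ Icc 0 T, |s - u| < δ → s ≠ u →
      massDeriv β h Q μ Φ T s = massDeriv β h Q μ Φ T u → pullDeriv β h Q μ Φ T u s < 0 := by
  obtain ⟨c, hc, δ, hδ, hform⟩ := exists_stabForm_le hdiff hlt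
  obtain ⟨C, hC⟩ := hp.exists_pullDeriv_le hβ h hQ hu
  have hCp : 0 < |C| + 1 := by positivity
  -- Within this radius the cubic error is at most `(c/4)(s - u)²`, while half the form is at most
  -- `-(c/2)(s - u)²`.
  refine ⟨min δ (c / (4 * (|C| + 1))), lt_min hδ (by positivity), fun s hs hsd hsu hms => ?_⟩
  have h1 := hC s hs hms
  have h2 := hform s ⟨hs.1, hs.2.trans hp.lt.le⟩ (hsd.trans_le (min_le_left _ _)) hsu
  have h3 : |s - u| * (4 * (|C| + 1)) < c := by
    rw [← lt_div_iff₀ (by positivity)]; exact hsd.trans_le (min_le_right _ _)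
  have h4 : 0 < |s - u| := abs_pos.mpr (sub_ne_zero.mpr hsu)
  have h5 : (s - u) ^ 2 = |s - u| ^ 2 := (sq_abs _).symm
  rw [h5] at h2
  have h6 : C * |s - u| ≤ c / 4 := by
    nlinarith [le_abs_self C]
  have h7 : C * |s - u| ^ 3 ≤ c / 4 * |s - u| ^ 2 := by
    have : C * |s - u| ^ 3 = C * |s - u| * |s - u| ^ 2 := by ring
    rw [this]
    exact mul_le_mul_of_nonneg_right h6 (by positivity)
  have h8 : 0 < |s - u| ^ 2 := by positivity
  nlinarith

end CutPair

/-! ### The bump and the associated change of parameter -/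

/-- The truncation of `t - u` to `[-δ, δ]`. -/
def trunc (u δ t : ℝ) : ℝ := max (-δ) (min δ (t - u))

/-- The function `max 0 (δ² - (t - u)²)`. -/
def cap (u δ t : ℝ) : ℝ := δ ^ 2 - trunc u δ t ^ 2

/-- A unimodal bump with Lipschitz derivative, supported in `[u - δ, u + δ]`. -/
def bump (u δ t : ℝ) : ℝ := cap u δ t ^ 2

section Bump

variable {u δ : ℝ}

theorem abs_trunc_le (hδ : 0 < δ) (t : ℝ) : |trunc u δ t| ≤ δ := by
  rw [abs_le]
  exact ⟨le_max_left _ _, max_le (by linarith) (min_le_left _ _)⟩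

theorem trunc_eq_of_abs_le {t : ℝ} (ht : |t - u| ≤ δ) : trunc u δ t = t - u := by
  rw [abs_le] at ht
  rw [trunc, min_eq_right ht.2, max_eq_right ht.1]

theorem trunc_sq_of_le_abs (hδ : 0 < δ) {t : ℝ} (ht : δ ≤ |t - u|) : trunc u δ t ^ 2 = δ ^ 2 := by
  rw [le_abs] at ht
  rcases ht with ht | ht
  · rw [trunc, min_eq_left ht, max_eq_right (by linarith)]
  · rw [trunc, min_eq_right (by linarith), max_eq_left (by linarith)]; ring

theorem cap_eq_max (hδ : 0 < δ) (t : ℝ) : cap u δ t = max 0 (δ ^ 2 - (t - u) ^ 2) := by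
  rcases le_total |t - u| δ with h | h
  · rw [cap, trunc_eq_of_abs_le h, max_eq_right]
    have := sq_le_sq₀ (abs_nonneg _) hδ.le |>.mpr h
    rw [sq_abs] at this
    linarith
  · rw [cap, trunc_sq_of_le_abs hδ h, max_eq_left, sub_self]
    have := sq_le_sq₀ hδ.le (abs_nonneg _) |>.mpr h
    rw [sq_abs] at this
    linarith

theorem cap_nonneg (hδ : 0 < δ) (t : ℝ) : 0 ≤ cap u δ t := by
  rw [cap_eq_max hδ]; exact le_max_left _ _

theorem cap_le (t : ℝ) : cap u δ t ≤ δ ^ 2 := by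
  unfold cap; linarith [sq_nonneg (trunc u δ t)]

/-- `cap` vanishes where the truncation is active. The unbounded factor `t - u` can thus be replaced
by `trunc`, which makes the derivatives products of bounded Lipschitz functions. -/
theorem sub_mul_cap (hδ : 0 < δ) (t : ℝ) : (t - u) * cap u δ t = trunc u δ t * cap u δ t := by
  rcases le_total |t - u| δ with h | h
  · rw [trunc_eq_of_abs_le h]
  · rw [cap, trunc_sq_of_le_abs hδ h]; ring

theorem bump_nonneg (t : ℝ) : 0 ≤ bump u δ t := sq_nonneg _

theorem cap_le_one (hδ : 0 < δ) (hδ1 : δ ≤ 1) (t : ℝ) : cap u δ t ≤ 1 :=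
  (cap_le t).trans (pow_le_one₀ hδ.le hδ1)

theorem bump_le_one (hδ : 0 < δ) (hδ1 : δ ≤ 1) (t : ℝ) : bump u δ t ≤ 1 :=
  pow_le_one₀ (cap_nonneg hδ t) (cap_le_one hδ hδ1 t)

theorem bump_eq_zero (hδ : 0 < δ) {t : ℝ} (ht : δ ≤ |t - u|) : bump u δ t = 0 := by
  rw [bump, cap, trunc_sq_of_le_abs hδ ht]; ring

theorem bump_pos (hδ : 0 < δ) {t : ℝ} (ht : |t - u| < δ) : 0 < bump u δ t := by
  have : 0 < cap u δ t := by
    rw [cap_eq_max hδ]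
    refine lt_max_of_lt_right ?_
    have := sq_lt_sq₀ (abs_nonneg _) hδ.le |>.mpr ht
    rw [sq_abs] at this
    linarith
  exact pow_pos this 2

/-- Unimodality about `u` is what keeps the pulled path monotone. -/
theorem bump_le_bump (hδ : 0 < δ) {s t : ℝ} (h : |s - u| ≤ |t - u|) :
    bump u δ t ≤ bump u δ s := by
  refine pow_le_pow_left₀ (cap_nonneg hδ t) ?_ 2
  rw [cap_eq_max hδ, cap_eq_max hδ]
  refine max_le_max le_rfl ?_
  have := sq_le_sq₀ (abs_nonneg _) (abs_nonneg _) |>.mpr h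
  rw [sq_abs, sq_abs] at this
  linarith

theorem lipschitzWith_trunc (u δ : ℝ) : ∃ K : ℝ≥0, LipschitzWith K (trunc u δ) := by
  refine ⟨1, ?_⟩
  have h : LipschitzWith 1 fun t : ℝ => t - u :=
    LipschitzWith.of_dist_le_mul fun s t => by simp [Real.dist_eq]
  exact (h.const_min δ).const_max (-δ)

theorem abs_cap_le_one (hδ : 0 < δ) (hδ1 : δ ≤ 1) (t : ℝ) : |cap u δ t| ≤ 1 := by
  rw [abs_of_nonneg (cap_nonneg hδ t)]; exact cap_le_one hδ hδ1 t

theorem abs_trunc_le_one (hδ : 0 < δ) (hδ1 : δ ≤ 1) (t : ℝ) : |trunc u δ t| ≤ 1 :=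
  (abs_trunc_le hδ t).trans hδ1

theorem lipschitzWith_cap (hδ : 0 < δ) (hδ1 : δ ≤ 1) : ∃ K : ℝ≥0, LipschitzWith K (cap u δ) := by
  obtain ⟨K, hK⟩ := exists_lipschitzWith_mul (lipschitzWith_trunc u δ) (lipschitzWith_trunc u δ)
    (abs_trunc_le_one hδ hδ1) (abs_trunc_le_one hδ hδ1)
  refine ⟨0 + K, ?_⟩
  have e : cap u δ = fun t => δ ^ 2 - trunc u δ t * trunc u δ t := by
    ext t; rw [cap]; ring
  rw [e]
  exact (LipschitzWith.const (δ ^ 2)).sub hK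

theorem lipschitzWith_bump (hδ : 0 < δ) (hδ1 : δ ≤ 1) : ∃ K : ℝ≥0, LipschitzWith K (bump u δ) := by
  have e : bump u δ = fun t => cap u δ t * cap u δ t := by
    ext t; rw [bump]; ring
  rw [e]
  exact exists_lipschitzWith_mul (lipschitzWith_cap hδ hδ1) (lipschitzWith_cap hδ hδ1)
    (abs_cap_le_one hδ hδ1) (abs_cap_le_one hδ hδ1)

theorem hasDerivAt_max_sq (x : ℝ) : HasDerivAt (fun y : ℝ => max 0 y ^ 2) (2 * max 0 x) x := by
  rcases lt_trichotomy x 0 with hx | rfl | hx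
  · rw [max_eq_left hx.le, mul_zero]
    refine (hasDerivAt_const x (0 : ℝ)).congr_of_eventuallyEq ?_
    filter_upwards [Iio_mem_nhds hx] with y hy
    rw [max_eq_left (le_of_lt hy)]; ring
  · rw [hasDerivAt_iff_tendsto_slope]
    -- At the kink the slope of `(max 0 y)²` from `0` is `max 0 y` itself, which tends to `0`.
    have h : Tendsto (fun y : ℝ => max 0 y) (𝓝[≠] 0) (𝓝 (2 * max 0 0)) := by
      have hc : Continuous fun y : ℝ => max 0 y := continuous_const.max continuous_id
      have := (hc.tendsto 0).mono_left (nhdsWithin_le_nhds (s := {0}ᶜ))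
      simpa using this
    refine h.congr' ?_
    filter_upwards [self_mem_nhdsWithin] with y hy
    have hy0 : y ≠ 0 := hy
    rw [slope_def_field]
    rcases le_total 0 y with h0 | h0
    · simp only [max_eq_right h0, max_self, sub_zero]
      field_simp
      ring
    · simp [max_eq_left h0]
  · rw [max_eq_right hx.le]
    refine (((hasDerivAt_id x).pow 2).congr_of_eventuallyEq (f₁ := fun y : ℝ => max 0 y ^ 2)
      ?_).congr_deriv (by simp)
    filter_upwards [Ioi_mem_nhds hx] with y hy
    rw [max_eq_right (le_of_lt hy)]; simp

theorem hasDerivAt_bump (hδ : 0 < δ) (t : ℝ) :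
    HasDerivAt (bump u δ) (-4 * (trunc u δ t * cap u δ t)) t := by
  have e : bump u δ = fun t => max 0 (δ ^ 2 - (t - u) ^ 2) ^ 2 := by
    ext t; rw [bump, cap_eq_max hδ]
  have h1 : HasDerivAt (fun t : ℝ => δ ^ 2 - (t - u) ^ 2) (-(2 * (t - u))) t := by
    refine ((((hasDerivAt_id t).sub_const u).pow 2).const_sub (δ ^ 2)).congr_deriv ?_
    simp
  have h2 := (hasDerivAt_max_sq (δ ^ 2 - (t - u) ^ 2)).comp t h1
  rw [e]
  refine h2.congr_deriv ?_
  rw [← sub_mul_cap hδ, cap_eq_max hδ]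
  ring

/-- The displacement `t ↦ t - ε η(t) (t - u)`. -/
def squeeze (u δ ε t : ℝ) : ℝ := u + (1 - ε * bump u δ t) * (t - u)

/-- The derivative of `squeeze`. -/
def squeezeD (u δ ε t : ℝ) : ℝ :=
  1 - ε * bump u δ t + 4 * ε * (trunc u δ t * (trunc u δ t * cap u δ t))

theorem hasDerivAt_squeeze (hδ : 0 < δ) (ε t : ℝ) :
    HasDerivAt (squeeze u δ ε) (squeezeD u δ ε t) t := by
  have h1 := (((hasDerivAt_bump (u := u) hδ t).const_mul ε).const_sub 1).mul
    ((hasDerivAt_id t).sub_const u)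
  refine (h1.const_add u).congr_deriv ?_
  have := sub_mul_cap (u := u) hδ t
  simp only [squeezeD, id]
  linear_combination (4 * ε * trunc u δ t) * this

/-- The term coming from the derivative of the bump is nonnegative, so the derivative is at least `1
- ε`. -/
theorem half_le_squeezeD (hδ : 0 < δ) (hδ1 : δ ≤ 1) {ε : ℝ} (hε : 0 ≤ ε) (hε1 : ε ≤ 1 / 2) (t : ℝ) :
    1 / 2 ≤ squeezeD u δ ε t := by
  have h1 := bump_le_one (u := u) hδ hδ1 t
  have h2 := bump_nonneg (u := u) (δ := δ) t
  have h3 : 0 ≤ trunc u δ t * (trunc u δ t * cap u δ t) := by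
    rw [← mul_assoc]; exact mul_nonneg (mul_self_nonneg _) (cap_nonneg hδ t)
  have h4 : 0 ≤ 4 * ε * (trunc u δ t * (trunc u δ t * cap u δ t)) := by positivity
  unfold squeezeD
  nlinarith

theorem squeeze_eq_self (hδ : 0 < δ) {t : ℝ} (ε : ℝ) (ht : δ ≤ |t - u|) : squeeze u δ ε t = t := by
  rw [squeeze, bump_eq_zero hδ ht]; ring

theorem strictMono_squeeze (hδ : 0 < δ) (hδ1 : δ ≤ 1) {ε : ℝ} (hε : 0 ≤ ε) (hε1 : ε ≤ 1 / 2) :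
    StrictMono (squeeze u δ ε) := by
  refine strictMono_of_deriv_pos fun t => ?_
  rw [(hasDerivAt_squeeze hδ ε t).deriv]
  linarith [half_le_squeezeD (u := u) hδ hδ1 hε hε1 t]

theorem surjective_squeeze (hδ : 0 < δ) (ε : ℝ) : Function.Surjective (squeeze u δ ε) := by
  have hc : Continuous (squeeze u δ ε) :=
    continuous_iff_continuousAt.mpr fun t => (hasDerivAt_squeeze hδ ε t).continuousAt
  refine hc.surjective ?_ ?_
  · refine tendsto_id.congr' ?_
    filter_upwards [eventually_ge_atTop (u + δ)] with t ht
    have h : δ ≤ |t - u| := le_abs.mpr (Or.inl (by linarith))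
    exact (squeeze_eq_self hδ ε h).symm
  · refine tendsto_id.congr' ?_
    filter_upwards [eventually_le_atBot (u - δ)] with t ht
    have h : δ ≤ |t - u| := le_abs.mpr (Or.inr (by linarith))
    exact (squeeze_eq_self hδ ε h).symm

theorem lipschitzWith_squeezeD (hδ : 0 < δ) (hδ1 : δ ≤ 1) (ε : ℝ) :
    ∃ K : ℝ≥0, LipschitzWith K (squeezeD u δ ε) := by
  have hz1 := abs_trunc_le_one (u := u) hδ hδ1
  have hp1 := abs_cap_le_one (u := u) hδ hδ1
  have h1 := exists_lipschitzWith_mul (lipschitzWith_trunc u δ) (lipschitzWith_cap hδ hδ1 (u := u))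
    hz1 hp1
  have hzp : ∀ t, |trunc u δ t * cap u δ t| ≤ 1 := fun t => by
    rw [abs_mul]; exact mul_le_one₀ (hz1 t) (abs_nonneg _) (hp1 t)
  obtain ⟨K, hK⟩ := exists_lipschitzWith_const_mul (4 * ε)
    (exists_lipschitzWith_mul (lipschitzWith_trunc u δ) h1 hz1 hzp)
  obtain ⟨L, hL⟩ := exists_lipschitzWith_const_mul ε (lipschitzWith_bump hδ hδ1 (u := u))
  exact ⟨_, ((LipschitzWith.const (1 : ℝ)).sub hL).add hK⟩

end Bump

/-! ### Pulling the path towards its value at `u` -/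

/-- The path displaced towards its value at `u`. -/
def pull (Φ : ℝ → Matrix (Fin m) (Fin m) ℝ) (u δ ε t : ℝ) : Matrix (Fin m) (Fin m) ℝ :=
  Φ u + (1 - ε * bump u δ t) • (Φ t - Φ u)

theorem pull_eq (Φ : ℝ → Matrix (Fin m) (Fin m) ℝ) (u δ ε t : ℝ) :
    pull Φ u δ ε t = Φ t + ε • (-(bump u δ t • (Φ t - Φ u))) := by
  ext i j; simp [pull]; ring

theorem pull_eq_self (Φ : ℝ → Matrix (Fin m) (Fin m) ℝ) {u δ : ℝ} (hδ : 0 < δ) (ε : ℝ) {t : ℝ}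
    (ht : δ ≤ |t - u|) : pull Φ u δ ε t = Φ t := by
  rw [pull, bump_eq_zero hδ ht]; simp

/-- Admissible sizes of the displaced interval. -/
structure GoodRadius (u δ T : ℝ) : Prop where
  pos : 0 < δ
  le_one : δ ≤ 1
  nonneg : 0 ≤ u
  left : u = 0 ∨ δ ≤ u
  right : u + δ ≤ T

section Pull

variable {Q : Matrix (Fin m) (Fin m) ℝ} {Φ : ℝ → Matrix (Fin m) (Fin m) ℝ} {u δ T ε : ℝ}

theorem GoodRadius.le_abs_of_ge (hr : GoodRadius u δ T) {t : ℝ} (ht : T ≤ t) : δ ≤ |t - u| :=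
  le_abs.mpr (Or.inl (by linarith [hr.right]))

theorem GoodRadius.le_abs_of_nonpos (hr : GoodRadius u δ T) (hu : u ≠ 0) {t : ℝ} (ht : t ≤ 0) :
    δ ≤ |t - u| :=
  le_abs.mpr (Or.inr (by linarith [hr.left.resolve_left hu]))

/-- If `u = 0`, the origin is the centre of the squeeze; otherwise it lies outside the bump. This is
why a support point at the left endpoint needs no separate argument. -/
theorem GoodRadius.squeeze_zero (hr : GoodRadius u δ T) (ε : ℝ) : squeeze u δ ε 0 = 0 := by
  by_cases hu : u = 0
  · rw [squeeze, hu]; ring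
  · exact squeeze_eq_self hr.pos ε (hr.le_abs_of_nonpos hu le_rfl)

theorem pull_lipschitz (hQ : IsConstraint Q) (hΦ : GlobalPath Q Φ) (hr : GoodRadius u δ T) :
    ∃ K : ℝ≥0, ∀ i j, LipschitzWith K fun t => (-(bump u δ t • (Φ t - Φ u))) i j := by
  obtain ⟨K, hK⟩ := hΦ.lipschitz
  have h : ∀ i j, ∃ K : ℝ≥0, LipschitzWith K fun t => (-(bump u δ t • (Φ t - Φ u))) i j :=
    fun i j => by
      obtain ⟨L, hL⟩ := exists_lipschitzWith_mul (lipschitzWith_bump (u := u) hr.pos hr.le_one)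
        ⟨K + 0, (hK i j).sub (LipschitzWith.const (Φ u i j))⟩ (a := 1) (b := 2)
        (fun t => by rw [abs_of_nonneg (bump_nonneg t)]; exact bump_le_one hr.pos hr.le_one t)
        fun t => hΦ.abs_sub_apply_le hQ t u i j
      exact ⟨L, hL.neg⟩
  choose L hL using h
  refine ⟨∑ i, ∑ j, L i j, fun i j => (hL i j).weaken ?_⟩
  exact (Finset.single_le_sum (f := fun j => L i j) (fun _ _ => zero_le)
      (Finset.mem_univ j)).trans
      (Finset.single_le_sum (f := fun i => ∑ j, L i j) (fun _ _ => zero_le)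
      (Finset.mem_univ i))

/-- An increment on one side of `u` is a nonnegative multiple of an increment of `Φ` plus another
weighted by a difference of bump values, nonnegative by unimodality. An increment across `u` splits
at `Φ(u)`. -/
theorem globalPath_pull (hQ : IsConstraint Q) (hΦ : GlobalPath Q Φ) (hr : GoodRadius u δ T)
    (hT : T ≤ m) (hε : 0 ≤ ε) (hε1 : ε ≤ 1 / 2) : GlobalPath Q (pull Φ u δ ε) := by
  have hκ : ∀ t, 0 ≤ 1 - ε * bump u δ t := fun t => by
    nlinarith [bump_le_one (u := u) hr.pos hr.le_one t, bump_nonneg (u := u) (δ := δ) t]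
  refine ⟨?_, fun s t hst => ?_, fun t ht => ?_, fun t ht => ?_⟩
  · obtain ⟨K, hK⟩ := hΦ.lipschitz
    obtain ⟨L, hL⟩ := pull_lipschitz hQ hΦ hr
    refine ⟨K + ‖ε‖₊ * L, fun i j => ?_⟩
    simp only [pull_eq]
    exact (hK i j).add ((lipschitzWith_smul ε).comp (hL i j))
  · rcases le_total u s with hus | hus
    · have e : pull Φ u δ ε t - pull Φ u δ ε s = (1 - ε * bump u δ t) • (Φ t - Φ s)
          + (ε * (bump u δ s - bump u δ t)) • (Φ s - Φ u) := by
        ext i j; simp [pull]; ring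
      rw [e]
      refine ((hΦ.mono s t hst).smul (hκ t)).add ((hΦ.mono u s hus).smul ?_)
      refine mul_nonneg hε (sub_nonneg.mpr (bump_le_bump hr.pos ?_))
      rw [abs_of_nonneg (by linarith), abs_of_nonneg (by linarith)]; linarith
    · rcases le_total t u with htu | htu
      · have e : pull Φ u δ ε t - pull Φ u δ ε s = (1 - ε * bump u δ s) • (Φ t - Φ s)
            + (ε * (bump u δ t - bump u δ s)) • (Φ u - Φ t) := by
          ext i j; simp [pull]; ring
        rw [e]
        refine ((hΦ.mono s t hst).smul (hκ s)).add ((hΦ.mono t u htu).smul ?_)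
        refine mul_nonneg hε (sub_nonneg.mpr (bump_le_bump hr.pos ?_))
        rw [abs_of_nonpos (by linarith), abs_of_nonpos (by linarith)]; linarith
      · have e : pull Φ u δ ε t - pull Φ u δ ε s = (1 - ε * bump u δ t) • (Φ t - Φ u)
            + (1 - ε * bump u δ s) • (Φ u - Φ s) := by
          ext i j; simp [pull]; ring
        rw [e]
        exact ((hΦ.mono u t htu).smul (hκ t)).add ((hΦ.mono s u hus).smul (hκ s))
  · by_cases hu : u = 0
    · rw [pull, hu, hΦ.eq_zero 0 le_rfl, hΦ.eq_zero t ht]; simp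
    · rw [pull_eq_self Φ hr.pos ε (hr.le_abs_of_nonpos hu ht), hΦ.eq_zero t ht]
  · rw [pull_eq_self Φ hr.pos ε (hr.le_abs_of_ge (hT.trans ht)), hΦ.eq_top t ht]

theorem CutPair.pull {μ : Measure ℝ} (hQ : IsConstraint Q) (hp : CutPair Q μ Φ T)
    (hr : GoodRadius u δ T) (hε : 0 ≤ ε) (hε1 : ε ≤ 1 / 2) :
    CutPair Q μ (VectorSpin.pull Φ u δ ε) T where
  path := globalPath_pull hQ hp.path hr hp.lt.le hε hε1
  prob := hp.prob
  compl := hp.compl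
  pos := hp.pos
  lt := hp.lt
  posDef := by
    rw [pull_eq_self Φ hr.pos ε (hr.le_abs_of_ge le_rfl)]; exact hp.posDef

end Pull

/-- The first-order consequence of minimality under displacement towards `Φ(u)`. -/
theorem CutPair.integral_bump_pullDeriv_nonneg {β : ℕ → Fin m → ℝ} (hβ : IsMixedEvenModel β)
    (h : Fin m → ℝ) {Q : Matrix (Fin m) (Fin m) ℝ} (hQ : IsConstraint Q) {μ : Measure ℝ}
    {Φ : ℝ → Matrix (Fin m) (Fin m) ℝ} {u δ T : ℝ} (hp : CutPair Q μ Φ T)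
    (hr : GoodRadius u δ T)
    (hmin : ∀ ε, 0 < ε → ε ≤ 1 / 2 →
      reduced β h Q μ Φ T ≤ reduced β h Q μ (VectorSpin.pull Φ u δ ε) T) :
    Integrable (fun s => bump u δ s * pullDeriv β h Q μ Φ T u s) μ ∧
      0 ≤ ∫ s, bump u δ s * pullDeriv β h Q μ Φ T u s ∂μ := by
  obtain ⟨L, hL⟩ := pull_lipschitz hQ hp.path hr
  have hfun : ∀ ε, (fun s => Φ s + ε • (-(bump u δ s • (Φ s - Φ u)))) = VectorSpin.pull Φ u δ ε :=
    fun ε => funext fun s => (pull_eq Φ u δ ε s).symm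
  have hb1 : ∀ t, |bump u δ t| ≤ 1 := fun t => by
    rw [abs_of_nonneg (bump_nonneg t)]; exact bump_le_one hr.pos hr.le_one t
  have key := hp.path_variation_nonneg hβ h hQ (Ψ := fun s => -(bump u δ s • (Φ s - Φ u)))
    (L := L) (C := 1 * 2) (ε₀ := 1 / 2) hL (fun t i j => ?_) ?_ ?_ (by norm_num)
    (fun ε h0 h1 => ?_) (fun ε h0 h1 s => ?_) (fun ε h0 h1 => ?_)
  · have hpt : ∀ s, (∫ t in (0 : ℝ)..T, (Iio s).indicator
          (fun t => pairing (resolv Q μ Φ t) (-(bump u δ s • (Φ s - Φ u)))) t)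
        - pairing (xiD β (Φ s) + Matrix.vecMulVec h h) (-(bump u δ s • (Φ s - Φ u)))
        = bump u δ s * pullDeriv β h Q μ Φ T u s := fun s => by
      have e : ∀ A : Matrix (Fin m) (Fin m) ℝ, pairing A (-(bump u δ s • (Φ s - Φ u)))
          = -bump u δ s * pairing A (Φ s - Φ u) := fun A => by
        rw [← neg_smul, pairing_smul_right]
      simp only [e, pullDeriv]
      have e2 : ∀ t, (Iio s).indicator
            (fun t => -bump u δ s * pairing (resolv Q μ Φ t) (Φ s - Φ u)) t
          = -bump u δ s * (Iio s).indicator (fun t => pairing (resolv Q μ Φ t) (Φ s - Φ u)) t :=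
        fun t => by by_cases ht : t < s <;> simp [indicator, ht]
      simp only [e2, intervalIntegral.integral_const_mul]
      ring
    simpa only [hpt] using key
  · rw [Matrix.neg_apply, Matrix.smul_apply, smul_eq_mul, abs_neg, abs_mul]
    exact mul_le_mul (hb1 t) (hp.path.abs_sub_apply_le hQ t u i j) (abs_nonneg _) zero_le_one
  · by_cases hu : u = 0
    · simp [hu]
    · simp [bump_eq_zero hr.pos (hr.le_abs_of_nonpos hu le_rfl)]
  · simp [bump_eq_zero hr.pos (hr.le_abs_of_ge le_rfl)]
  · rw [hfun]; exact hp.pull hQ hr h0.le h1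
  · have hg := globalPath_pull hQ hp.path hr hp.lt.le h0.le h1
    have e : Φ s - VectorSpin.pull Φ u δ ε s = (ε * bump u δ s) • (Φ s - Φ u) := by
      ext i j; simp [VectorSpin.pull]; ring
    have hnn : 0 ≤ ε * bump u δ s := mul_nonneg h0.le (bump_nonneg s)
    -- The tangent is taken at `Φ(s)`, so the inequality bounds the potential of the pulled path
    -- from below.
    have hc := potential_convex hβ h (hg.posSemidef s) (hp.path.posSemidef s)
      (hg.abs_apply_le_one hQ s) (hp.path.abs_apply_le_one hQ s) (by
        rw [e, ← smul_neg]
        rcases hp.path.sub_posSemidef_or s u with hd | hd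
        · exact Or.inl (hd.smul hnn)
        · exact Or.inr (hd.smul hnn))
    rw [e, pairing_smul_right] at hc
    rw [← pull_eq, ← neg_smul, pairing_smul_right]
    linarith
  · rw [hfun]; exact hmin ε h0 h1

/-! ### Invariance under reparametrization -/

/-- Increasing `C¹` reparametrizations of the line that fix `0`, `T` and `m`. -/
structure IsReparam (m : ℕ) (T : ℝ) (e : ℝ ≃o ℝ) (e' : ℝ → ℝ) : Prop where
  hasDerivAt : ∀ t, HasDerivAt e (e' t) t
  half_le : ∀ t, 1 / 2 ≤ e' t
  zero : e 0 = 0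
  cut : e T = T
  top : e m = m

namespace IsReparam

variable {T : ℝ} {e : ℝ ≃o ℝ} {e' : ℝ → ℝ}

theorem symm_zero (he : IsReparam m T e e') : e.symm 0 = 0 := by
  rw [OrderIso.symm_apply_eq, he.zero]

theorem symm_cut (he : IsReparam m T e e') : e.symm T = T := by
  rw [OrderIso.symm_apply_eq, he.cut]

theorem symm_top (he : IsReparam m T e e') : e.symm m = m := by
  rw [OrderIso.symm_apply_eq, he.top]

theorem hasDerivAt_symm (he : IsReparam m T e e') (t : ℝ) :
    HasDerivAt e.symm (e' (e.symm t))⁻¹ t :=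
  HasDerivAt.of_local_left_inverse e.symm.continuous.continuousAt (he.hasDerivAt _)
    (by linarith [he.half_le (e.symm t)]) (Eventually.of_forall fun s => e.apply_symm_apply s)

theorem lipschitzWith_symm (he : IsReparam m T e e') : LipschitzWith 2 e.symm := by
  refine lipschitzWith_of_nnnorm_deriv_le (fun t => (he.hasDerivAt_symm t).differentiableAt)
    fun t => ?_
  rw [(he.hasDerivAt_symm t).deriv, ← NNReal.coe_le_coe, coe_nnnorm, Real.norm_eq_abs]
  have h := he.half_le (e.symm t)
  rw [abs_of_nonneg (by positivity), NNReal.coe_ofNat]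
  rw [inv_le_comm₀ (by linarith) (by norm_num)]
  linarith

theorem symm_mem_Icc (he : IsReparam m T e e') {t : ℝ} (ht : t ∈ Icc (0 : ℝ) m) :
    e.symm t ∈ Icc (0 : ℝ) m :=
  ⟨by rw [← he.symm_zero]; exact e.symm.monotone ht.1,
    by rw [← he.symm_top]; exact e.symm.monotone ht.2⟩

theorem preimage_Icc (he : IsReparam m T e e') (a : ℝ) : e ⁻¹' Icc 0 (e a) = Icc 0 a := by
  ext t
  simp [he.symm_zero]

end IsReparam

section Reparam

variable {Q : Matrix (Fin m) (Fin m) ℝ} {μ : Measure ℝ} {Φ : ℝ → Matrix (Fin m) (Fin m) ℝ}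
  {T : ℝ} {e : ℝ ≃o ℝ} {e' : ℝ → ℝ}

theorem GlobalPath.reparam (hΦ : GlobalPath Q Φ) (he : IsReparam m T e e') :
    GlobalPath Q fun t => Φ (e.symm t) where
  lipschitz := by
    obtain ⟨K, hK⟩ := hΦ.lipschitz
    exact ⟨K * 2, fun i j => (hK i j).comp he.lipschitzWith_symm⟩
  mono s t hst := hΦ.mono _ _ (e.symm.monotone hst)
  eq_zero t ht := hΦ.eq_zero _ (by rw [← he.symm_zero]; exact e.symm.monotone ht)
  eq_top t ht := hΦ.eq_top _ (by rw [← he.symm_top]; exact e.symm.monotone ht)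

theorem integral_map_orderIso (e : ℝ ≃o ℝ) (μ : Measure ℝ) (f : ℝ → ℝ) :
    ∫ s, f s ∂(μ.map e) = ∫ s, f (e s) ∂μ :=
  e.toHomeomorph.measurableEmbedding.integral_map f

theorem distr_map (he : IsReparam m T e e') (μ : Measure ℝ) (a : ℝ) :
    distr (μ.map e) (e a) = distr μ a := by
  rw [distr, distr, map_measureReal_apply e.continuous.measurable measurableSet_Icc,
    he.preimage_Icc]

theorem CutPair.reparam (hp : CutPair Q μ Φ T) (he : IsReparam m T e e') :
    CutPair Q (μ.map e) (fun t => Φ (e.symm t)) T where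
  path := hp.path.reparam he
  prob := by
    have := hp.prob
    exact Measure.isProbabilityMeasure_map e.continuous.measurable.aemeasurable
  compl := by
    have h := he.preimage_Icc T
    rw [he.cut] at h
    rw [Measure.map_apply e.continuous.measurable measurableSet_Icc.compl, preimage_compl, h]
    exact hp.compl
  pos := hp.pos
  lt := hp.lt
  posDef := by rw [he.symm_cut]; exact hp.posDef

/-- `Φ̂` uses the time axis only through the maximum, and an order isomorphism commutes with it. -/
theorem hatM_map (e : ℝ ≃o ℝ) (t : ℝ) :
    hatM Q (μ.map e) (fun t => Φ (e.symm t)) (e t) = hatM Q μ Φ t := by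
  ext i j
  simp only [hatM, tail, Matrix.of_apply, one_mul]
  rw [integral_map_orderIso]
  refine integral_congr_ae (ae_of_all _ fun s => ?_)
  simp only [← e.monotone.map_max, e.symm_apply_apply]

/-- The reduced functional does not depend on the parametrization. -/
theorem reduced_reparam (β : ℕ → Fin m → ℝ) (h : Fin m → ℝ) (hp : CutPair Q μ Φ T)
    (he : IsReparam m T e e') :
    reduced β h Q (μ.map e) (fun t => Φ (e.symm t)) T = reduced β h Q μ Φ T := by
  unfold reduced
  congr 1
  · rw [integral_map_orderIso]
    simp only [e.symm_apply_apply]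
  · rw [intervalIntegral.integral_of_le hp.pos.le, intervalIntegral.integral_of_le hp.pos.le]
    have himg : e '' Ioc 0 T = Ioc 0 T := by
      rw [OrderIso.image_Ioc, he.zero, he.cut]
    have hcv := integral_image_eq_integral_abs_deriv_smul (s := Ioc 0 T) (f := e) (f' := e')
      measurableSet_Ioc (fun t _ => (he.hasDerivAt t).hasDerivWithinAt) e.injective.injOn
      fun t => pairing (hatM Q (μ.map e) (fun t => Φ (e.symm t)) t)⁻¹
        (pathD (fun t => Φ (e.symm t)) t)
    rw [himg] at hcv
    rw [hcv]
    refine integral_congr_ae (ae_restrict_of_ae ?_)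
    filter_upwards [ae_differentiableAt hp.path] with t ht
    have hpos : 0 < e' t := by linarith [he.half_le t]
    -- The factor `e'` from the change of variables cancels the chain-rule factor in the derivative
    -- of `Φ ∘ e⁻¹`.
    have hd : e' t • pathD (fun t => Φ (e.symm t)) (e t) = pathD Φ t := by
      ext i j
      have h1 := he.hasDerivAt_symm (e t)
      rw [e.symm_apply_apply] at h1
      have h2 : HasDerivAt (fun s => Φ s i j) (deriv (fun s => Φ s i j) t) (e.symm (e t)) := by
        rw [e.symm_apply_apply]; exact (ht i j).hasDerivAt
      have h3 := (h2.comp (e t) h1).deriv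
      change e' t * deriv ((fun s => Φ s i j) ∘ e.symm) (e t) = deriv (fun s => Φ s i j) t
      rw [h3]
      field_simp
    rw [hatM_map, abs_of_pos hpos, smul_eq_mul, ← pairing_smul_right, hd]

theorem mem_support_map (e : ℝ ≃o ℝ) {t : ℝ} (ht : t ∈ (μ.map e).support) :
    e.symm t ∈ μ.support := by
  rw [Measure.mem_support_iff_forall] at ht ⊢
  intro U hU
  have hV : e.symm ⁻¹' U ∈ 𝓝 t := e.symm.continuous.continuousAt.preimage_mem_nhds hU
  have := ht _ hV
  change 0 < (μ.map e.toHomeomorph) (e.symm ⁻¹' U) at this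
  rw [e.toHomeomorph.measurableEmbedding.map_apply] at this
  have h2 : e ⁻¹' (e.symm ⁻¹' U) = U := by ext s; simp
  change 0 < μ (e ⁻¹' (e.symm ⁻¹' U)) at this
  rwa [h2] at this

end Reparam

/-- `squeeze` as an order isomorphism. -/
def squeezeIso {u δ ε : ℝ} (hδ : 0 < δ) (hδ1 : δ ≤ 1) (hε : 0 ≤ ε) (hε1 : ε ≤ 1 / 2) : ℝ ≃o ℝ :=
  (strictMono_squeeze (u := u) hδ hδ1 hε hε1).orderIsoOfSurjective _ (surjective_squeeze hδ ε)

theorem isReparam_squeezeIso {u δ T ε : ℝ} (hr : GoodRadius u δ T) (hT : T ≤ m) (hε : 0 ≤ ε)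
    (hε1 : ε ≤ 1 / 2) :
    IsReparam m T (squeezeIso (u := u) hr.pos hr.le_one hε hε1) (squeezeD u δ ε) where
  hasDerivAt := hasDerivAt_squeeze hr.pos ε
  half_le := half_le_squeezeD hr.pos hr.le_one hε hε1
  zero := hr.squeeze_zero ε
  cut := squeeze_eq_self hr.pos ε (hr.le_abs_of_ge le_rfl)
  top := squeeze_eq_self hr.pos ε (hr.le_abs_of_ge hT)

/-! ### Admissibility of the competitors -/

section Admissible

variable {Q : Matrix (Fin m) (Fin m) ℝ} {μ : Measure ℝ} {Φ : ℝ → Matrix (Fin m) (Fin m) ℝ} {T : ℝ}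

theorem topPoint_le {a : ℝ} (ha : a ∈ Icc (0 : ℝ) m) (h : distr μ a = 1) : topPoint m μ ≤ a :=
  csInf_le ⟨0, fun _ ht => ht.1.1⟩ ⟨ha, h⟩

theorem CutPair.isCutoff (hp : CutPair Q μ Φ T) {a : ℝ} (ha : a ∈ Icc (0 : ℝ) m) (haT : a < T)
    (h : distr μ a = 1) : IsCutoff Q μ Φ T :=
  ⟨(topPoint_le ha h).trans_lt haT, hp.lt, hp.posDef.det_pos⟩

theorem CutPair.isPair (hp : CutPair Q μ Φ T) {a : ℝ} (ha : a ∈ Icc (0 : ℝ) m) (haT : a < T)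
    (h : distr μ a = 1) : IsPair Q μ Φ where
  prob := hp.prob
  compl := hp.compl_top
  topPoint_lt := (topPoint_le ha h).trans_lt (haT.trans hp.lt)
  det_pos := by
    have h1 := hp.path.mono (topPoint m μ) T ((topPoint_le ha h).trans haT.le)
    refine (PosDef.of_le hp.posDef (Y := Q - Φ (topPoint m μ)) ?_).det_pos
    rwa [sub_sub_sub_cancel_left]

theorem GlobalPath.isMonotonePath (hΦ : GlobalPath Q Φ) : IsMonotonePath Q Φ where
  posSemidef t _ := hΦ.posSemidef t
  mono s _ t _ hst := hΦ.mono s t hst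
  zero := hΦ.eq_zero 0 le_rfl
  top := hΦ.eq_top m le_rfl

/-- The Lipschitz constant `1` comes for free: increments are positive semidefinite, so their
entries are bounded by their trace `t - s`. -/
theorem GlobalPath.isTracePath (hΦ : GlobalPath Q Φ)
    (htr : ∀ t ∈ Icc (0 : ℝ) m, (Φ t).trace = t) : IsTracePath Q Φ where
  toIsMonotonePath := hΦ.isMonotonePath
  trace := htr
  lipschitz i j := by
    have key : ∀ s ∈ Icc (0 : ℝ) m, ∀ t ∈ Icc (0 : ℝ) m, s ≤ t → |Φ t i j - Φ s i j| ≤ |t - s| := by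
      intro s hs t ht hst
      have h1 := PosSemidef.abs_apply_le_trace (hΦ.mono s t hst) i j
      rw [Matrix.trace_sub, htr s hs, htr t ht] at h1
      exact h1.trans (le_abs_self _)
    refine LipschitzOnWith.of_dist_le_mul fun s hs t ht => ?_
    rw [Real.dist_eq, Real.dist_eq, NNReal.coe_one, one_mul]
    rcases le_total s t with hst | hst
    · rw [abs_sub_comm, abs_sub_comm s]; exact key s hs t ht hst
    · exact key t ht s hs hst

/-- The pull is affine in `Φ(t)`, so the trace moves exactly as `squeeze` does. Composing with the
inverse of `squeeze` restores `Tr Φ(t) = t`. -/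
theorem trace_pull (Φ : ℝ → Matrix (Fin m) (Fin m) ℝ) {u δ ε t : ℝ} (hu : (Φ u).trace = u)
    (ht : (Φ t).trace = t) : (pull Φ u δ ε t).trace = squeeze u δ ε t := by
  simp [pull, squeeze, hu, ht]

end Admissible

theorem lipschitzOnWith_congr {f g : ℝ → ℝ} {K : ℝ≥0} {s : Set ℝ} (hf : LipschitzOnWith K f s)
    (h : EqOn f g s) : LipschitzOnWith K g s := fun x hx y hy => by
  rw [← h hx, ← h hy]
  exact hf hx hy

/-- The retraction of the line onto `[0, m]`. -/
def clamp (m : ℕ) (t : ℝ) : ℝ := max 0 (min m t)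

theorem clamp_mem (m : ℕ) (t : ℝ) : clamp m t ∈ Icc (0 : ℝ) m :=
  ⟨le_max_left _ _, max_le (Nat.cast_nonneg m) (min_le_left _ _)⟩

theorem clamp_of_mem {t : ℝ} (ht : t ∈ Icc (0 : ℝ) m) : clamp m t = t := by
  rw [clamp, min_eq_right ht.2, max_eq_right ht.1]

theorem clamp_mono (m : ℕ) : Monotone (clamp m) := fun _ _ h =>
  max_le_max le_rfl (min_le_min le_rfl h)

theorem lipschitzWith_clamp (m : ℕ) : LipschitzWith 1 (clamp m) :=
  (LipschitzWith.id.const_min (m : ℝ)).const_max 0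

theorem lipschitzWith_comp_clamp {f : ℝ → ℝ} {K : ℝ≥0} (hf : LipschitzOnWith K f (Icc (0 : ℝ) m)) :
    LipschitzWith K fun t => f (clamp m t) := by
  have := hf.comp ((lipschitzWith_clamp m).lipschitzOnWith (s := univ)) fun t _ => clamp_mem m t
  rw [lipschitzOnWith_univ, mul_one] at this
  exact this

theorem exists_uniform_lipschitzOnWith {f : Fin m → Fin m → ℝ → ℝ} {s : Set ℝ}
    (h : ∀ i j, ∃ K : ℝ≥0, LipschitzOnWith K (f i j) s) :
    ∃ K : ℝ≥0, ∀ i j, LipschitzOnWith K (f i j) s := by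
  choose L hL using h
  refine ⟨∑ i, ∑ j, L i j, fun i j => (hL i j).weaken ?_⟩
  exact (Finset.single_le_sum (f := fun j => L i j) (fun _ _ => zero_le)
      (Finset.mem_univ j)).trans
      (Finset.single_le_sum (f := fun i => ∑ j, L i j) (fun _ _ => zero_le)
      (Finset.mem_univ i))

theorem exists_lipschitzWith_inv {f : ℝ → ℝ} (hf : ∃ K : ℝ≥0, LipschitzWith K f)
    (hlow : ∀ t, 1 / 2 ≤ f t) : ∃ K : ℝ≥0, LipschitzWith K fun t => (f t)⁻¹ := by
  obtain ⟨K, hK⟩ := hf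
  refine ⟨4 * K, LipschitzWith.of_dist_le_mul fun s t => ?_⟩
  have hs : 0 < f s := by linarith [hlow s]
  have ht : 0 < f t := by linarith [hlow t]
  have e : (f s)⁻¹ - (f t)⁻¹ = (f t - f s) / (f s * f t) := by
    field_simp
  rw [Real.dist_eq, Real.dist_eq, e, abs_div, abs_of_pos (mul_pos hs ht), abs_sub_comm,
    div_le_iff₀ (mul_pos hs ht)]
  have h1 := abs_sub_le_of_lipschitzWith hK s t
  have h2 : 1 ≤ 4 * (f s * f t) := by nlinarith [hlow s, hlow t]
  have h3 : 0 ≤ (K : ℝ) * |s - t| := by positivity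
  push_cast
  nlinarith

section Smooth

variable {Q : Matrix (Fin m) (Fin m) ℝ} {μ : Measure ℝ} {Φ : ℝ → Matrix (Fin m) (Fin m) ℝ}
  {u δ T ε : ℝ}

/-- The displaced path, reparametrized, is again smooth. -/
theorem IsSmoothPath.pull (hQ : IsConstraint Q) (hS : IsSmoothPath Q μ Φ) (hΦ : GlobalPath Q Φ)
    (hu : u ∈ μ.support) (hr : GoodRadius u δ T) (hT : T ≤ m) (hε : 0 ≤ ε) (hε1 : ε ≤ 1 / 2) :
    IsSmoothPath Q (μ.map (squeezeIso (u := u) hr.pos hr.le_one hε hε1))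
      fun t => VectorSpin.pull Φ u δ ε ((squeezeIso (u := u) hr.pos hr.le_one hε hε1).symm t) := by
  set e := squeezeIso (u := u) hr.pos hr.le_one hε hε1 with he
  have hre : IsReparam m T e (squeezeD u δ ε) := isReparam_squeezeIso hr hT hε hε1
  have hg := (globalPath_pull hQ hΦ hr hT hε hε1).reparam hre
  have hm0 : (0 : ℝ) ≤ m := Nat.cast_nonneg m
  have hmpos : (0 : ℝ) < m := by linarith [hr.right, hr.pos, hr.nonneg]
  obtain ⟨K, hK⟩ := hΦ.lipschitz
  obtain ⟨L, hL⟩ := hS.lipschitz_deriv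
  -- The derivative of the reparametrized path in the old parameter, with Jacobian `1 / squeezeD`.
  -- Written with `clamp`, `trunc` and `cap`, it is Lipschitz on the whole line as a combination of
  -- bounded Lipschitz factors.
  set H : Fin m → Fin m → ℝ → ℝ := fun i j r =>
    ((1 - ε * bump u δ r) * pathDeriv Φ (clamp m r) i j
      + 4 * ε * (trunc u δ r * cap u δ r) * (Φ r - Φ u) i j) * (squeezeD u δ ε r)⁻¹ with hH
  have hder : ∀ i j, ∀ t ∈ Icc (0 : ℝ) m, HasDerivWithinAt
      (fun t => VectorSpin.pull Φ u δ ε (e.symm t) i j) (H i j (e.symm t)) (Icc (0 : ℝ) m) t := by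
    intro i j t ht
    have hr' := hre.symm_mem_Icc ht
    have h1 : HasDerivWithinAt (fun s => Φ s i j) (pathDeriv Φ (e.symm t) i j) (Icc (0 : ℝ) m)
        (e.symm t) :=
      ((hS.contDiff i j).differentiableOn one_ne_zero _ hr').hasDerivWithinAt
    have h2 := (((hasDerivAt_bump (u := u) hr.pos (e.symm t)).const_mul ε).const_sub
      1).hasDerivWithinAt (s := Icc (0 : ℝ) m)
    have h3 := ((h2.mul (h1.sub_const (Φ u i j))).const_add (Φ u i j)).comp t
      (hre.hasDerivAt_symm t).hasDerivWithinAt fun s hs => hre.symm_mem_Icc hs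
    refine h3.congr_deriv ?_
    simp only [hH, clamp_of_mem hr', Matrix.sub_apply]
    ring
  have hpd : ∀ i j, ∀ t ∈ Icc (0 : ℝ) m,
      pathDeriv (fun t => VectorSpin.pull Φ u δ ε (e.symm t)) t i j = H i j (e.symm t) :=
    fun i j t ht => (hder i j t ht).derivWithin (uniqueDiffOn_Icc hmpos t ht)
  have hHl : ∀ i j, ∃ K : ℝ≥0, LipschitzWith K (H i j) := by
    intro i j
    have hP := lipschitzWith_comp_clamp (hL i j)
    obtain ⟨p, hp⟩ := (isCompact_Icc (a := (0 : ℝ)) (b := m)).exists_bound_of_continuousOn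
      (hL i j).continuousOn
    have hPb : ∀ t, |pathDeriv Φ (clamp m t) i j| ≤ p := fun t => hp _ (clamp_mem m t)
    have hb1 : ∀ t, |bump u δ t| ≤ 1 := fun t => by
      rw [abs_of_nonneg (bump_nonneg t)]; exact bump_le_one hr.pos hr.le_one t
    obtain ⟨K₁, hK₁⟩ := exists_lipschitzWith_const_mul ε
      (lipschitzWith_bump (u := u) hr.pos hr.le_one)
    have hκl : ∃ K : ℝ≥0, LipschitzWith K fun t => 1 - ε * bump u δ t :=
      ⟨0 + K₁, (LipschitzWith.const (1 : ℝ)).sub hK₁⟩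
    have hκb : ∀ t, |1 - ε * bump u δ t| ≤ 1 := fun t => by
      have h1 := bump_nonneg (u := u) (δ := δ) t
      have h2 := bump_le_one (u := u) hr.pos hr.le_one t
      rw [abs_le]; constructor <;> nlinarith
    obtain ⟨K₂, hK₂⟩ := exists_lipschitzWith_mul hκl ⟨L, hP⟩ hκb hPb
    have hz1 := abs_trunc_le_one (u := u) hr.pos hr.le_one
    have hp1 := abs_cap_le_one (u := u) hr.pos hr.le_one
    have hzl := exists_lipschitzWith_const_mul (4 * ε) (exists_lipschitzWith_mul
      (lipschitzWith_trunc u δ) (lipschitzWith_cap hr.pos hr.le_one (u := u)) hz1 hp1)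
    have hzb : ∀ t, |4 * ε * (trunc u δ t * cap u δ t)| ≤ 2 := fun t => by
      rw [abs_mul, abs_mul (trunc u δ t), abs_of_nonneg (by positivity : 0 ≤ 4 * ε)]
      have h1 : |trunc u δ t| * |cap u δ t| ≤ 1 := mul_le_one₀ (hz1 t) (abs_nonneg _) (hp1 t)
      have h2 : 0 ≤ |trunc u δ t| * |cap u δ t| := by positivity
      nlinarith
    have hDb : ∀ t, |(Φ t - Φ u) i j| ≤ 2 := fun t => hΦ.abs_sub_apply_le hQ t u i j
    obtain ⟨K₃, hK₃⟩ := exists_lipschitzWith_mul hzl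
      ⟨K + 0, (hK i j).sub (LipschitzWith.const (Φ u i j))⟩ hzb hDb
    have hlow := half_le_squeezeD (u := u) hr.pos hr.le_one hε hε1
    refine exists_lipschitzWith_mul (a := 1 * p + 2 * 2) (b := 2) ⟨K₂ + K₃, hK₂.add hK₃⟩
      (exists_lipschitzWith_inv (lipschitzWith_squeezeD (u := u) hr.pos hr.le_one ε) hlow)
      (fun t => ?_) fun t => ?_
    · refine (abs_add_le _ _).trans (add_le_add ?_ ?_)
      · rw [abs_mul]
        exact mul_le_mul (hκb t) (hPb t) (abs_nonneg _) zero_le_one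
      · rw [abs_mul]
        exact mul_le_mul (hzb t) (hDb t) (abs_nonneg _) zero_le_two
    · have h := hlow t
      rw [abs_of_nonneg (by positivity), inv_le_comm₀ (by linarith) (by norm_num)]
      linarith
  have hlip : ∃ K : ℝ≥0, ∀ i j, LipschitzOnWith K
      (fun t => pathDeriv (fun t => VectorSpin.pull Φ u δ ε (e.symm t)) t i j) (Icc (0 : ℝ) m) := by
    refine exists_uniform_lipschitzOnWith fun i j => ?_
    obtain ⟨K, hK⟩ := hHl i j
    exact ⟨K * 2, lipschitzOnWith_congr (hK.comp hre.lipschitzWith_symm).lipschitzOnWith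
      fun t ht => (hpd i j t ht).symm⟩
  refine { toIsMonotonePath := hg.isMonotonePath, contDiff := fun i j => ?_,
           lipschitz := ?_, lipschitz_deriv := hlip, trace := fun t ht => ?_ }
  · rw [contDiffOn_one_iff_derivWithin (uniqueDiffOn_Icc hmpos)]
    obtain ⟨K, hK⟩ := hlip
    exact ⟨fun t ht => (hder i j t ht).differentiableWithinAt, (hK i j).continuousOn⟩
  · obtain ⟨K, hK⟩ := hg.lipschitz
    exact ⟨K, fun i j => (hK i j).lipschitzOnWith⟩
  · rw [trace_pull Φ (hS.trace u hu) (hS.trace _ (mem_support_map e ht))]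
    exact e.apply_symm_apply t

/-- Tilted measures are absolutely continuous with respect to `μ`, so their support is no larger and
the trace condition survives. -/
theorem IsSmoothPath.of_support_subset {ν : Measure ℝ} (hS : IsSmoothPath Q μ Φ)
    (h : ν.support ⊆ μ.support) : IsSmoothPath Q ν Φ :=
  { hS with trace := fun t ht => hS.trace t (h ht) }

theorem IsTracePath.pull (hQ : IsConstraint Q) (hS : IsTracePath Q Φ) (hΦ : GlobalPath Q Φ)
    (hr : GoodRadius u δ T) (hT : T ≤ m) (hε : 0 ≤ ε) (hε1 : ε ≤ 1 / 2) :
    IsTracePath Q fun t =>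
      VectorSpin.pull Φ u δ ε ((squeezeIso (u := u) hr.pos hr.le_one hε hε1).symm t) := by
  have hre := isReparam_squeezeIso (m := m) hr hT hε hε1
  refine ((globalPath_pull hQ hΦ hr hT hε hε1).reparam hre).isTracePath fun t ht => ?_
  have hu : u ∈ Icc (0 : ℝ) m := ⟨hr.nonneg, by linarith [hr.right, hr.pos]⟩
  rw [trace_pull Φ (hS.trace u hu) (hS.trace _ (hre.symm_mem_Icc ht))]
  exact (squeezeIso (u := u) hr.pos hr.le_one hε hε1).apply_symm_apply t

end Smooth

/-! ### Independence of the values outside `[0, m]`, and existence of a cut point -/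

section Congr

variable {Q : Matrix (Fin m) (Fin m) ℝ} {μ : Measure ℝ} {Φ Ψ : ℝ → Matrix (Fin m) (Fin m) ℝ}

theorem pathDeriv_congr (h : EqOn Φ Ψ (Icc (0 : ℝ) m)) {t : ℝ} (ht : t ∈ Icc (0 : ℝ) m) :
    pathDeriv Φ t = pathDeriv Ψ t := by
  ext i j
  exact derivWithin_congr (fun s hs => by rw [h hs]) (by rw [h ht])

theorem hatPath_congr (h : EqOn Φ Ψ (Icc (0 : ℝ) m)) {t : ℝ} (ht : t ∈ Icc (0 : ℝ) m) :
    hatPath μ Φ t = hatPath μ Ψ t := by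
  ext i j
  refine intervalIntegral.integral_congr fun s hs => ?_
  rw [uIcc_of_le ht.2] at hs
  simp only [pathDeriv_congr h ⟨ht.1.trans hs.1, hs.2⟩]

theorem crisantiSommers_congr (β : ℕ → Fin m → ℝ) (k : Fin m → ℝ)
    (h : EqOn Φ Ψ (Icc (0 : ℝ) m)) {T : ℝ} (hT : T ∈ Icc (0 : ℝ) m) :
    crisantiSommers β k T μ Φ = crisantiSommers β k T μ Ψ := by
  have hm0 : (0 : ℝ) ≤ m := Nat.cast_nonneg m
  unfold crisantiSommers
  rw [h ⟨hm0, le_rfl⟩, h hT]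
  congr 2
  · congr 1
    refine intervalIntegral.integral_congr fun s hs => ?_
    rw [uIcc_of_le hm0] at hs
    simp only [pathDeriv_congr h hs, h hs]
  · refine intervalIntegral.integral_congr fun s hs => ?_
    rw [uIcc_of_le hT.1] at hs
    have hs' : s ∈ Icc (0 : ℝ) m := ⟨hs.1, hs.2.trans hT.2⟩
    simp only [pathDeriv_congr h hs', hatPath_congr h hs']

theorem IsPair.distr_top (hp : IsPair Q μ Φ) : distr μ m = 1 := by
  have := hp.prob
  have h := (prob_compl_eq_zero_iff measurableSet_Icc).mp hp.compl
  simp [distr, measureReal_def, h]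

theorem IsPair.topPoint_mem (hp : IsPair Q μ Φ) : topPoint m μ ∈ Icc (0 : ℝ) m :=
  ⟨le_csInf ⟨m, ⟨Nat.cast_nonneg m, le_rfl⟩, hp.distr_top⟩ fun _ ht => ht.1.1, hp.topPoint_lt.le⟩

theorem IsPair.congr (hp : IsPair Q μ Φ) (h : EqOn Φ Ψ (Icc (0 : ℝ) m)) : IsPair Q μ Ψ :=
  ⟨hp.prob, hp.compl, hp.topPoint_lt, by rw [← h hp.topPoint_mem]; exact hp.det_pos⟩

theorem IsMonotonePath.congr (hp : IsMonotonePath Q Φ) (h : EqOn Φ Ψ (Icc (0 : ℝ) m)) :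
    IsMonotonePath Q Ψ where
  posSemidef t ht := by rw [← h ht]; exact hp.posSemidef t ht
  mono s hs t ht hst := by rw [← h ht, ← h hs]; exact hp.mono s hs t ht hst
  zero := by rw [← h ⟨le_rfl, Nat.cast_nonneg m⟩]; exact hp.zero
  top := by rw [← h ⟨Nat.cast_nonneg m, le_rfl⟩]; exact hp.top

theorem IsTracePath.congr (hp : IsTracePath Q Φ) (h : EqOn Φ Ψ (Icc (0 : ℝ) m)) :
    IsTracePath Q Ψ where
  toIsMonotonePath := hp.toIsMonotonePath.congr h
  lipschitz i j := lipschitzOnWith_congr (hp.lipschitz i j) fun t ht => by simp only [h ht]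
  trace t ht := by rw [← h ht]; exact hp.trace t ht

theorem IsSmoothPath.congr (hp : IsSmoothPath Q μ Φ) (h : EqOn Φ Ψ (Icc (0 : ℝ) m))
    (hμ : μ.support ⊆ Icc (0 : ℝ) m) : IsSmoothPath Q μ Ψ where
  toIsMonotonePath := hp.toIsMonotonePath.congr h
  contDiff i j := (hp.contDiff i j).congr fun t ht => by rw [h ht]
  lipschitz := by
    obtain ⟨K, hK⟩ := hp.lipschitz
    exact ⟨K, fun i j => lipschitzOnWith_congr (hK i j) fun t ht => by simp only [h ht]⟩
  lipschitz_deriv := by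
    obtain ⟨K, hK⟩ := hp.lipschitz_deriv
    exact ⟨K, fun i j => lipschitzOnWith_congr (hK i j) fun t ht => by
      simp only [pathDeriv_congr h ht]⟩
  trace t ht := by rw [← h (hμ ht)]; exact hp.trace t ht

theorem IsMonotonePath.globalPath (hp : IsMonotonePath Q Φ)
    (hl : ∃ K : ℝ≥0, ∀ i j, LipschitzOnWith K (fun t => Φ t i j) (Icc (0 : ℝ) m)) :
    GlobalPath Q fun t => Φ (clamp m t) where
  lipschitz := by
    obtain ⟨K, hK⟩ := hl
    exact ⟨K, fun i j => lipschitzWith_comp_clamp (hK i j)⟩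
  mono s t hst := hp.mono _ (clamp_mem m s) _ (clamp_mem m t) (clamp_mono m hst)
  eq_zero t ht := by
    have : clamp m t = 0 := max_eq_left ((min_le_right _ _).trans ht)
    rw [this, hp.zero]
  eq_top t ht := by
    have : clamp m t = m := by
      rw [clamp, min_eq_left ht, max_eq_right (Nat.cast_nonneg m)]
    rw [this, hp.top]

theorem eqOn_clamp (Φ : ℝ → Matrix (Fin m) (Fin m) ℝ) :
    EqOn Φ (fun t => Φ (clamp m t)) (Icc (0 : ℝ) m) := fun t ht => by
  simp only [clamp_of_mem ht]

/-- A point `T` at which the functional of a pair can be written down. -/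
theorem IsPair.exists_cutPair (hp : IsPair Q μ Φ) (hΦ : GlobalPath Q Φ) :
    ∃ T a, CutPair Q μ Φ T ∧ a ∈ Icc (0 : ℝ) m ∧ a < T ∧ distr μ a = 1 := by
  have := hp.prob
  have hc : Continuous fun t => (Q - Φ t).det :=
    Continuous.matrix_det (continuous_matrix fun i j =>
      continuous_const.sub (hΦ.continuous_apply i j))
  have h1 : ∀ᶠ t in 𝓝[>] (topPoint m μ), 0 < (Q - Φ t).det :=
    (hc.tendsto _).mono_left nhdsWithin_le_nhds |>.eventually (lt_mem_nhds hp.det_pos)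
  have h2 : ∀ᶠ t in 𝓝[>] (topPoint m μ), t ∈ Ioo (topPoint m μ) (m : ℝ) :=
    Ioo_mem_nhdsGT hp.topPoint_lt
  obtain ⟨T, hT1, hT2⟩ := (h1.and h2).exists
  -- The infimum need not be known to be attained: any `a < T` with `x(a) = 1` shows that `μ` lives
  -- on `[0, T]`.
  obtain ⟨a, ⟨ha1, ha2⟩, haT⟩ := exists_lt_of_csInf_lt
    (⟨m, ⟨Nat.cast_nonneg m, le_rfl⟩, hp.distr_top⟩ :
      {t : ℝ | t ∈ Icc (0 : ℝ) m ∧ distr μ t = 1}.Nonempty) hT2.1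
  refine ⟨T, a, ⟨hΦ, hp.prob, ?_, ha1.1.trans_lt haT, hT2.2,
    posDef_of_det_pos (hΦ.le_top T) hT1⟩, ha1, haT, ha2⟩
  have h3 : μ (Icc 0 a) = 1 := by
    rw [distr, measureReal_def] at ha2
    rw [← ENNReal.ofReal_toReal (measure_ne_top μ (Icc 0 a)), ha2, ENNReal.ofReal_one]
  exact measure_mono_null (compl_subset_compl.mpr (Icc_subset_Icc_right haT.le))
    ((prob_compl_eq_zero_iff measurableSet_Icc).mpr h3)

end Congr

/-! ### Minimality and the existence of an atom -/

section Minimizer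

variable {β : ℕ → Fin m → ℝ} {h : Fin m → ℝ} {Q : Matrix (Fin m) (Fin m) ℝ} {μ ν : Measure ℝ}
  {Φ Ψ : ℝ → Matrix (Fin m) (Fin m) ℝ} {u δ T a : ℝ}
  {𝒜 : Measure ℝ → (ℝ → Matrix (Fin m) (Fin m) ℝ) → Prop}

theorem measure_Icc_compl_of_distr_eq_one [IsProbabilityMeasure μ] (ha : distr μ a = 1) :
    μ (Icc 0 a)ᶜ = 0 := by
  rw [prob_compl_eq_zero_iff measurableSet_Icc,
    ← ENNReal.ofReal_toReal (measure_ne_top μ (Icc 0 a)), ← measureReal_def]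
  rw [distr] at ha
  rw [ha, ENNReal.ofReal_one]

theorem distr_eq_one [IsProbabilityMeasure μ] (ha : μ (Icc 0 a)ᶜ = 0) : distr μ a = 1 := by
  rw [distr, measureReal_def, (prob_compl_eq_zero_iff measurableSet_Icc).mp ha, ENNReal.toReal_one]

theorem support_subset_Icc {b : ℝ} (hb : μ (Icc 0 b)ᶜ = 0) : μ.support ⊆ Icc 0 b :=
  Measure.support_subset_of_isClosed isClosed_Icc hb

theorem IsMinimizer.congr (hmin : IsMinimizer β h Q 𝒜 μ Φ) (hp : IsPair Q μ Φ)
    (hΨ : 𝒜 μ Ψ) (hΦΨ : EqOn Φ Ψ (Icc (0 : ℝ) m)) : IsMinimizer β h Q 𝒜 μ Ψ := by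
  refine ⟨hΨ, fun ν Θ hΘ T S hT hS => ?_⟩
  have hTm : T ∈ Icc (0 : ℝ) m := ⟨hp.topPoint_mem.1.trans hT.1.le, hT.2.1.le⟩
  rw [← crisantiSommers_congr β h hΦΨ hTm]
  exact hmin.2 ν Θ hΘ T S ⟨hT.1, hT.2.1, by rw [hΦΨ hTm]; exact hT.2.2⟩ hS

/-- With a common cut point and `Ψ(T) = Φ(T)`, the terms `log|Q - Φ(T)|` cancel and the comparison
concerns `reduced` alone. -/
theorem IsMinimizer.reduced_le (hβ : IsMixedEvenModel β) (hQ : IsConstraint Q)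
    (hmin : IsMinimizer β h Q 𝒜 μ Φ) (hp : CutPair Q μ Φ T) (ha : a ∈ Icc (0 : ℝ) m) (haT : a < T)
    (ha1 : distr μ a = 1) (hq : CutPair Q ν Ψ T) {b : ℝ} (hb : b ∈ Icc (0 : ℝ) m) (hbT : b < T)
    (hb1 : distr ν b = 1) (hT : Ψ T = Φ T) (h𝒜 : IsPair Q ν Ψ → 𝒜 ν Ψ) :
    reduced β h Q μ Φ T ≤ reduced β h Q ν Ψ T := by
  have h1 := hmin.2 ν Ψ (h𝒜 (hq.isPair hb hbT hb1)) T T (hp.isCutoff ha haT ha1)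
    (hq.isCutoff hb hbT hb1)
  rw [hp.crisantiSommers_eq_reduced hβ h hQ, hq.crisantiSommers_eq_reduced hβ h hQ, hT] at h1
  linarith

theorem IsMinimizer.reduced_le_tilt (hβ : IsMixedEvenModel β) (hQ : IsConstraint Q)
    (hmin : IsMinimizer β h Q 𝒜 μ Φ) (hp : CutPair Q μ Φ T) (ha : a ∈ Icc (0 : ℝ) m) (haT : a < T)
    (ha1 : distr μ a = 1) {w : ℝ → ℝ} {W ε : ℝ} (hw : Measurable w) (hW : ∀ s, |w s| ≤ W)
    (h0 : ∫ s, w s ∂μ = 0) (hε : 0 < ε) (hεW : ε * W ≤ 1)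
    (h𝒜 : ∀ ν, ν ≪ μ → IsPair Q ν Φ → 𝒜 ν Φ) :
    reduced β h Q μ Φ T ≤ reduced β h Q (tilt μ w ε) Φ T := by
  have := hp.prob
  have hq : CutPair Q (tilt μ w ε) Φ T := hp.tilt hw hW (by rwa [abs_of_pos hε]) h0
  have := hq.prob
  have hac := tilt_absolutelyContinuous μ w ε
  exact hmin.reduced_le hβ hQ hp ha haT ha1 hq ha haT
    (distr_eq_one (hac (measure_Icc_compl_of_distr_eq_one ha1))) rfl (h𝒜 _ hac)

/-- The pulled path itself need not satisfy the trace condition. The competitor is its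
reparametrization, with the image measure, and `reduced_reparam` carries the inequality back. -/
theorem IsMinimizer.reduced_le_pull (hβ : IsMixedEvenModel β) (hQ : IsConstraint Q)
    (hmin : IsMinimizer β h Q 𝒜 μ Φ) (hp : CutPair Q μ Φ T) (ha : a ∈ Icc (0 : ℝ) m) (haT : a < T)
    (ha1 : distr μ a = 1) (hr : GoodRadius u δ T) {ε : ℝ} (hε : 0 ≤ ε) (hε1 : ε ≤ 1 / 2)
    (h𝒜 : IsPair Q (μ.map (squeezeIso (u := u) hr.pos hr.le_one hε hε1))
        (fun t => pull Φ u δ ε ((squeezeIso (u := u) hr.pos hr.le_one hε hε1).symm t)) →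
      𝒜 (μ.map (squeezeIso (u := u) hr.pos hr.le_one hε hε1))
        (fun t => pull Φ u δ ε ((squeezeIso (u := u) hr.pos hr.le_one hε hε1).symm t))) :
    reduced β h Q μ Φ T ≤ reduced β h Q μ (pull Φ u δ ε) T := by
  have he := isReparam_squeezeIso (m := m) hr hp.lt.le hε hε1
  have hq := hp.pull hQ hr hε hε1
  have heT := he.cut
  have he0 := he.zero
  have hem := he.symm_cut
  set e := squeezeIso (u := u) hr.pos hr.le_one hε hε1 with hedef
  have hlt : e a < T := by
    rw [← heT]
    exact e.strictMono haT
  rw [← reduced_reparam β h hq he]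
  refine hmin.reduced_le hβ hQ hp ha haT ha1 (hq.reparam he) (b := e a)
    ⟨?_, hlt.le.trans hp.lt.le⟩ hlt ((distr_map he μ a).trans ha1) ?_ h𝒜
  · rw [← he0]
    exact e.monotone ha.1
  · rw [hem, pull_eq_self Φ hr.pos ε (hr.le_abs_of_ge le_rfl)]

/-- A point of the support at which the stability form is negative is an atom. -/
theorem IsMinimizer.measure_singleton_ne_zero (hβ : IsMixedEvenModel β) (hQ : IsConstraint Q)
    (hmin : IsMinimizer β h Q 𝒜 μ Φ) (hΦ : GlobalPath Q Φ) (hpair : IsPair Q μ Φ)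
    (htilt : ∀ ν, ν ≪ μ → IsPair Q ν Φ → 𝒜 ν Φ)
    (hpull : ∀ δ T (hr : GoodRadius u δ T) ε (hε : 0 ≤ ε) (hε1 : ε ≤ 1 / 2), T ≤ m →
      IsPair Q (μ.map (squeezeIso (u := u) hr.pos hr.le_one hε hε1))
        (fun t => pull Φ u δ ε ((squeezeIso (u := u) hr.pos hr.le_one hε hε1).symm t)) →
      𝒜 (μ.map (squeezeIso (u := u) hr.pos hr.le_one hε hε1))
        (fun t => pull Φ u δ ε ((squeezeIso (u := u) hr.pos hr.le_one hε hε1).symm t)))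
    (hu : u ∈ μ.support)
    (hdiff : ∀ i j, DifferentiableWithinAt ℝ (fun t => Φ t i j) (Icc (0 : ℝ) m) u)
    (hlt : stabForm β Q (pathDeriv Φ u) < 0) : μ {u} ≠ 0 := by
  intro hμu
  have := hpair.prob
  obtain ⟨T, a, hp, ha, haT, ha1⟩ := hpair.exists_cutPair hΦ
  have hua := support_subset_Icc (measure_Icc_compl_of_distr_eq_one ha1) hu
  have huT : u < T := hua.2.trans_lt haT
  have hconst : ∀ s ∈ μ.support, massDeriv β h Q μ Φ T s = massDeriv β h Q μ Φ T u :=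
    fun s hs => hp.massDeriv_eq_of_mem_support hβ h hQ (fun w W ε hw hW h0 hε hεW =>
      hmin.reduced_le_tilt hβ hQ hp ha haT ha1 hw hW h0 hε hεW htilt) hs hu
  obtain ⟨δ₀, hδ₀, hneg⟩ := hp.exists_pullDeriv_neg hβ h hQ ⟨hua.1, huT.le⟩ hdiff hlt
  obtain ⟨δ, hδδ₀, hr⟩ : ∃ δ ≤ δ₀, GoodRadius u δ T := by
    by_cases hu0 : u = 0
    · exact ⟨min δ₀ (min 1 (T - u)), min_le_left _ _,
        lt_min hδ₀ (lt_min one_pos (sub_pos.mpr huT)),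
        (min_le_right _ _).trans (min_le_left _ _), hua.1, Or.inl hu0, by
          linarith [(min_le_right δ₀ (min 1 (T - u))).trans (min_le_right _ _)]⟩
    · refine ⟨min (min δ₀ u) (min 1 (T - u)), (min_le_left _ _).trans (min_le_left _ _),
        lt_min (lt_min hδ₀ (lt_of_le_of_ne hua.1 (Ne.symm hu0)))
          (lt_min one_pos (sub_pos.mpr huT)),
        (min_le_right _ _).trans (min_le_left _ _), hua.1,
        Or.inr ((min_le_left _ _).trans (min_le_right _ _)), ?_⟩
      linarith [(min_le_right (min δ₀ u) (min 1 (T - u))).trans (min_le_right _ _)]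
  obtain ⟨hint, hnonneg⟩ := hp.integral_bump_pullDeriv_nonneg hβ h hQ hr fun ε hε hε1 =>
    hmin.reduced_le_pull hβ hQ hp ha haT ha1 hr hε.le hε1 (hpull δ T hr ε hε.le hε1 hp.lt.le)
  -- Here the assumption `μ {u} = 0` enters: it discards `s = u`, the one nearby point where
  -- `pullDeriv` vanishes instead of being negative.
  have hsign : ∀ᵐ s ∂μ, s ≠ u ∧ (|s - u| < δ → pullDeriv β h Q μ Φ T u s < 0) := by
    have h1 : ∀ᵐ s ∂μ, s ≠ u := by
      rw [ae_iff]
      simpa using hμu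
    filter_upwards [h1, (Measure.support_mem_ae : μ.support ∈ ae μ)] with s hsu hs
    have hsa := support_subset_Icc hp.compl hs
    exact ⟨hsu, fun hd => hneg s hsa (hd.trans_le hδδ₀) hsu (hconst s hs)⟩
  have hle : ∀ᵐ s ∂μ, 0 ≤ -(bump u δ s * pullDeriv β h Q μ Φ T u s) := by
    filter_upwards [hsign] with s hs
    by_cases hd : |s - u| < δ
    · exact neg_nonneg.mpr (mul_nonpos_of_nonneg_of_nonpos (bump_nonneg s) (hs.2 hd).le)
    · rw [bump_eq_zero hr.pos (not_lt.mp hd)]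
      simp
  -- A nonnegative function with nonpositive integral vanishes almost everywhere. On the ball of
  -- radius `δ` it is almost everywhere strictly positive, so that ball is null, against `u` being
  -- in the support.
  have hzero := (integral_eq_zero_iff_of_nonneg_ae hle hint.neg).mp (le_antisymm (by
    rw [integral_neg]
    linarith) (integral_nonneg_of_ae hle))
  have hball : ∀ᵐ s ∂μ, s ∉ Metric.ball u δ := by
    filter_upwards [hsign, hzero] with s hs hz hmem
    rw [Metric.mem_ball, Real.dist_eq] at hmem
    have h2 := mul_neg_of_pos_of_neg (bump_pos hr.pos hmem) (hs.2 hmem)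
    have h3 : -(bump u δ s * pullDeriv β h Q μ Φ T u s) = 0 := hz
    linarith
  rw [Measure.mem_support_iff_forall] at hu
  refine (hu _ (Metric.ball_mem_nhds u hr.pos)).ne' ?_
  exact (measure_eq_zero_iff_ae_notMem).mpr hball

end Minimizer

/-! ### From an atom to a jump -/

/-- The distribution function jumps at every atom in the half-line `t ≥ 0`. -/
theorem hasJumpAt_distr {μ : Measure ℝ} [IsFiniteMeasure μ] {u : ℝ} (hu : 0 ≤ u)
    (h : μ {u} ≠ 0) : HasJumpAt (distr μ) u := by
  have hmono := distr_mono μ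
  have hl := hmono.tendsto_nhdsLT u
  have hr := hmono.tendsto_nhdsGT u
  refine ⟨_, _, hl, hr, fun heq => h ?_⟩
  -- This includes `s < 0`, where `Icc 0 s` is empty, so the left limit at `u = 0` is covered.
  have hgap : ∀ s < u, distr μ s + μ.real {u} ≤ distr μ u := fun s hs => by
    rw [distr, distr, ← measureReal_union _ (measurableSet_singleton u)]
    · refine measureReal_mono (union_subset (Icc_subset_Icc_right hs.le) ?_)
      rintro _ rfl
      exact ⟨hu, le_rfl⟩
    · rw [disjoint_singleton_right]
      exact fun hmem => (hmem.2.trans_lt hs).false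
  have h1 : sSup (distr μ '' Iio u) + μ.real {u} ≤ distr μ u :=
    le_of_tendsto (hl.add_const _) (eventually_nhdsWithin_of_forall hgap)
  have h2 : distr μ u ≤ sInf (distr μ '' Ioi u) :=
    ge_of_tendsto hr (eventually_nhdsWithin_of_forall fun t ht => hmono (le_of_lt ht))
  have h3 : μ.real {u} = 0 := le_antisymm (by linarith) measureReal_nonneg
  rwa [measureReal_eq_zero_iff] at h3

end VectorSpin

end

/-! ### The proposition for both classes -/

theorem mainTheorem10 {m : ℕ} (hm : 1 ≤ m)
    (β : ℕ → Fin m → ℝ) (hβ : VectorSpin.IsMixedEvenModel β)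
    (h : Fin m → ℝ)
    (Q : Matrix (Fin m) (Fin m) ℝ) (hQ : VectorSpin.IsConstraint Q)
    (μP : Measure ℝ) (Φ : ℝ → Matrix (Fin m) (Fin m) ℝ)
    (hmin : VectorSpin.IsMinimizer β h Q (VectorSpin.TracePair Q) μP Φ ∨
      VectorSpin.IsMinimizer β h Q (VectorSpin.SmoothPair Q) μP Φ)
    (u₀ : ℝ) (hu₀ : u₀ ∈ μP.support)
    (hdiff : ∀ i j, DifferentiableWithinAt ℝ (fun t => Φ t i j) (Icc (0 : ℝ) m) u₀)
    (hlt : VectorSpin.pairing (VectorSpin.xiDD β Q)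
        (VectorSpin.pathDeriv Φ u₀ ⊙ VectorSpin.pathDeriv Φ u₀) <
      VectorSpin.pairing (Q⁻¹ * VectorSpin.pathDeriv Φ u₀) (Q⁻¹ * VectorSpin.pathDeriv Φ u₀)) :
    VectorSpin.HasJumpAt (VectorSpin.distr μP) u₀ := by
  -- The path is replaced by its constant extension outside `[0, m]`, which changes neither the
  -- functional nor membership in the class.
  have heq := VectorSpin.eqOn_clamp Φ
  have hpair : VectorSpin.IsPair Q μP Φ := hmin.elim (fun H => H.1.1) fun H => H.1.1
  have := hpair.prob
  have hsupp := VectorSpin.support_subset_Icc hpair.compl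
  have hu := hsupp hu₀
  have hpairc := hpair.congr heq
  have hdiffc : ∀ i j, DifferentiableWithinAt ℝ (fun t => Φ (VectorSpin.clamp m t) i j)
      (Icc (0 : ℝ) m) u₀ :=
    fun i j => (hdiff i j).congr (fun t ht => by rw [VectorSpin.clamp_of_mem ht])
      (by rw [VectorSpin.clamp_of_mem hu])
  have hltc : VectorSpin.stabForm β Q
      (VectorSpin.pathDeriv (fun t => Φ (VectorSpin.clamp m t)) u₀) < 0 := by
    rw [← VectorSpin.pathDeriv_congr heq hu]
    exact sub_neg.mpr hlt
  refine VectorSpin.hasJumpAt_distr hu.1 ?_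
  -- The class enters only through its stability under tilting the measure and under pulling
  -- followed by reparametrization.
  rcases hmin with H | H
  · have htr := H.1.2.congr heq
    have hΦ := H.1.2.toIsMonotonePath.globalPath ⟨1, H.1.2.lipschitz⟩
    exact (H.congr hpair ⟨hpairc, htr⟩ heq).measure_singleton_ne_zero hβ hQ hΦ hpairc
      (fun ν _ hν => ⟨hν, htr⟩)
      (fun δ T hr ε hε hε1 hT hν => ⟨hν, htr.pull hQ hΦ hr hT hε hε1⟩) hu₀ hdiffc hltc
  · have hsm := H.1.2.congr heq hsupp
    have hΦ := H.1.2.toIsMonotonePath.globalPath H.1.2.lipschitz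
    exact (H.congr hpair ⟨hpairc, hsm⟩ heq).measure_singleton_ne_zero hβ hQ hΦ hpairc
      (fun ν hac hν => ⟨hν, hsm.of_support_subset hac.support_mono⟩)
      (fun δ T hr ε hε hε1 hT hν => ⟨hν, hsm.pull hQ hΦ hu₀ hr hT hε hε1⟩) hu₀ hdiffc hltc
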